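/- **Setting.** Let $(\varepsilon_n)_{n\in\mathbb Z}$ be i.i.d. random variables with values in a measurable space $S$, let $g:S^{\mathbb N}\to L^2[0,1]$ be measurable, and let $(X_n)_{n\in\mathbb Z}$ be the functional time series $X_n=g(\varepsilon_n,\varepsilon_{n-1},\dots)$ of random functions $X_n:[0,1]\to\mathbb R$, where $X_n(t,\omega)$ is jointly measurable in $(t,\omega)$. Let $\|\cdot\|$ be the norm of $L^2[0,1]$. Assume that * $\mathbb E X_0=0$ and $\mathbb E\|X_0\|^{4+\delta}<\infty$ for some $\delta\in(0,1)$; * ($m$-approximability) for all $n$ and $m$ there are i.i.d. copies $(\varepsilon^*_{n,m,k})_{k\in\mathbb Z}$ of $\varepsilon_0$, independent of $(\varepsilon_k)_{k\in\mathbb Z}$, such that with $X_{n,m}:=g(\varepsilon_n,\dots,\varepsilon_{n-m+1},\varepsilon^*_{n,m,n-m},\varepsilon^*_{n,m,n-m-1},\dots)$ one has, for all $n$, $$\sum_{m\ge1}\big(\mathbb E\|X_n-X_{n,m}\|^{4+\delta}\big)^{1/\kappa}<\infty$$ for some $\delta\in(0,1)$ and some $\kappa>4+\delta$ that do not depend on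 $n$. Let $c(s,t)=\mathbb E[X_1(s)X_1(t)]$ be the covariance kernel, and let $\tau_1\ge\tau_2\ge\cdots$ be the eigenvalues, counted with multiplicity, of the integral operator on $L^2[0,1]$ with kernel $c$. Assume that $\tau_1>\tau_2>\dots>\tau_{p+1}>0$ for some $p\in\mathbb N$, and let $v_1,\dots,v_p$ be eigenfunctions with $\|v_j\|=1$ for the eigenvalues $\tau_1,\dots,\tau_p$. For $N\in\mathbb N$ and $\lambda\in[0,1]$ put $$\hat c(\lambda,s,t)=\frac1{\lfloor N\lambda\rfloor}\sum_{n=1}^{\lfloor N\lambda\rfloor}X_n(s)X_n(t),\qquad \hat Z_N(s,t,\lambda)=\frac1{\sqrt N}\sum_{n=1}^{\lfloor N\lambda\rfloor}\big(X_n(s)X_n(t)-c(s,t)\big),$$ with $\hat c(\lambda,\cdot,\cdot)=0$ if $\lfloor N\lambda\rfloor=0$, and let $\hat\tau_{1,\lambda}\ge\hat\tau_{2,\lambda}\ge\cdots$ be the eigenvalues, counted with multiplicity, of the integral operator with kernel $\hat c(\lambda,\cdot,\cdot)$. **Proposition B.2.** For every $j\in\{1,\dots,p\}$, as $N\to\infty$,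 $$\sup_{\lambda\in[0,1]}\Big|\lambda(\hat\tau_{j,\lambda}-\tau_j)-\frac1{\sqrt N}\int_0^1\!\!\int_0^1\hat Z_N(s,t,\lambda)\,v_j(s)\,v_j(t)\,ds\,dt\Big|=o_P\big(1/\sqrt N\big),$$ and $$\sup_{\lambda\in[0,1]}\big|\sqrt\lambda\,(\hat\tau_{j,\lambda}-\tau_j)\big|=O_P\big(\log(N)^{1/\kappa}/\sqrt N\big).$$ -/

import Mathlib

open MeasureTheory ProbabilityTheory Filter Topology Set
open scoped ENNReal

noncomputable section

/-- The Hilbert space `L²[0,1]` of real functions, up to equality almost everywhere. -/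
abbrev L2I : Type := Lp ℝ 2 (volume : Measure unitInterval)

/-- `(ε_n, ε_{n-1}, ε_{n-2}, …)`. -/
def past {Ω S : Type*} (ε : ℤ → Ω → S) (n : ℤ) (ω : Ω) : ℕ → S :=
  fun k => ε (n - k) ω

/-- `(ε_n, …, ε_{n-m+1}, ε'_{n-m}, ε'_{n-m-1}, …)`. -/
def coupledPast {Ω S : Type*} (ε ε' : ℤ → Ω → S) (n : ℤ) (m : ℕ) (ω : Ω) : ℕ → S :=
  fun k => if k < m then ε (n - k) ω else ε' (n - k) ω

/-- `ε'` is a sequence of i.i.d. copies of `ε_0`, independent of the sequence `ε`. -/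
structure IsIndepCopy {Ω S : Type*} [MeasurableSpace Ω] [MeasurableSpace S] (P : Measure Ω)
    (ε ε' : ℤ → Ω → S) : Prop where
  iIndep : iIndepFun ε' P
  identDistrib : ∀ k, IdentDistrib (ε' k) (ε 0) P P
  measurable : ∀ k, Measurable (ε' k)
  indep : IndepFun (fun ω k => ε k ω) (fun ω k => ε' k ω) P

/-- The functional time series `(X_n)` (with paths `X n ω : [0,1] → ℝ`) is a centered Bernoulli
shift `X_n = g(ε_n, ε_{n-1}, …)` with values in `L²[0,1]`, has `4 + δ` moments, and is
`m`-approximable with exponent `κ`. -/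
structure IsApproximableSeries {Ω S : Type*} [MeasurableSpace Ω] [MeasurableSpace S]
    (P : Measure Ω) (ε : ℤ → Ω → S) (g : (ℕ → S) → L2I) (X : ℤ → Ω → unitInterval → ℝ)
    (κ : ℝ) : Prop where
  measurable_innovation : ∀ n, Measurable (ε n)
  iIndep_innovation : iIndepFun ε P
  identDistrib_innovation : ∀ n, IdentDistrib (ε n) (ε 0) P P
  measurable_shift : @Measurable (ℕ → S) L2I _ (borel L2I) g
  eq_shift : ∀ n, ∀ᵐ ω ∂P, X n ω =ᵐ[volume] g (past ε n ω)
  jointly_measurable : ∀ n, Measurable (fun z : unitInterval × Ω => X n z.2 z.1)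
  centered : ∀ᵐ t : unitInterval, ∫ ω, X 0 ω t ∂P = 0
  moment : ∃ δ : ℝ, 0 < δ ∧ δ < 1 ∧
    ∫⁻ ω, (eLpNorm (X 0 ω) 2 volume) ^ (4 + δ) ∂P < ∞
  approximable : ∃ ε' : ℤ → ℕ → ℤ → Ω → S, (∀ n m, IsIndepCopy P ε (ε' n m)) ∧
    ∃ δ : ℝ, 0 < δ ∧ δ < 1 ∧ 4 + δ < κ ∧ ∀ n,
      ∑' m : ℕ, (∫⁻ ω, ‖g (past ε n ω) - g (coupledPast ε (ε' n (m + 1)) n (m + 1) ω)‖ₑ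
        ^ (4 + δ) ∂P) ^ (1 / κ) < ∞

/-- The covariance kernel `c(s,t) = E[X_1(s) X_1(t)]`. -/
def covKernel {Ω : Type*} [MeasurableSpace Ω] (P : Measure Ω) (X : ℤ → Ω → unitInterval → ℝ)
    (s t : unitInterval) : ℝ :=
  ∫ ω, X 1 ω s * X 1 ω t ∂P

/-- The sequential empirical covariance kernel
`ĉ(r,s,t) = ⌊N r⌋⁻¹ ∑_{n = 1}^{⌊N r⌋} X_n(s) X_n(t)`, which is `0` if `⌊N r⌋ = 0`. -/
def empKernel {Ω : Type*} (X : ℤ → Ω → unitInterval → ℝ) (N : ℕ) (r : ℝ) (ω : Ω)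
    (s t : unitInterval) : ℝ :=
  (⌊(N : ℝ) * r⌋₊ : ℝ)⁻¹ * ∑ n ∈ Finset.Icc 1 ⌊(N : ℝ) * r⌋₊, X (n : ℤ) ω s * X (n : ℤ) ω t

/-- `Ẑ_N(s,t,r) = N^{-1/2} ∑_{n = 1}^{⌊N r⌋} (X_n(s) X_n(t) - c(s,t))`. -/
def seqProcess {Ω : Type*} [MeasurableSpace Ω] (P : Measure Ω) (X : ℤ → Ω → unitInterval → ℝ)
    (N : ℕ) (r : ℝ) (ω : Ω) (s t : unitInterval) : ℝ :=
  (1 / √(N : ℝ)) *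
    ∑ n ∈ Finset.Icc 1 ⌊(N : ℝ) * r⌋₊, (X (n : ℤ) ω s * X (n : ℤ) ω t - covKernel P X s t)

/-- `f` satisfies the eigenvalue equation `∫ k(·,t) f(t) dt = ν f` in `L²[0,1]`. -/
def IsEigenfunction (k : unitInterval → unitInterval → ℝ) (ν : ℝ) (f : L2I) : Prop :=
  ∀ᵐ s : unitInterval, ∫ t, k s t * f t = ν * f s

/-- The `j`-th largest eigenvalue (`j ≥ 1`), counted with multiplicity, of the integral operator
on `L²[0,1]` with the symmetric positive semidefinite square integrable kernel `k`: the largest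
`μ` such that there are `j` orthonormal eigenfunctions with eigenvalues at least `μ`. -/
def kernelEigenvalue (k : unitInterval → unitInterval → ℝ) (j : ℕ) : ℝ :=
  sSup {μ : ℝ | ∃ (f : Fin j → L2I) (ν : Fin j → ℝ), Orthonormal ℝ f ∧
    ∀ i, IsEigenfunction k (ν i) (f i) ∧ μ ≤ ν i}

/-- `Y_N = o_P(a_N)` for nonnegative `Y_N`. -/
def IsLittleOP {Ω : Type*} [MeasurableSpace Ω] (P : Measure Ω) (Y : ℕ → Ω → ℝ≥0∞)
    (a : ℕ → ℝ) : Prop :=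
  ∀ η : ℝ, 0 < η → Tendsto (fun N => P {ω | ENNReal.ofReal (η * a N) < Y N ω}) atTop (𝓝 0)

/-- `Y_N = O_P(a_N)` for nonnegative `Y_N`. -/
def IsBigOP {Ω : Type*} [MeasurableSpace Ω] (P : Measure Ω) (Y : ℕ → Ω → ℝ≥0∞)
    (a : ℕ → ℝ) : Prop :=
  ∀ η : ℝ, 0 < η → ∃ M : ℝ, 0 < M ∧
    ∀ᶠ N in atTop, P {ω | ENNReal.ofReal (M * a N) < Y N ω} ≤ ENNReal.ofReal η

end

/-!
Both remainders are controlled, path by path, by the self-normalized maximum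
`M_N = max_{1 ≤ k ≤ N} ‖S_k‖ / √k` of the partial sums `S_k` of the centred tensor squares
`X_n ⊗ X_n - c`, regarded as elements of the Hilbert space `L²([0,1]²)`.

Indeed, for `k = ⌊N r⌋ ≥ 1` the empirical kernel is `c + S_k / k`. Both kernels define compact,
positive, symmetric operators, so their eigenvalues obey the max-min and min-max principles
(`IsLeading.le_of_forall_span`, `IsLeading.le_of_forall_orthogonal`). These give Weyl's inequality
`|τ̂_j - τ_j| ≤ ‖S_k‖ / k` (`IsLeading.abs_sub_le`) and, for an eigenvalue that is separated from
the others, the first order expansion `τ̂_j - τ_j = ⟨S_k, v_j ⊗ v_j⟩ / k + O(‖S_k‖² / k²)`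
(`IsLeading.abs_sub_sub_le`). As `r = k / N + O(1 / N)`, the first remainder is
`O((M_N² + M_N + 1) / N)` and the second one `O((M_N + 1) / √N)`, uniformly in `r`; the range
`r < 1 / N`, where the empirical kernel is zero, accounts for the terms `1`
(`IsApproximableSeries.abs_remainder_le`). It remains to see that `M_N = O_P(log(N) ^ (1 / κ))`,
which is more than enough for the first claim.

For the maximum, the sum `∑ ‖(X_n ⊗ X_n) - (X_{n,m} ⊗ X_{n,m})‖_{L²}` over `m` is finite by Hölder's
inequality. Hence the centred tensor square is a convergent series of centred functions of windows
of innovations, the `l`-th with a window of length at most `2 ^ (l + 1)` and with `L²` norm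
`O(2 ^ (-l))`. Along each residue class modulo the window length such a function gives i.i.d.
variables, and summing over the residue classes costs only the square root of the window length
(`exists_lintegral_maxRatio_window_le`), so that the contributions form a geometric series
(`exists_lintegral_maxRatio_shift_le`).

For i.i.d. centred square integrable variables `ξ_i` with values in a Hilbert space, `ξ_i` is
truncated at `√i`. The parts cut off are summable against `1 / √i`, because
`∑ E[‖ξ‖; ‖ξ‖ > √i] / √i` is at most a multiple of `E ‖ξ‖²`. For the truncated variables, the
functional `(n + ‖u‖²) ^ s` grows by at most a factor `1 + C / n` with each of `n` steps, also for
the partial sums stopped at a level, and this gives a maximal inequality of any moment order `2 s`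
(`exists_measure_max_sum_le`). Applied to the `O(log N)` dyadic blocks of indices, it bounds the
expectation of the self-normalized maximum by a multiple of `log(N) ^ (1 / (2 s))`
(`exists_lintegral_maxRatio_iid_le`), and `s` may be chosen with `2 s ≥ κ`.
-/

set_option linter.unusedSectionVars false

/-! ### A maximal inequality for bounded independent summands in a Hilbert space -/

/-- A quadratic upper bound for `(1 + x) ^ s`, uniform on the range of relative increments that
occurs in `lintegral_add_norm_add_sq_pow_le`. -/
lemma exists_one_add_pow_le (s : ℕ) :
    ∃ C : ℝ, 0 ≤ C ∧ ∀ x : ℝ, -1 ≤ x → x ≤ 8 → (1 + x) ^ s ≤ 1 + s * x + C * x ^ 2 := by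
  induction s with
  | zero => exact ⟨0, le_rfl, fun x _ _ => by simp⟩
  | succ s ih =>
    obtain ⟨C, hC, h⟩ := ih
    refine ⟨s + 9 * C, by positivity, fun x h1 h2 => ?_⟩
    have h3 := mul_le_mul_of_nonneg_left (h x h1 h2) (by linarith : 0 ≤ 1 + x)
    have h4 : C * x ^ 2 * x ≤ C * x ^ 2 * 8 := by gcongr
    rw [pow_succ']
    push_cast
    nlinarith [h3, h4]

section Hilbert

variable {H : Type*} [NormedAddCommGroup H] [InnerProductSpace ℝ H] [CompleteSpace H]
  [SecondCountableTopology H] [MeasurableSpace H] [BorelSpace H]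

/-- Adding one centred increment of norm at most `2 √n` and variance at most `1` multiplies the
moment functional `u ↦ (n + ‖u‖²) ^ s` by at most `1 + C / n`. -/
lemma lintegral_add_norm_add_sq_pow_le (s : ℕ) :
    ∃ C : ℝ, 0 ≤ C ∧ ∀ (n : ℝ), 0 < n → ∀ (ν : Measure H) [IsProbabilityMeasure ν],
      (∀ᵐ z ∂ν, ‖z‖ ≤ 2 * √n) → ∫ z, z ∂ν = 0 → ∫ z, ‖z‖ ^ 2 ∂ν ≤ 1 → ∀ u : H,
      ∫⁻ z, ENNReal.ofReal ((n + ‖u + z‖ ^ 2) ^ s) ∂ν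
        ≤ ENNReal.ofReal (1 + C / n) * ENNReal.ofReal ((n + ‖u‖ ^ 2) ^ s) := by
  obtain ⟨C, hC, hbin⟩ := exists_one_add_pow_le s
  refine ⟨s + 16 * C, by positivity, fun n hn ν _ hb h0 h2 u => ?_⟩
  set A := n + ‖u‖ ^ 2 with hA
  have hnA : n ≤ A := by rw [hA]; nlinarith [sq_nonneg ‖u‖]
  have hApos : 0 < A := hn.trans_le hnA
  have hi1 : Integrable (fun z : H => z) ν :=
    Integrable.of_bound (by fun_prop) _ hb
  have hi2 : Integrable (fun z : H => ‖z‖ ^ 2) ν := by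
    refine Integrable.of_bound (by fun_prop) ((2 * √n) ^ 2) ?_
    filter_upwards [hb] with z hz
    rw [Real.norm_of_nonneg (by positivity)]
    gcongr
  have hi3 : Integrable (fun z : H => inner ℝ u z) ν := hi1.const_inner u
  have h0' : ∫ z, inner ℝ u z ∂ν = 0 := by
    rw [integral_inner hi1, h0, inner_zero_right]
  set R : H → ℝ := fun z =>
    A ^ s * (1 + (2 * s / A) * inner ℝ u z + ((s + 16 * C) / A) * ‖z‖ ^ 2) with hR
  have hle : ∀ᵐ z ∂ν, (n + ‖u + z‖ ^ 2) ^ s ≤ R z := by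
    filter_upwards [hb] with z hz
    set B := 2 * inner ℝ u z + ‖z‖ ^ 2 with hB
    have e1 : n + ‖u + z‖ ^ 2 = A * (1 + B / A) := by
      rw [norm_add_sq_real]; field_simp; ring
    have hin := abs_real_inner_le_norm u z
    have hu : ‖u‖ ≤ √A := Real.le_sqrt_of_sq_le (by rw [hA]; linarith)
    have hz' : ‖z‖ ≤ 2 * √A := hz.trans (by gcongr)
    have hAA : √A ^ 2 = A := Real.sq_sqrt hApos.le
    have hBabs : |B| ≤ ‖z‖ * (4 * √A) := by
      rw [hB]
      calc |2 * inner ℝ u z + ‖z‖ ^ 2| ≤ |2 * inner ℝ u z| + |‖z‖ ^ 2| := abs_add_le _ _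
        _ ≤ 2 * (‖u‖ * ‖z‖) + ‖z‖ ^ 2 := by
          rw [abs_mul, abs_two, abs_of_nonneg (sq_nonneg ‖z‖)]; gcongr
        _ ≤ _ := by nlinarith [norm_nonneg z]
    have hB8 : B ≤ 8 * A := by
      have := le_abs_self B
      nlinarith [Real.sqrt_nonneg A, norm_nonneg z]
    have hBsq : B ^ 2 ≤ 16 * A * ‖z‖ ^ 2 := by
      rw [← sq_abs]
      calc |B| ^ 2 ≤ (‖z‖ * (4 * √A)) ^ 2 := by gcongr
        _ = 16 * A * ‖z‖ ^ 2 := by rw [mul_pow, mul_pow, hAA]; ring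
    have hx1 : -1 ≤ B / A := by
      have : 0 ≤ A * (1 + B / A) := by rw [← e1]; positivity
      have := nonneg_of_mul_nonneg_right this hApos
      linarith
    have hx2 : B / A ≤ 8 := by rwa [div_le_iff₀ hApos]
    have hx3 : (B / A) ^ 2 ≤ 16 / A * ‖z‖ ^ 2 := by
      rw [div_pow, div_le_iff₀ (by positivity)]
      calc B ^ 2 ≤ 16 * A * ‖z‖ ^ 2 := hBsq
        _ = _ := by field_simp
    rw [e1, mul_pow]
    refine mul_le_mul_of_nonneg_left ((hbin _ hx1 hx2).trans ?_) (by positivity)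
    calc 1 + s * (B / A) + C * (B / A) ^ 2 ≤ 1 + s * (B / A) + C * (16 / A * ‖z‖ ^ 2) := by gcongr
      _ = _ := by rw [hB]; field_simp; ring
  have hRi : Integrable R ν := by
    rw [hR]
    exact (((integrable_const _).add (hi3.const_mul _)).add (hi2.const_mul _)).const_mul _
  have hRint : ∫ z, R z ∂ν ≤ (1 + (s + 16 * C) / n) * A ^ s := by
    have e : ∫ z, R z ∂ν = A ^ s * (1 + ((s + 16 * C) / A) * ∫ z, ‖z‖ ^ 2 ∂ν) := by
      have e1 : ∫ z, (1 + (2 * s / A) * inner ℝ u z) ∂ν = 1 := by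
        rw [integral_add (integrable_const _) (hi3.const_mul _), integral_const_mul, h0']
        simp
      have e2 : Integrable (fun z => 1 + (2 * s / A) * inner ℝ u z) ν :=
        (integrable_const _).add (hi3.const_mul _)
      rw [hR, integral_const_mul, integral_add e2 (hi2.const_mul _), e1, integral_const_mul]
    rw [e, mul_comm]
    gcongr
    calc (s + 16 * C) / A * ∫ z, ‖z‖ ^ 2 ∂ν ≤ (s + 16 * C) / A * 1 := by gcongr
      _ ≤ (s + 16 * C) / n := by rw [mul_one]; gcongr
  calc ∫⁻ z, ENNReal.ofReal ((n + ‖u + z‖ ^ 2) ^ s) ∂ν ≤ ∫⁻ z, ENNReal.ofReal (R z) ∂ν :=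
        lintegral_mono_ae (hle.mono fun z hz => ENNReal.ofReal_le_ofReal hz)
    _ = ENNReal.ofReal (∫ z, R z ∂ν) := by
        rw [ofReal_integral_eq_lintegral_ofReal hRi]
        filter_upwards [hle] with z hz
        exact le_trans (by positivity) hz
    _ ≤ _ := by
        rw [← ENNReal.ofReal_mul (by positivity)]
        exact ENNReal.ofReal_le_ofReal hRint

variable {Ω : Type*} [MeasurableSpace Ω] {P : Measure Ω} [IsProbabilityMeasure P]

open Classical in
/-- The partial sums of `ζ`, frozen as soon as their norm reaches the level `lam`. -/
noncomputable def stoppedSum (ζ : ℕ → Ω → H) (lam : ℝ) : ℕ → Ω → H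
  | 0, _ => 0
  | k + 1, ω => if lam ≤ ‖stoppedSum ζ lam k ω‖ then stoppedSum ζ lam k ω
      else stoppedSum ζ lam k ω + ζ k ω

lemma stoppedSum_eq_or (ζ : ℕ → Ω → H) (lam : ℝ) (n : ℕ) (ω : Ω) :
    (stoppedSum ζ lam n ω = ∑ i ∈ Finset.range n, ζ i ω ∧
      ∀ k < n, ‖∑ i ∈ Finset.range k, ζ i ω‖ < lam) ∨ lam ≤ ‖stoppedSum ζ lam n ω‖ := by
  induction n with
  | zero => left; simp [stoppedSum]
  | succ n ih =>
    by_cases h : lam ≤ ‖stoppedSum ζ lam n ω‖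
    · right; simp [stoppedSum, h]
    · left
      obtain ⟨h1, h2⟩ := ih.resolve_right h
      refine ⟨by rw [Finset.sum_range_succ, ← h1]; simp [stoppedSum, h], fun k hk => ?_⟩
      rcases Nat.lt_succ_iff_lt_or_eq.1 hk with hk | rfl
      · exact h2 k hk
      · rw [← h1]; exact not_le.1 h

lemma le_norm_stoppedSum (ζ : ℕ → Ω → H) (lam : ℝ) {n k : ℕ} (hk : k ≤ n) (ω : Ω)
    (h : lam ≤ ‖∑ i ∈ Finset.range k, ζ i ω‖) : lam ≤ ‖stoppedSum ζ lam n ω‖ := by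
  rcases stoppedSum_eq_or ζ lam n ω with ⟨h1, h2⟩ | h'
  · rcases hk.lt_or_eq with hk | rfl
    · exact absurd h (not_le.2 (h2 k hk))
    · rwa [h1]
  · exact h'

lemma measurable_stoppedStep (lam : ℝ) (m : MeasurableSpace Ω) {U Z : Ω → H}
    (hU : Measurable[m] U) (hZ : Measurable[m] Z) :
    Measurable[m] fun ω => open Classical in if lam ≤ ‖U ω‖ then U ω else U ω + Z ω := by
  classical
  exact Measurable.ite (measurableSet_le measurable_const hU.norm) hU (hU.add hZ)

lemma measurable_stoppedSum (ζ : ℕ → Ω → H) (lam : ℝ) (n : ℕ) :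
    Measurable[⨆ i ∈ Set.Iio n, MeasurableSpace.comap (ζ i) inferInstance]
      (stoppedSum ζ lam n) := by
  induction n with
  | zero => exact measurable_const
  | succ n ih =>
    have h1 : (⨆ i ∈ Set.Iio n, MeasurableSpace.comap (ζ i) inferInstance) ≤
        ⨆ i ∈ Set.Iio (n + 1), MeasurableSpace.comap (ζ i) inferInstance :=
      biSup_mono fun i hi => lt_trans hi (Nat.lt_succ_self n)
    have h2 : MeasurableSpace.comap (ζ n) inferInstance ≤
        ⨆ i ∈ Set.Iio (n + 1), MeasurableSpace.comap (ζ i) inferInstance :=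
      le_iSup₂_of_le n (Nat.lt_succ_self n) le_rfl
    exact measurable_stoppedStep lam _ (ih.mono h1 le_rfl)
      ((comap_measurable (ζ n)).mono h2 le_rfl)

lemma indepFun_stoppedSum {ζ : ℕ → Ω → H} (hm : ∀ i, Measurable (ζ i)) (hind : iIndepFun ζ P)
    (lam : ℝ) (n : ℕ) : IndepFun (stoppedSum ζ lam n) (ζ n) P := by
  have h := indep_iSup_of_disjoint (fun i => (hm i).comap_le) hind.iIndep
    (S := Set.Iio n) (T := {n}) (by simp)
  rw [IndepFun_iff_Indep]
  refine indep_of_indep_of_le_left (indep_of_indep_of_le_right h ?_) ?_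
  · simp
  · exact (measurable_stoppedSum ζ lam n).comap_le

/-- The maximal inequality: partial sums of `n` independent centred summands with variances at
most `1` and norms at most `2 √n` have maxima with all moments of the Gaussian order. -/
lemma exists_measure_max_sum_le (s : ℕ) :
    ∃ C : ℝ, 0 ≤ C ∧ ∀ (n : ℕ), 0 < n → ∀ ζ : ℕ → Ω → H, (∀ i, Measurable (ζ i)) →
      iIndepFun ζ P → (∀ i < n, ∀ᵐ ω ∂P, ‖ζ i ω‖ ≤ 2 * √(n : ℝ)) →
      (∀ i < n, ∫ ω, ζ i ω ∂P = 0) → (∀ i < n, ∫ ω, ‖ζ i ω‖ ^ 2 ∂P ≤ 1) →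
      ∀ lam : ℝ, 0 < lam →
      P {ω | ∃ k ≤ n, lam ≤ ‖∑ i ∈ Finset.range k, ζ i ω‖}
        ≤ ENNReal.ofReal (C * n ^ s / lam ^ (2 * s)) := by
  obtain ⟨C, hC, hstep⟩ := lintegral_add_norm_add_sq_pow_le (H := H) s
  refine ⟨Real.exp C, by positivity, fun n hn ζ hm hind hb h0 h2 lam hlam => ?_⟩
  have hnR : (0 : ℝ) < n := by exact_mod_cast hn
  set U := stoppedSum ζ lam with hU
  have hUm : ∀ k, Measurable (U k) := fun k =>
    (measurable_stoppedSum ζ lam k).mono (iSup₂_le fun i _ => (hm i).comap_le) le_rfl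
  set Φ : H → ℝ≥0∞ := fun u => ENNReal.ofReal ((n + ‖u‖ ^ 2) ^ s) with hΦ
  have hΦm : Measurable Φ := by rw [hΦ]; fun_prop
  have hrec : ∀ k < n, ∫⁻ ω, Φ (U (k + 1) ω) ∂P ≤
      ENNReal.ofReal (1 + C / n) * ∫⁻ ω, Φ (U k ω) ∂P := by
    intro k hk
    classical
    have hpm : IsProbabilityMeasure (P.map (ζ k)) :=
      Measure.isProbabilityMeasure_map (hm k).aemeasurable
    have hlaw := (indepFun_iff_map_prod_eq_prod_map_map (hUm k).aemeasurable
      (hm k).aemeasurable).1 (indepFun_stoppedSum hm hind lam k)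
    set V : H × H → H := fun z => if lam ≤ ‖z.1‖ then z.1 else z.1 + z.2 with hV
    have hVm : Measurable V := by
      have := measurable_stoppedStep lam (inferInstance : MeasurableSpace (H × H))
        (measurable_fst (α := H) (β := H)) (measurable_snd (α := H) (β := H))
      convert this
    have hone : ∀ u : H, ∫⁻ z, Φ (V (u, z)) ∂(P.map (ζ k)) ≤
        ENNReal.ofReal (1 + C / n) * Φ u := by
      intro u
      by_cases hu : lam ≤ ‖u‖
      · simp only [hV, hu, if_true, lintegral_const, measure_univ, mul_one]
        refine le_mul_of_one_le_left zero_le ?_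
        rw [ENNReal.one_le_ofReal]
        have : 0 ≤ C / n := by positivity
        linarith
      · simp only [hV, hu, if_false]
        refine hstep n hnR _ ?_ ?_ ?_ u
        · exact (ae_map_iff (hm k).aemeasurable
            (measurableSet_le measurable_norm measurable_const)).2 (hb k hk)
        · rw [integral_map (hm k).aemeasurable (by fun_prop)]; exact h0 k hk
        · rw [integral_map (hm k).aemeasurable (by fun_prop)]; exact h2 k hk
    calc ∫⁻ ω, Φ (U (k + 1) ω) ∂P = ∫⁻ ω, Φ (V (U k ω, ζ k ω)) ∂P := by
          refine lintegral_congr fun ω => ?_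
          simp only [hU, hV, stoppedSum]
      _ = ∫⁻ z, Φ (V z) ∂(P.map fun ω => (U k ω, ζ k ω)) := by
          exact (lintegral_map (hΦm.comp hVm) ((hUm k).prodMk (hm k))).symm
      _ = ∫⁻ u, ∫⁻ z, Φ (V (u, z)) ∂(P.map (ζ k)) ∂(P.map (U k)) := by
          rw [hlaw]; exact lintegral_prod _ (hΦm.comp hVm).aemeasurable
      _ ≤ ∫⁻ u, ENNReal.ofReal (1 + C / n) * Φ u ∂(P.map (U k)) := lintegral_mono hone
      _ = _ := by rw [lintegral_const_mul _ hΦm, lintegral_map hΦm (hUm k)]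
  have hiter : ∀ k ≤ n, ∫⁻ ω, Φ (U k ω) ∂P ≤ ENNReal.ofReal ((1 + C / n) ^ k * n ^ s) := by
    intro k
    induction k with
    | zero => intro _; simp [hU, stoppedSum, hΦ]
    | succ k ih =>
      intro hk
      refine (hrec k hk).trans ((mul_le_mul_right (ih (Nat.le_of_succ_le hk)) _).trans ?_)
      rw [← ENNReal.ofReal_mul (by positivity)]
      exact (ENNReal.ofReal_le_ofReal (by rw [pow_succ']; linarith))
  have hfin : ∫⁻ ω, Φ (U n ω) ∂P ≤ ENNReal.ofReal (Real.exp C * n ^ s) := by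
    refine (hiter n le_rfl).trans (ENNReal.ofReal_le_ofReal ?_)
    gcongr
    calc (1 + C / n) ^ n ≤ (Real.exp (C / n)) ^ n := by
          gcongr; linarith [Real.add_one_le_exp (C / n)]
      _ = Real.exp C := by rw [← Real.exp_nat_mul]; congr 1; field_simp
  have hsub : {ω | ∃ k ≤ n, lam ≤ ‖∑ i ∈ Finset.range k, ζ i ω‖} ⊆
      {ω | ENNReal.ofReal (lam ^ (2 * s)) ≤ Φ (U n ω)} := by
    rintro ω ⟨k, hk, hl⟩
    have := le_norm_stoppedSum ζ lam hk ω hl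
    refine ENNReal.ofReal_le_ofReal ?_
    rw [pow_mul]
    gcongr
    have : lam ^ 2 ≤ ‖U n ω‖ ^ 2 := by gcongr
    linarith
  have hl0 : 0 < lam ^ (2 * s) := by positivity
  calc _ ≤ P {ω | ENNReal.ofReal (lam ^ (2 * s)) ≤ Φ (U n ω)} := measure_mono hsub
    _ ≤ (∫⁻ ω, Φ (U n ω) ∂P) / ENNReal.ofReal (lam ^ (2 * s)) :=
      meas_ge_le_lintegral_div (hΦm.comp (hUm n)).aemeasurable (ENNReal.ofReal_pos.2 hl0).ne'
        ENNReal.ofReal_ne_top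
    _ ≤ ENNReal.ofReal (Real.exp C * n ^ s) / ENNReal.ofReal (lam ^ (2 * s)) := by gcongr
    _ = _ := by rw [ENNReal.ofReal_div_of_pos hl0]

end Hilbert

/-! ### Self-normalized maxima of i.i.d. sums in a Hilbert space -/

/-- The self-normalized maximum `max_{1 ≤ k ≤ N} ‖T k‖ / √k`. -/
noncomputable def maxRatio {H : Type*} [NormedAddCommGroup H] (T : ℕ → H) (N : ℕ) : ℝ≥0∞ :=
  ⨆ k ∈ Finset.Icc 1 N, ENNReal.ofReal (‖T k‖ / √(k : ℝ))

lemma le_maxRatio {H : Type*} [NormedAddCommGroup H] (T : ℕ → H) {N k : ℕ} (h1 : 1 ≤ k)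
    (h2 : k ≤ N) : ENNReal.ofReal (‖T k‖ / √(k : ℝ)) ≤ maxRatio T N :=
  le_iSup₂ (f := fun (k : ℕ) (_ : k ∈ Finset.Icc 1 N) => ENNReal.ofReal (‖T k‖ / √(k : ℝ))) k
    (Finset.mem_Icc.2 ⟨h1, h2⟩)

lemma maxRatio_le {H : Type*} [NormedAddCommGroup H] {T : ℕ → H} {N : ℕ} {a : ℝ≥0∞}
    (h : ∀ k, 1 ≤ k → k ≤ N → ENNReal.ofReal (‖T k‖ / √(k : ℝ)) ≤ a) : maxRatio T N ≤ a :=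
  iSup₂_le fun k hk => h k (Finset.mem_Icc.1 hk).1 (Finset.mem_Icc.1 hk).2

lemma maxRatio_ne_top {H : Type*} [NormedAddCommGroup H] (T : ℕ → H) (N : ℕ) :
    maxRatio T N ≠ ∞ := by
  refine ne_top_of_le_ne_top (ENNReal.sum_ne_top.2 fun k (_ : k ∈ Finset.Icc 1 N) =>
    ENNReal.ofReal_ne_top (r := ‖T k‖ / √(k : ℝ))) (iSup₂_le fun k hk => ?_)
  exact Finset.single_le_sum (f := fun k : ℕ => ENNReal.ofReal (‖T k‖ / √(k : ℝ)))
    (fun _ _ => zero_le) hk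

lemma exists_le_of_le_maxRatio {H : Type*} [NormedAddCommGroup H] {T : ℕ → H} {N : ℕ} {x : ℝ}
    (hx : 0 < x) (h : ENNReal.ofReal x ≤ maxRatio T N) :
    ∃ k, 1 ≤ k ∧ k ≤ N ∧ x * √(k : ℝ) ≤ ‖T k‖ := by
  by_contra! hc
  have hlt : maxRatio T N < ENNReal.ofReal x := by
    have hsup : maxRatio T N = (Finset.Icc 1 N).sup fun k : ℕ =>
        ENNReal.ofReal (‖T k‖ / √(k : ℝ)) := by rw [maxRatio, Finset.sup_eq_iSup]
    rw [hsup, Finset.sup_lt_iff (by simpa using hx)]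
    intro k hk
    obtain ⟨h1, h2⟩ := Finset.mem_Icc.1 hk
    have hk0 : (0 : ℝ) < √(k : ℝ) := Real.sqrt_pos.2 (by exact_mod_cast h1)
    rw [ENNReal.ofReal_lt_ofReal_iff hx, div_lt_iff₀ hk0]
    exact hc k h1 h2
  exact absurd h (not_le.2 hlt)

lemma measurable_maxRatio {Ω H : Type*} [MeasurableSpace Ω] [NormedAddCommGroup H]
    [MeasurableSpace H] [OpensMeasurableSpace H] {T : ℕ → Ω → H} (hT : ∀ k, Measurable (T k))
    (N : ℕ) : Measurable fun ω => maxRatio (fun k => T k ω) N := by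
  refine Measurable.biSup _ (Finset.countable_toSet _) fun k _ => ?_
  exact ((hT k).norm.div_const _).ennreal_ofReal

/-- A dyadic layer-cake bound. -/
lemma lintegral_le_of_measure_dyadic_le {Ω : Type*} [MeasurableSpace Ω] {P : Measure Ω}
    [IsProbabilityMeasure P] {Y : Ω → ℝ≥0∞} (hY : Measurable Y) (hfin : ∀ ω, Y ω ≠ ∞) {x K : ℝ}
    (hx : 0 < x) (hK : 0 ≤ K)
    (h : ∀ j : ℕ, P {ω | ENNReal.ofReal (x * 2 ^ j) ≤ Y ω} ≤ ENNReal.ofReal (K / 4 ^ j)) :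
    ∫⁻ ω, Y ω ∂P ≤ ENNReal.ofReal (x * (1 + 2 * K)) := by
  set A : ℕ → Set Ω := fun j => {ω | ENNReal.ofReal (x * 2 ^ j) ≤ Y ω} with hA
  have hAm : ∀ j, MeasurableSet (A j) := fun j => measurableSet_le measurable_const hY
  have hpt : ∀ ω, Y ω ≤ ENNReal.ofReal x +
      ∑' j : ℕ, (A j).indicator (fun _ => ENNReal.ofReal (x * 2 ^ j)) ω := by
    intro ω
    have hind : ∀ J : ℕ, ENNReal.ofReal (x * 2 ^ J) ≤ Y ω ∨ Y ω ≤ ENNReal.ofReal x +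
        ∑ j ∈ Finset.range J, (A j).indicator (fun _ => ENNReal.ofReal (x * 2 ^ j)) ω := by
      intro J
      have hsum : ∀ J : ℕ, ENNReal.ofReal (x * 2 ^ J) ≤ Y ω → ENNReal.ofReal (x * 2 ^ J) ≤
          ENNReal.ofReal x +
          ∑ j ∈ Finset.range J, (A j).indicator (fun _ => ENNReal.ofReal (x * 2 ^ j)) ω := by
        intro J
        induction J with
        | zero => intro _; simp
        | succ J ih =>
          intro hJ
          have hmono : ENNReal.ofReal (x * 2 ^ J) ≤ ENNReal.ofReal (x * 2 ^ (J + 1)) := by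
            apply ENNReal.ofReal_le_ofReal; gcongr <;> simp
          have hJ' := hmono.trans hJ
          have hi := ih hJ'
          rw [Finset.sum_range_succ, ← add_assoc]
          have hin : (A J).indicator (fun _ => ENNReal.ofReal (x * 2 ^ J)) ω =
            ENNReal.ofReal (x * 2 ^ J) := indicator_of_mem (s := A J) hJ' _
          rw [hin]
          refine le_trans ?_ (add_le_add_left hi _)
          rw [← ENNReal.ofReal_add (by positivity) (by positivity)]
          exact ENNReal.ofReal_le_ofReal (by rw [pow_succ]; linarith)
      induction J with
      | zero =>
        rcases le_total (ENNReal.ofReal x) (Y ω) with h | h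
        · left; simpa using h
        · right; simpa using h
      | succ J ih =>
        by_cases hJ : ENNReal.ofReal (x * 2 ^ (J + 1)) ≤ Y ω
        · exact Or.inl hJ
        right
        rcases ih with ih | ih
        · have hin : (A J).indicator (fun _ => ENNReal.ofReal (x * 2 ^ J)) ω =
            ENNReal.ofReal (x * 2 ^ J) := indicator_of_mem (s := A J) ih _
          rw [Finset.sum_range_succ, ← add_assoc, hin]
          refine (not_le.1 hJ).le.trans (le_trans ?_ (add_le_add_left (hsum J ih) _))
          rw [← ENNReal.ofReal_add (by positivity) (by positivity)]
          exact ENNReal.ofReal_le_ofReal (by rw [pow_succ]; linarith)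
        · rw [Finset.sum_range_succ, ← add_assoc]
          exact ih.trans le_self_add
    obtain ⟨J, hJ⟩ : ∃ J : ℕ, (Y ω).toReal / x < 2 ^ J :=
      pow_unbounded_of_one_lt _ one_lt_two
    have hJ' : ¬ ENNReal.ofReal (x * 2 ^ J) ≤ Y ω := by
      rw [not_le, ENNReal.lt_ofReal_iff_toReal_lt (hfin ω)]
      rwa [div_lt_iff₀ hx, mul_comm] at hJ
    exact ((hind J).resolve_left hJ').trans (by gcongr; exact ENNReal.sum_le_tsum _)
  have hterm : ∀ j : ℕ, ENNReal.ofReal (x * 2 ^ j) * P (A j) ≤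
      ENNReal.ofReal (x * K * (1 / 2) ^ j) := by
    intro j
    refine (mul_le_mul_right (h j) _).trans ?_
    rw [← ENNReal.ofReal_mul (by positivity)]
    refine ENNReal.ofReal_le_ofReal (le_of_eq ?_)
    have : (4 : ℝ) ^ j = 2 ^ j * 2 ^ j := by rw [← mul_pow]; norm_num
    rw [this, one_div, inv_pow]
    field_simp
  calc ∫⁻ ω, Y ω ∂P ≤ ∫⁻ ω, (ENNReal.ofReal x +
        ∑' j : ℕ, (A j).indicator (fun _ => ENNReal.ofReal (x * 2 ^ j)) ω) ∂P := lintegral_mono hpt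
    _ = ENNReal.ofReal x + ∑' j : ℕ, ENNReal.ofReal (x * 2 ^ j) * P (A j) := by
        rw [lintegral_add_left measurable_const, lintegral_const, measure_univ, mul_one,
          lintegral_tsum fun j => (measurable_const.indicator (hAm j)).aemeasurable]
        congr 2
        ext j
        exact lintegral_indicator_const (hAm j) _
    _ ≤ ENNReal.ofReal x + ∑' j : ℕ, ENNReal.ofReal (x * K * (1 / 2) ^ j) := by
        gcongr with j; exact hterm j
    _ = ENNReal.ofReal (x * (1 + 2 * K)) := by
        rw [← ENNReal.ofReal_tsum_of_nonneg (fun j => by positivity)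
          (summable_geometric_two.mul_left _), tsum_mul_left, tsum_geometric_two,
          ← ENNReal.ofReal_add hx.le (by positivity)]
        congr 1; ring

/-- The weights `1 / √(i + 1)` with `√(i + 1) < y` add up to at most `2 y`. -/
lemma sum_indicator_inv_sqrt_le (N : ℕ) {y : ℝ} (hy : 0 ≤ y) :
    ∑ i ∈ Finset.range N, (if √((i : ℝ) + 1) < y then 1 / √((i : ℝ) + 1) else 0) ≤ 2 * y := by
  suffices h : ∑ i ∈ Finset.range N, (if √((i : ℝ) + 1) < y then 1 / √((i : ℝ) + 1) else 0) ≤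
      2 * min (√(N : ℝ)) y from h.trans (by gcongr; exact min_le_right _ _)
  induction N with
  | zero => simp [hy]
  | succ N ih =>
    rw [Finset.sum_range_succ]
    have hmono : √(N : ℝ) ≤ √((N : ℝ) + 1) := Real.sqrt_le_sqrt (by linarith)
    push_cast
    split_ifs with h
    · rw [min_eq_left h.le]
      have hm : min (√(N : ℝ)) y = √(N : ℝ) := min_eq_left (hmono.trans h.le)
      rw [hm] at ih
      have h1 : √(N : ℝ) ^ 2 = N := Real.sq_sqrt (by positivity)
      have h2 : √((N : ℝ) + 1) ^ 2 = N + 1 := Real.sq_sqrt (by positivity)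
      have h3 : 0 < √((N : ℝ) + 1) := Real.sqrt_pos.2 (by positivity)
      have h4 : 1 / √((N : ℝ) + 1) ≤ 2 * (√((N : ℝ) + 1) - √(N : ℝ)) := by
        rw [div_le_iff₀ h3]; nlinarith [Real.sqrt_nonneg (N : ℝ)]
      linarith
    · rw [add_zero]
      exact ih.trans (by gcongr)

lemma sum_inv_sqrt_le (N : ℕ) : ∑ i ∈ Finset.range N, 1 / √((i : ℝ) + 1) ≤ 2 * √(N : ℝ) := by
  induction N with
  | zero => simp
  | succ N ih =>
    rw [Finset.sum_range_succ]
    push_cast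
    have h1 : √(N : ℝ) ^ 2 = N := Real.sq_sqrt (by positivity)
    have h2 : √((N : ℝ) + 1) ^ 2 = N + 1 := Real.sq_sqrt (by positivity)
    have h3 : 0 < √((N : ℝ) + 1) := Real.sqrt_pos.2 (by positivity)
    have hmono : √(N : ℝ) ≤ √((N : ℝ) + 1) := Real.sqrt_le_sqrt (by linarith)
    have h4 : 1 / √((N : ℝ) + 1) ≤ 2 * (√((N : ℝ) + 1) - √(N : ℝ)) := by
      rw [div_le_iff₀ h3]; nlinarith [Real.sqrt_nonneg (N : ℝ)]
    linarith

section Hilbert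

variable {H : Type*} [NormedAddCommGroup H] [InnerProductSpace ℝ H] [CompleteSpace H]
  [SecondCountableTopology H] [MeasurableSpace H] [BorelSpace H]

variable {Ω : Type*} [MeasurableSpace Ω] {P : Measure Ω} [IsProbabilityMeasure P]

/-- For summands of unit variance that are truncated at `√i`, the maximal inequality on each of
the `L` dyadic blocks costs only the factor `L ^ (1 / (2 s))`, with `s` at choice. -/
lemma exists_lintegral_maxRatio_le_of_bounded (s : ℕ) (hs : 1 ≤ s) :
    ∃ C : ℝ, 0 ≤ C ∧ ∀ ζ : ℕ → Ω → H, (∀ i, Measurable (ζ i)) →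
      iIndepFun ζ P → (∀ i : ℕ, ∀ᵐ ω ∂P, ‖ζ i ω‖ ≤ 2 * √((i : ℝ) + 1)) →
      (∀ i, ∫ ω, ζ i ω ∂P = 0) → (∀ i, ∫ ω, ‖ζ i ω‖ ^ 2 ∂P ≤ 1) →
      ∀ L N : ℕ, 1 ≤ L → N < 2 ^ L →
      ∫⁻ ω, maxRatio (fun k => ∑ i ∈ Finset.range k, ζ i ω) N ∂P
        ≤ ENNReal.ofReal (C * (L : ℝ) ^ ((2 * s : ℕ) : ℝ)⁻¹) := by
  obtain ⟨C, hC, hmax⟩ := exists_measure_max_sum_le (H := H) (P := P) s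
  refine ⟨1 + 2 * (C * 2 ^ s), by positivity, fun ζ hm hind hb h0 h2 L N hL hN => ?_⟩
  have hLpos : (0 : ℝ) < L := by exact_mod_cast hL
  set x : ℝ := (L : ℝ) ^ ((2 * s : ℕ) : ℝ)⁻¹ with hx
  have hxpos : 0 < x := by positivity
  have hxpow : x ^ (2 * s) = L := Real.rpow_inv_natCast_pow hLpos.le (by omega)
  rw [mul_comm]
  have hTm : ∀ k : ℕ, Measurable fun ω => ∑ i ∈ Finset.range k, ζ i ω := fun k =>
    Finset.measurable_sum _ fun i _ => hm i
  refine lintegral_le_of_measure_dyadic_le (measurable_maxRatio hTm N)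
    (fun ω => maxRatio_ne_top _ _) hxpos (by positivity) fun j => ?_
  set y := x * 2 ^ j with hy
  have hypos : 0 < y := by positivity
  have hsub : {ω | ENNReal.ofReal y ≤ maxRatio (fun k => ∑ i ∈ Finset.range k, ζ i ω) N} ⊆
      ⋃ l ∈ Finset.range L, {ω | ∃ k ≤ 2 ^ (l + 1), y * √((2 : ℝ) ^ l) ≤
        ‖∑ i ∈ Finset.range k, ζ i ω‖} := by
    intro ω hω
    obtain ⟨k, h1, h2, h3⟩ := exists_le_of_le_maxRatio hypos hω
    have hk0 : k ≠ 0 := by omega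
    have hlog : Nat.log 2 k < L := (Nat.log_lt_iff_lt_pow one_lt_two hk0).2 (h2.trans_lt hN)
    refine mem_iUnion₂.2 ⟨Nat.log 2 k, Finset.mem_range.2 hlog, k,
      (Nat.lt_pow_succ_log_self one_lt_two k).le, le_trans ?_ h3⟩
    gcongr
    exact_mod_cast Nat.pow_log_le_self 2 hk0
  have hblock : ∀ l : ℕ, P {ω | ∃ k ≤ 2 ^ (l + 1), y * √((2 : ℝ) ^ l) ≤
        ‖∑ i ∈ Finset.range k, ζ i ω‖} ≤ ENNReal.ofReal (C * 2 ^ s / y ^ (2 * s)) := by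
    intro l
    refine (hmax (2 ^ (l + 1)) (by positivity) ζ hm hind (fun i hi => ?_) (fun i _ => h0 i)
      (fun i _ => h2 i) _ (by positivity)).trans (ENNReal.ofReal_le_ofReal (le_of_eq ?_))
    · filter_upwards [hb i] with ω hω
      refine hω.trans ?_
      gcongr
      exact_mod_cast hi
    · have h4 : √((2 : ℝ) ^ l) ^ (2 * s) = (2 ^ l) ^ s := by
        rw [pow_mul, Real.sq_sqrt (by positivity)]
      rw [mul_pow, h4]
      push_cast
      rw [pow_succ, mul_pow]
      field_simp
  calc _ ≤ _ := measure_mono hsub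
    _ ≤ ∑ l ∈ Finset.range L, ENNReal.ofReal (C * 2 ^ s / y ^ (2 * s)) :=
      (measure_biUnion_finset_le _ _).trans (Finset.sum_le_sum fun l _ => hblock l)
    _ = ENNReal.ofReal (L * (C * 2 ^ s / y ^ (2 * s))) := by
      rw [Finset.sum_const, Finset.card_range, nsmul_eq_mul, ENNReal.ofReal_mul hLpos.le,
        ENNReal.ofReal_natCast]
    _ ≤ ENNReal.ofReal (C * 2 ^ s / 4 ^ j) := by
      refine ENNReal.ofReal_le_ofReal ?_
      rw [hy, mul_pow, hxpow]
      have h5 : (4 : ℝ) ^ j ≤ (2 ^ j) ^ (2 * s) := by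
        rw [← pow_mul, mul_comm j, mul_assoc, pow_mul]
        norm_num
        exact pow_le_pow_right₀ (by norm_num) (by nlinarith)
      calc L * (C * 2 ^ s / (L * (2 ^ j) ^ (2 * s))) = C * 2 ^ s / (2 ^ j) ^ (2 * s) := by
            field_simp
        _ ≤ _ := by gcongr

open Classical in
/-- The vector `z` if its norm is at most `a`, and zero otherwise. -/
noncomputable def truncate {H : Type*} [NormedAddCommGroup H] (a : ℝ) (z : H) : H :=
  if ‖z‖ ≤ a then z else 0

lemma measurable_truncate (a : ℝ) : Measurable (truncate a : H → H) := by
  classical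
  exact Measurable.ite (measurableSet_le measurable_norm measurable_const) measurable_id
    measurable_const

lemma norm_truncate_le {a : ℝ} (ha : 0 ≤ a) (z : H) : ‖truncate a z‖ ≤ a := by
  unfold truncate; split_ifs with h
  · exact h
  · simpa using ha

lemma norm_truncate_le_norm (a : ℝ) (z : H) : ‖truncate a z‖ ≤ ‖z‖ := by
  unfold truncate; split_ifs with h <;> simp

lemma norm_sub_truncate (a : ℝ) (z : H) :
    ‖z - truncate a z‖ = if a < ‖z‖ then ‖z‖ else 0 := by
  unfold truncate
  by_cases h : ‖z‖ ≤ a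
  · simp [h, not_lt.2 h]
  · simp [h, not_le.1 h]

lemma integral_comp_of_map_eq {E F : Type*} [NormedAddCommGroup E] [NormedSpace ℝ E]
    [MeasurableSpace F] {Y : Ω → F} (hY : Measurable Y) {ν : Measure F} (h : P.map Y = ν)
    {f : F → E} (hf : AEStronglyMeasurable f ν) : ∫ ω, f (Y ω) ∂P = ∫ z, f z ∂ν := by
  rw [← h] at hf ⊢
  exact (integral_map hY.aemeasurable hf).symm

/-- I.i.d. centred summands with variance at most `1`: the parts cut off at `√i` are summable
against the weights `1 / √i`, and the remaining parts are covered by the bounded case. -/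
lemma exists_lintegral_maxRatio_iid_le_of_unit (s : ℕ) (hs : 1 ≤ s) :
    ∃ C : ℝ, 0 ≤ C ∧ ∀ (ν : Measure H) [IsProbabilityMeasure ν] (ξ : ℕ → Ω → H),
      (∀ i, Measurable (ξ i)) → iIndepFun ξ P → (∀ i, P.map (ξ i) = ν) →
      MemLp id 2 ν → ∫ z, z ∂ν = 0 → ∫ z, ‖z‖ ^ 2 ∂ν ≤ 1 →
      ∀ L N : ℕ, 1 ≤ L → N < 2 ^ L →
      ∫⁻ ω, maxRatio (fun k => ∑ i ∈ Finset.range k, ξ i ω) N ∂P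
        ≤ ENNReal.ofReal (C * (L : ℝ) ^ ((2 * s : ℕ) : ℝ)⁻¹) := by
  obtain ⟨C, hC, hbd⟩ := exists_lintegral_maxRatio_le_of_bounded (H := H) (P := P) s hs
  refine ⟨C + 4, by positivity, fun ν _ ξ hm hind hlaw hL2 h0 h2 L N hL hN => ?_⟩
  have hi1 : Integrable (fun z : H => z) ν := hL2.integrable (by norm_num)
  have hi2 : Integrable (fun z : H => ‖z‖ ^ 2) ν := hL2.integrable_norm_pow (by norm_num)
  set a : ℕ → ℝ := fun i => √((i : ℝ) + 1) with ha
  have ha0 : ∀ i, 0 < a i := fun i => Real.sqrt_pos.2 (by positivity)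
  have hti : ∀ i, Integrable (truncate (a i) : H → H) ν := fun i =>
    hi1.mono (measurable_truncate _).aestronglyMeasurable
      (Eventually.of_forall fun z => norm_truncate_le_norm _ _)
  have hti2 : ∀ i, Integrable (fun z : H => ‖truncate (a i) z‖ ^ 2) ν := fun i => by
    refine hi2.mono ((measurable_truncate _).norm.pow_const 2).aestronglyMeasurable
      (Eventually.of_forall fun z => ?_)
    rw [Real.norm_of_nonneg (by positivity), Real.norm_of_nonneg (by positivity)]
    have := norm_truncate_le_norm (a i) z
    gcongr
  set m : ℕ → H := fun i => ∫ z, truncate (a i) z ∂ν with hmdef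
  have hmb : ∀ i, ‖m i‖ ≤ a i := fun i => by
    have := norm_integral_le_of_norm_le_const (μ := ν) (f := (truncate (a i) : H → H))
      (Eventually.of_forall fun z => norm_truncate_le (ha0 i).le z)
    simpa using this
  set d : ℕ → H → ℝ := fun i z => ‖z - truncate (a i) z‖ with hd
  have hdi : ∀ i, Integrable (d i) ν := fun i => (hi1.sub (hti i)).norm
  have hmd : ∀ i, ‖m i‖ ≤ ∫ z, d i z ∂ν := fun i => by
    have : m i = - ∫ z, (z - truncate (a i) z) ∂ν := by
      rw [integral_sub hi1 (hti i), h0, zero_sub, neg_neg]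
    rw [this, norm_neg]
    exact norm_integral_le_integral_norm _
  set ζ : ℕ → Ω → H := fun i ω => truncate (a i) (ξ i ω) - m i with hζ
  have hζm : ∀ i, Measurable (ζ i) := fun i =>
    ((measurable_truncate _).comp (hm i)).sub_const _
  have hζind : iIndepFun ζ P :=
    hind.comp (fun i z => truncate (a i) z - m i) fun i => (measurable_truncate _).sub_const _
  have hmain := hbd ζ hζm hζind
    (fun i => Eventually.of_forall fun ω => by
      have := norm_sub_le (truncate (a i) (ξ i ω)) (m i)
      have h1 := norm_truncate_le (ha0 i).le (ξ i ω)
      linarith [hmb i])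
    (fun i => by
      have := integral_comp_of_map_eq (hm i) (hlaw i) (f := fun z => truncate (a i) z - m i)
        ((measurable_truncate _).sub_const _).aestronglyMeasurable
      rw [hζ]
      simp only
      rw [this, integral_sub (hti i) (integrable_const _)]
      simp [hmdef])
    (fun i => by
      have := integral_comp_of_map_eq (hm i) (hlaw i) (f := fun z => ‖truncate (a i) z - m i‖ ^ 2)
        (((measurable_truncate _).sub_const _).norm.pow_const 2).aestronglyMeasurable
      rw [hζ]
      simp only
      rw [this]
      have e1 : ∀ z : H, ‖truncate (a i) z - m i‖ ^ 2 =
          ‖truncate (a i) z‖ ^ 2 - 2 * inner ℝ (m i) (truncate (a i) z) + ‖m i‖ ^ 2 := fun z => by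
        rw [norm_sub_sq_real, real_inner_comm]
      have e2 : Integrable (fun z => 2 * inner ℝ (m i) (truncate (a i) z)) ν :=
        ((hti i).const_inner (m i)).const_mul 2
      have e3 : Integrable (fun z => ‖truncate (a i) z‖ ^ 2 -
        2 * inner ℝ (m i) (truncate (a i) z)) ν := (hti2 i).sub e2
      simp_rw [e1]
      rw [integral_add e3 (integrable_const _), integral_sub (hti2 i) e2, integral_const_mul,
        integral_inner (hti i)]
      have e4 : ∫ z, truncate (a i) z ∂ν = m i := rfl
      rw [e4, real_inner_self_eq_norm_sq]
      have e5 : ∫ z, ‖truncate (a i) z‖ ^ 2 ∂ν ≤ ∫ z, ‖z‖ ^ 2 ∂ν :=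
        integral_mono (hti2 i) hi2 fun z => by
          have := norm_truncate_le_norm (a i) z
          simp only
          gcongr
      simp only [integral_const, measureReal_def, measure_univ, ENNReal.toReal_one, one_smul]
      nlinarith [sq_nonneg ‖m i‖]) L N hL hN
  set W : Ω → ℝ := fun ω => ∑ i ∈ Finset.range N, (d i (ξ i ω) + ‖m i‖) / a i with hW
  have hpt : ∀ ω, maxRatio (fun k => ∑ i ∈ Finset.range k, ξ i ω) N ≤
      maxRatio (fun k => ∑ i ∈ Finset.range k, ζ i ω) N + ENNReal.ofReal (W ω) := by
    intro ω
    refine maxRatio_le fun k h1 h2 => ?_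
    have hk0 : (0 : ℝ) < √(k : ℝ) := Real.sqrt_pos.2 (by exact_mod_cast h1)
    refine le_trans ?_ (add_le_add_left (le_maxRatio _ h1 h2) _)
    have hWnn : 0 ≤ W ω := Finset.sum_nonneg fun i _ =>
      div_nonneg (add_nonneg (norm_nonneg _) (norm_nonneg _)) (ha0 i).le
    rw [← ENNReal.ofReal_add (by positivity) hWnn]
    refine ENNReal.ofReal_le_ofReal ?_
    have hsplit : ∑ i ∈ Finset.range k, ξ i ω = ∑ i ∈ Finset.range k, ζ i ω +
        ∑ i ∈ Finset.range k, (ξ i ω - truncate (a i) (ξ i ω) + m i) := by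
      rw [← Finset.sum_add_distrib]
      refine Finset.sum_congr rfl fun i _ => ?_
      simp only [hζ]; abel
    have hrest : ‖∑ i ∈ Finset.range k, (ξ i ω - truncate (a i) (ξ i ω) + m i)‖ / √(k : ℝ) ≤
        W ω := by
      calc _ ≤ (∑ i ∈ Finset.range k, (d i (ξ i ω) + ‖m i‖)) / √(k : ℝ) := by
            gcongr
            exact (norm_sum_le _ _).trans (Finset.sum_le_sum fun i _ => norm_add_le _ _)
        _ = ∑ i ∈ Finset.range k, (d i (ξ i ω) + ‖m i‖) / √(k : ℝ) := Finset.sum_div _ _ _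
        _ ≤ ∑ i ∈ Finset.range k, (d i (ξ i ω) + ‖m i‖) / a i := by
            refine Finset.sum_le_sum fun i hi => ?_
            have hik : (i : ℝ) + 1 ≤ k := by exact_mod_cast Finset.mem_range.1 hi
            have : a i ≤ √(k : ℝ) := Real.sqrt_le_sqrt hik
            have := ha0 i
            have : 0 ≤ d i (ξ i ω) := norm_nonneg _
            gcongr
        _ ≤ W ω := by
            refine Finset.sum_le_sum_of_subset_of_nonneg (Finset.range_mono h2) fun i _ _ => ?_
            exact div_nonneg (add_nonneg (norm_nonneg _) (norm_nonneg _)) (ha0 i).le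
    rw [hsplit]
    calc _ ≤ (‖∑ i ∈ Finset.range k, ζ i ω‖ +
          ‖∑ i ∈ Finset.range k, (ξ i ω - truncate (a i) (ξ i ω) + m i)‖) / √(k : ℝ) := by
          gcongr; exact norm_add_le _ _
      _ ≤ _ := by rw [add_div]; gcongr
  have hdξ : ∀ i, Integrable (fun ω => d i (ξ i ω)) P := fun i => by
    have := hdi i
    rw [← hlaw i] at this
    exact this.comp_measurable (hm i)
  have hWi : Integrable W P := integrable_finsetSum _ fun i _ =>
    ((hdξ i).add (integrable_const _)).div_const _
  have hWint : ∫ ω, W ω ∂P ≤ 4 := by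
    have e1 : ∫ ω, W ω ∂P ≤ 2 * ∑ i ∈ Finset.range N, ∫ z, d i z / a i ∂ν := by
      have hterm : ∀ i ∈ Finset.range N, Integrable (fun ω => (d i (ξ i ω) + ‖m i‖) / a i) P :=
        fun i _ => ((hdξ i).add (integrable_const _)).div_const _
      rw [hW, integral_finsetSum _ hterm, Finset.mul_sum]
      refine Finset.sum_le_sum fun i _ => ?_
      rw [integral_div, integral_add (hdξ i) (integrable_const _),
        integral_comp_of_map_eq (hm i) (hlaw i) (hdi i).aestronglyMeasurable, integral_div,
        ← mul_div_assoc]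
      have := ha0 i
      gcongr
      simp only [integral_const, measureReal_def, measure_univ, ENNReal.toReal_one, one_smul]
      linarith [hmd i]
    have e2 : ∑ i ∈ Finset.range N, ∫ z, d i z / a i ∂ν ≤ 2 := by
      rw [← integral_finsetSum _ fun i _ => (hdi i).div_const _]
      calc ∫ z, ∑ i ∈ Finset.range N, d i z / a i ∂ν ≤ ∫ z, 2 * ‖z‖ ^ 2 ∂ν := by
            refine integral_mono (integrable_finsetSum _ fun i _ => (hdi i).div_const _)
              (hi2.const_mul 2) fun z => ?_
            simp only
            have e3 := mul_le_mul_of_nonneg_left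
              (sum_indicator_inv_sqrt_le N (norm_nonneg z)) (norm_nonneg z)
            calc _ = ‖z‖ * ∑ i ∈ Finset.range N,
                  (if √((i : ℝ) + 1) < ‖z‖ then 1 / √((i : ℝ) + 1) else 0) := by
                  rw [Finset.mul_sum]
                  refine Finset.sum_congr rfl fun i _ => ?_
                  simp only [hd, norm_sub_truncate, ha]
                  split_ifs <;> simp [div_eq_mul_inv]
              _ ≤ ‖z‖ * (2 * ‖z‖) := e3
              _ = _ := by ring
        _ ≤ 2 := by rw [integral_const_mul]; linarith
    linarith
  have hx1 : 1 ≤ (L : ℝ) ^ ((2 * s : ℕ) : ℝ)⁻¹ :=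
    Real.one_le_rpow (by exact_mod_cast hL) (by positivity)
  calc _ ≤ ∫⁻ ω, (maxRatio (fun k => ∑ i ∈ Finset.range k, ζ i ω) N + ENNReal.ofReal (W ω)) ∂P :=
        lintegral_mono hpt
    _ = ∫⁻ ω, maxRatio (fun k => ∑ i ∈ Finset.range k, ζ i ω) N ∂P +
        ENNReal.ofReal (∫ ω, W ω ∂P) := by
        rw [lintegral_add_left (measurable_maxRatio
          (fun k => Finset.measurable_sum _ fun i _ => hζm i) N),
          ofReal_integral_eq_lintegral_ofReal hWi]
        exact Eventually.of_forall fun ω => Finset.sum_nonneg fun i _ =>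
          div_nonneg (add_nonneg (norm_nonneg _) (norm_nonneg _)) (ha0 i).le
    _ ≤ ENNReal.ofReal (C * (L : ℝ) ^ ((2 * s : ℕ) : ℝ)⁻¹) + ENNReal.ofReal 4 := by
        gcongr
    _ ≤ _ := by
        rw [← ENNReal.ofReal_add (by positivity) (by norm_num)]
        exact ENNReal.ofReal_le_ofReal (by nlinarith)

/-- I.i.d. centred summands with second moment at most `β ^ 2`: the self-normalized maximum has
expectation at most `C β L ^ (1 / (2 s))`. -/
lemma exists_lintegral_maxRatio_iid_le (s : ℕ) (hs : 1 ≤ s) :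
    ∃ C : ℝ, 0 ≤ C ∧ ∀ (ν : Measure H) [IsProbabilityMeasure ν] (ξ : ℕ → Ω → H),
      (∀ i, Measurable (ξ i)) → iIndepFun ξ P → (∀ i, P.map (ξ i) = ν) →
      MemLp id 2 ν → ∫ z, z ∂ν = 0 → ∀ β : ℝ, 0 < β → ∫ z, ‖z‖ ^ 2 ∂ν ≤ β ^ 2 →
      ∀ L N : ℕ, 1 ≤ L → N < 2 ^ L →
      ∫⁻ ω, maxRatio (fun k => ∑ i ∈ Finset.range k, ξ i ω) N ∂P
        ≤ ENNReal.ofReal (C * β * (L : ℝ) ^ ((2 * s : ℕ) : ℝ)⁻¹) := by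
  obtain ⟨C, hC, hunit⟩ := exists_lintegral_maxRatio_iid_le_of_unit (H := H) (P := P) s hs
  refine ⟨C, hC, fun ν _ ξ hm hind hlaw hL2 h0 β hβ h2 L N hL hN => ?_⟩
  have hsm : Measurable fun z : H => β⁻¹ • z := measurable_const_smul _
  have hpm : IsProbabilityMeasure (ν.map fun z => β⁻¹ • z) :=
    Measure.isProbabilityMeasure_map hsm.aemeasurable
  have hres := hunit (ν.map fun z => β⁻¹ • z) (fun i ω => β⁻¹ • ξ i ω)
    (fun i => hsm.comp (hm i)) (hind.comp (fun _ z => β⁻¹ • z) fun _ => hsm)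
    (fun i => by rw [← hlaw i, Measure.map_map hsm (hm i)]; rfl)
    ((memLp_map_measure_iff (by fun_prop) hsm.aemeasurable).2 (hL2.const_smul β⁻¹))
    (by rw [integral_map hsm.aemeasurable (by fun_prop), integral_smul, h0, smul_zero])
    (by
      rw [integral_map hsm.aemeasurable (by fun_prop)]
      simp_rw [norm_smul, mul_pow]
      rw [integral_const_mul, norm_inv, Real.norm_of_nonneg hβ.le]
      calc β⁻¹ ^ 2 * ∫ z, ‖z‖ ^ 2 ∂ν ≤ β⁻¹ ^ 2 * β ^ 2 := by gcongr
        _ = 1 := by field_simp) L N hL hN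
  have hscale : ∀ ω, maxRatio (fun k => ∑ i ∈ Finset.range k, ξ i ω) N ≤
      ENNReal.ofReal β * maxRatio (fun k => ∑ i ∈ Finset.range k, β⁻¹ • ξ i ω) N := by
    intro ω
    refine maxRatio_le fun k h1 h2 => ?_
    refine le_trans ?_ (mul_le_mul_right (le_maxRatio _ h1 h2) _)
    rw [← ENNReal.ofReal_mul hβ.le, ← Finset.smul_sum, norm_smul, norm_inv,
      Real.norm_of_nonneg hβ.le]
    refine ENNReal.ofReal_le_ofReal (le_of_eq ?_)
    field_simp
  calc _ ≤ ∫⁻ ω, ENNReal.ofReal β * maxRatio (fun k => ∑ i ∈ Finset.range k, β⁻¹ • ξ i ω) N ∂P :=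
        lintegral_mono hscale
    _ ≤ ENNReal.ofReal β * ENNReal.ofReal (C * (L : ℝ) ^ ((2 * s : ℕ) : ℝ)⁻¹) := by
        rw [lintegral_const_mul' _ _ ENNReal.ofReal_ne_top]
        gcongr
    _ = _ := by rw [← ENNReal.ofReal_mul hβ.le]; congr 1; ring

end Hilbert

/-! ### Independent sequences of innovations and their product law -/

section Splice

variable {S : Type*} [MeasurableSpace S]

/-- The sequence whose first `m` entries are those of `z.1` and whose other entries are those
of `z.2`. -/
def splice (m : ℕ) (z : (ℕ → S) × (ℕ → S)) : ℕ → S := fun k => if k < m then z.1 k else z.2 k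

lemma splice_zero (x y : ℕ → S) : splice 0 (x, y) = y := by
  ext k
  simp [splice]

lemma measurable_splice (m : ℕ) : Measurable (splice m : (ℕ → S) × (ℕ → S) → ℕ → S) := by
  refine measurable_pi_lambda _ fun k => ?_
  unfold splice
  split_ifs <;> fun_prop

/-- The law of an i.i.d. sequence indexed by `ℕ` with marginal `μ`. -/
noncomputable abbrev seqLaw (μ : Measure S) : Measure (ℕ → S) :=
  Measure.infinitePi fun _ : ℕ => μ

/-- Splicing two independent i.i.d. sequences gives an i.i.d. sequence. -/
lemma measurePreserving_splice (μ : Measure S) [IsProbabilityMeasure μ] (m : ℕ) :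
    MeasurePreserving (splice m) ((seqLaw μ).prod (seqLaw μ)) (seqLaw μ) := by
  classical
  refine ⟨measurable_splice m, Measure.eq_infinitePi _ fun s t ht => ?_⟩
  have hpre : splice m ⁻¹' (Set.pi s t) =
      (Set.pi (s.filter (· < m)) t) ×ˢ (Set.pi (s.filter (¬ · < m)) t) := by
    ext z
    simp only [mem_preimage, Set.mem_pi, Finset.mem_coe, mem_prod, Finset.mem_filter, splice]
    constructor
    · intro h
      exact ⟨fun i hi => by simpa [hi.2] using h i hi.1, fun i hi => by simpa [hi.2] using h i hi.1⟩
    · rintro ⟨h1, h2⟩ i hi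
      split_ifs with hm
      · exact h1 i ⟨hi, hm⟩
      · exact h2 i ⟨hi, hm⟩
  rw [Measure.map_apply (measurable_splice m)
    (MeasurableSet.pi (Finset.countable_toSet s) fun i _ => ht i), hpre, Measure.prod_prod,
    Measure.infinitePi_pi _ (fun i _ => ht i), Measure.infinitePi_pi _ (fun i _ => ht i)]
  exact Finset.prod_filter_mul_prod_filter_not s (· < m) fun i => μ (t i)

variable {Ω : Type*} [MeasurableSpace Ω] {P : Measure Ω} [IsProbabilityMeasure P]

lemma measurable_past {ε : ℤ → Ω → S} (hm : ∀ n, Measurable (ε n)) (n : ℤ) :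
    Measurable (past ε n) := measurable_pi_lambda _ fun _ => hm _

lemma map_past {ε : ℤ → Ω → S} (hm : ∀ n, Measurable (ε n)) (hind : iIndepFun ε P) {μ : Measure S}
    (hid : ∀ n, P.map (ε n) = μ) (n : ℤ) : P.map (past ε n) = seqLaw μ := by
  have hinj : Function.Injective fun k : ℕ => n - (k : ℤ) := fun a b h => by simpa using h
  have := (hind.precomp hinj).map_fun_eq_infinitePi_map fun k => hm _
  simp only [hid] at this
  exact this

/-- Blocks of innovations over disjoint windows of length `w` are independent. -/
lemma iIndepFun_windows {ε : ℤ → Ω → S} (hm : ∀ n, Measurable (ε n)) (hind : iIndepFun ε P)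
    {w : ℕ} (r : ℕ) :
    iIndepFun (fun (j : ℕ) ω (i : Fin w) => ε ((r + j * w + 1 : ℕ) - (i : ℤ)) ω) P := by
  set f : ℕ × Fin w → ℤ := fun p => ((r + p.1 * w + 1 : ℕ) : ℤ) - (p.2 : ℕ) with hf
  have hinj : Function.Injective f := by
    rintro ⟨a, b⟩ ⟨c, d⟩ h
    have h' : ((a : ℤ) - c) * w = (b : ℕ) - (d : ℕ) := by
      simp only [hf] at h; push_cast at h; linarith
    have hb := b.2
    have hd := d.2
    have hac : (a : ℤ) - c = 0 := by
      by_contra hne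
      rcases lt_or_gt_of_ne hne with h1 | h1
      · nlinarith
      · nlinarith
    have hac' : a = c := by omega
    rw [hac, zero_mul] at h'
    refine Prod.ext hac' (Fin.ext ?_)
    simp only
    omega
  have hprob : ∀ n, IsProbabilityMeasure (P.map (ε n)) := fun n =>
    Measure.isProbabilityMeasure_map (hm n).aemeasurable
  have h1 := (hind.precomp hinj).map_fun_eq_infinitePi_map fun p => hm _
  have hmc : Measurable fun ω (p : ℕ × Fin w) => ε (f p) ω :=
    measurable_pi_lambda _ fun p => hm _
  have h2 : P.map (fun ω (j : ℕ) (i : Fin w) => ε (f (j, i)) ω) =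
      Measure.infinitePi fun j : ℕ => Measure.infinitePi fun i : Fin w => P.map (ε (f (j, i))) := by
    rw [← Measure.infinitePi_map_curry (fun (j : ℕ) (i : Fin w) => P.map (ε (f (j, i)))), ← h1,
      Measure.map_map (MeasurableEquiv.measurable _) hmc]
    rfl
  have h3 : ∀ j : ℕ, P.map (fun ω (i : Fin w) => ε (f (j, i)) ω) =
      Measure.infinitePi fun i : Fin w => P.map (ε (f (j, i))) := fun j => by
    have hj : Function.Injective fun i : Fin w => f (j, i) := fun a b h => by
      simpa using hinj h
    exact (hind.precomp hj).map_fun_eq_infinitePi_map fun p => hm _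
  rw [iIndepFun_iff_map_fun_eq_infinitePi_map
    (fun j => measurable_pi_lambda _ fun i => hm _)]
  refine Eq.trans h2 ?_
  congr 1
  ext1 j
  exact (h3 j).symm

end Splice

/-! ### Functions of finitely many innovations -/

/-- Sorting `0, …, k - 1` by residues modulo `w`. -/
lemma sum_range_eq_sum_residues {M : Type*} [AddCommMonoid M] (f : ℕ → M) {w : ℕ} (hw : 0 < w)
    (k : ℕ) : ∑ i ∈ Finset.range k, f i =
      ∑ r ∈ Finset.range w, ∑ j ∈ Finset.range ((k + (w - 1 - r)) / w), f (r + j * w) := by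
  induction k with
  | zero =>
    rw [Finset.range_zero, Finset.sum_empty]
    refine (Finset.sum_eq_zero fun r hr => ?_).symm
    rw [Nat.div_eq_of_lt (by omega), Finset.range_zero, Finset.sum_empty]
  | succ k ih =>
    have hstep : ∀ r ∈ Finset.range w,
        ∑ j ∈ Finset.range ((k + 1 + (w - 1 - r)) / w), f (r + j * w) =
        ∑ j ∈ Finset.range ((k + (w - 1 - r)) / w), f (r + j * w) +
          if r = k % w then f k else 0 := by
      intro r hr
      have hr := Finset.mem_range.1 hr
      have e : k + 1 + (w - 1 - r) = (k + (w - 1 - r)) + 1 := by ring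
      have hk := Nat.mod_add_div k w
      have hkm := Nat.mod_lt k hw
      by_cases h : r = k % w
      · have e1 : k + (w - 1 - r) = (w - 1) + w * (k / w) := by omega
        have e2 : (k + (w - 1 - r)) / w = k / w := by
          rw [e1, Nat.add_mul_div_left _ _ hw, Nat.div_eq_of_lt (by omega), zero_add]
        have e3 : (k + 1 + (w - 1 - r)) / w = k / w + 1 := by
          rw [e, e1, show w - 1 + w * (k / w) + 1 = w * (k / w + 1) by
            rw [mul_add]; omega, Nat.mul_div_cancel_left _ hw]
        rw [e3, Finset.sum_range_succ, e2, if_pos h]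
        congr 2
        rw [h, mul_comm]; exact hk
      · have e4 : ¬ w ∣ k + (w - 1 - r) + 1 := by
          intro hd
          apply h
          have : (k + (w - r)) % w = 0 :=
            Nat.mod_eq_zero_of_dvd (by convert hd using 1; omega)
          rcases Nat.lt_or_ge (k % w) r with hlt | hge
          · have e5 : k + (w - r) = (k % w + (w - r)) + w * (k / w) := by omega
            rw [e5, Nat.add_mul_mod_self_left, Nat.mod_eq_of_lt (by omega)] at this
            omega
          · have e5 : k + (w - r) = (k % w - r) + w * (k / w + 1) := by
              rw [mul_add]; omega
            rw [e5, Nat.add_mul_mod_self_left, Nat.mod_eq_of_lt (by omega)] at this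
            omega
        rw [e, Nat.succ_div_of_not_dvd e4, if_neg h, add_zero]
    rw [Finset.sum_range_succ, ih, Finset.sum_congr rfl hstep, Finset.sum_add_distrib,
      Finset.sum_ite_eq', if_pos (Finset.mem_range.2 (Nat.mod_lt k hw))]

section Hilbert

variable {H : Type*} [NormedAddCommGroup H] [InnerProductSpace ℝ H] [CompleteSpace H]
  [SecondCountableTopology H] [MeasurableSpace H] [BorelSpace H]
  {S : Type*} [MeasurableSpace S]
  {Ω : Type*} [MeasurableSpace Ω] {P : Measure Ω} [IsProbabilityMeasure P]

/-- The sum over `1, …, k` splits into the `w` residue classes modulo `w`; a class starting at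
`r + 1` has at most `4 k / (r + 1)` terms. -/
lemma maxRatio_sum_le_residues (f : ℕ → H) {w : ℕ} (hw : 0 < w) (N : ℕ) :
    maxRatio (fun k => ∑ i ∈ Finset.range k, f i) N ≤ ∑ r ∈ Finset.range w,
      ENNReal.ofReal (2 * (1 / √((r : ℝ) + 1))) *
        maxRatio (fun k => ∑ j ∈ Finset.range k, f (r + j * w)) N := by
  refine maxRatio_le fun k h1 h2 => ?_
  have hk : (0 : ℝ) < k := by exact_mod_cast h1
  have hk0 : (0 : ℝ) < √(k : ℝ) := Real.sqrt_pos.2 hk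
  rw [sum_range_eq_sum_residues f hw k]
  calc _ ≤ ENNReal.ofReal (∑ r ∈ Finset.range w,
        ‖∑ j ∈ Finset.range ((k + (w - 1 - r)) / w), f (r + j * w)‖ / √(k : ℝ)) := by
        refine ENNReal.ofReal_le_ofReal ?_
        rw [← Finset.sum_div]
        gcongr
        exact norm_sum_le _ _
    _ = ∑ r ∈ Finset.range w, ENNReal.ofReal
        (‖∑ j ∈ Finset.range ((k + (w - 1 - r)) / w), f (r + j * w)‖ / √(k : ℝ)) :=
        ENNReal.ofReal_sum_of_nonneg fun r _ => by positivity
    _ ≤ _ := Finset.sum_le_sum fun r hr => ?_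
  have hr := Finset.mem_range.1 hr
  set J := (k + (w - 1 - r)) / w with hJ
  rcases Nat.eq_zero_or_pos J with hJ0 | hJ0
  · simp [hJ0]
  have hJw : J * w ≤ k + (w - 1 - r) := Nat.div_mul_le_self _ _
  have hrk : r + 1 ≤ k := by
    have : w ≤ J * w := Nat.le_mul_of_pos_left _ hJ0
    omega
  have hJk : J ≤ k := by
    obtain ⟨J', hJ'⟩ : ∃ J', J = J' + 1 := ⟨J - 1, by omega⟩
    rw [hJ'] at hJw ⊢
    have : J' ≤ J' * w := Nat.le_mul_of_pos_right _ hw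
    have e : (J' + 1) * w = J' * w + w := by ring
    omega
  have hJN := le_maxRatio (fun k => ∑ j ∈ Finset.range k, f (r + j * w)) hJ0 (hJk.trans h2)
  refine le_trans ?_ (mul_le_mul_right hJN _)
  rw [← ENNReal.ofReal_mul (by positivity)]
  refine ENNReal.ofReal_le_ofReal ?_
  have hJr : (0 : ℝ) < √(J : ℝ) := Real.sqrt_pos.2 (by exact_mod_cast hJ0)
  have hrr : (0 : ℝ) < √((r : ℝ) + 1) := Real.sqrt_pos.2 (by positivity)
  have hcount : J * (r + 1) ≤ 4 * k := by
    have : J * (r + 1) ≤ J * w := Nat.mul_le_mul_left _ hr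
    rcases le_total w k with h | h
    · omega
    · have hJ1 : J ≤ 1 := by
        by_contra hc
        have : 2 * w ≤ J * w := Nat.mul_le_mul_right _ (by omega)
        omega
      calc J * (r + 1) ≤ 1 * (r + 1) := Nat.mul_le_mul_right _ hJ1
        _ ≤ 4 * k := by omega
  have hsq : √(J : ℝ) * √((r : ℝ) + 1) ≤ 2 * √(k : ℝ) := by
    rw [← Real.sqrt_mul (by positivity)]
    have : √(4 * (k : ℝ)) = 2 * √(k : ℝ) := by
      rw [Real.sqrt_mul (by norm_num), show (4 : ℝ) = 2 ^ 2 by norm_num,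
        Real.sqrt_sq (by norm_num)]
    rw [← this]
    exact Real.sqrt_le_sqrt (by exact_mod_cast hcount)
  rw [div_le_iff₀ hk0]
  set T := ‖∑ j ∈ Finset.range J, f (r + j * w)‖
  have hT : 0 ≤ T := norm_nonneg _
  calc T = T / (√(J : ℝ) * √((r : ℝ) + 1)) * (√(J : ℝ) * √((r : ℝ) + 1)) := by field_simp
    _ ≤ T / (√(J : ℝ) * √((r : ℝ) + 1)) * (2 * √(k : ℝ)) := by gcongr
    _ = _ := by field_simp

/-- Sums of a centred function of a window of `w` innovations: each residue class modulo `w` is an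
i.i.d. sequence, so the bound for i.i.d. summands deteriorates by the factor `√w`. -/
lemma exists_lintegral_maxRatio_window_le (s : ℕ) (hs : 1 ≤ s) :
    ∃ C : ℝ, 0 ≤ C ∧ ∀ (ε : ℤ → Ω → S) (μ : Measure S) [IsProbabilityMeasure μ],
      (∀ n, Measurable (ε n)) → iIndepFun ε P → (∀ n, P.map (ε n) = μ) →
      ∀ (h : (ℕ → S) → H) (w : ℕ), 0 < w → Measurable h →
      (∀ x y : ℕ → S, (∀ k < w, x k = y k) → h x = h y) →
      MemLp h 2 (seqLaw μ) → ∫ x, h x ∂(seqLaw μ) = 0 →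
      ∀ β : ℝ, 0 < β → ∫ x, ‖h x‖ ^ 2 ∂(seqLaw μ) ≤ β ^ 2 →
      ∀ L N : ℕ, 1 ≤ L → N < 2 ^ L →
      ∫⁻ ω, maxRatio (fun k => ∑ i ∈ Finset.range k, h (past ε ((i + 1 : ℕ) : ℤ) ω)) N ∂P
        ≤ ENNReal.ofReal (C * (√(w : ℝ) * β) * (L : ℝ) ^ ((2 * s : ℕ) : ℝ)⁻¹) := by
  obtain ⟨C, hC, hiid⟩ := exists_lintegral_maxRatio_iid_le (H := H) (P := P) s hs
  refine ⟨4 * C, by positivity, fun ε μ _ hm hind hid h w hw hh hdep hL2 h0 β hβ h2 L N hL hN => ?_⟩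
  obtain ⟨ω₀⟩ : Nonempty Ω := nonempty_of_isProbabilityMeasure P
  set s₀ : S := ε 0 ω₀
  -- as a function of the window alone
  set φ : (Fin w → S) → H := fun b => h fun k => if hk : k < w then b ⟨k, hk⟩ else s₀ with hφ
  have hφm : Measurable φ := by
    refine hh.comp (measurable_pi_lambda _ fun k => ?_)
    split_ifs <;> fun_prop
  have hpm : IsProbabilityMeasure ((seqLaw μ).map h) :=
    Measure.isProbabilityMeasure_map hh.aemeasurable
  have hclass : ∀ r : ℕ, ∫⁻ ω, maxRatio (fun k => ∑ j ∈ Finset.range k,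
      h (past ε ((r + j * w + 1 : ℕ) : ℤ) ω)) N ∂P ≤
      ENNReal.ofReal (C * β * (L : ℝ) ^ ((2 * s : ℕ) : ℝ)⁻¹) := by
    intro r
    refine hiid ((seqLaw μ).map h) (fun j ω => h (past ε ((r + j * w + 1 : ℕ) : ℤ) ω))
      (fun j => hh.comp (measurable_past hm _)) ?_ (fun j => ?_) ?_ ?_ β hβ ?_ L N hL hN
    · have hcomp := (iIndepFun_windows hm hind (w := w) r).comp (fun _ => φ) fun _ => hφm
      convert hcomp using 3 with j ω
      simp only [Function.comp, hφ]
      refine hdep _ _ fun k hk => ?_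
      simp [hk, past]
    · rw [← map_past hm hind hid ((r + j * w + 1 : ℕ) : ℤ),
        Measure.map_map hh (measurable_past hm _)]
      rfl
    · exact (memLp_map_measure_iff aestronglyMeasurable_id hh.aemeasurable).2 hL2
    · rw [integral_map hh.aemeasurable (by fun_prop)]; exact h0
    · rw [integral_map hh.aemeasurable (by fun_prop)]; exact h2
  calc _ ≤ ∫⁻ ω, ∑ r ∈ Finset.range w, ENNReal.ofReal (2 * (1 / √((r : ℝ) + 1))) *
        maxRatio (fun k => ∑ j ∈ Finset.range k, h (past ε ((r + j * w + 1 : ℕ) : ℤ) ω)) N ∂P :=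
        lintegral_mono fun ω => maxRatio_sum_le_residues
          (fun i => h (past ε ((i + 1 : ℕ) : ℤ) ω)) hw N
    _ = ∑ r ∈ Finset.range w, ENNReal.ofReal (2 * (1 / √((r : ℝ) + 1))) * ∫⁻ ω,
        maxRatio (fun k => ∑ j ∈ Finset.range k, h (past ε ((r + j * w + 1 : ℕ) : ℤ) ω)) N ∂P := by
        have hmeas : ∀ r : ℕ, Measurable fun ω => maxRatio (fun k => ∑ j ∈ Finset.range k,
            h (past ε ((r + j * w + 1 : ℕ) : ℤ) ω)) N := fun r =>
          measurable_maxRatio (fun k => Finset.measurable_sum _ fun j _ =>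
            hh.comp (measurable_past hm _)) N
        rw [lintegral_finsetSum _ fun r _ => (hmeas r).const_mul _]
        exact Finset.sum_congr rfl fun r _ => lintegral_const_mul _ (hmeas r)
    _ ≤ ∑ r ∈ Finset.range w, ENNReal.ofReal (2 * (1 / √((r : ℝ) + 1))) *
        ENNReal.ofReal (C * β * (L : ℝ) ^ ((2 * s : ℕ) : ℝ)⁻¹) := by
        gcongr with r; exact hclass r
    _ = ENNReal.ofReal ((2 * ∑ r ∈ Finset.range w, 1 / √((r : ℝ) + 1)) *
        (C * β * (L : ℝ) ^ ((2 * s : ℕ) : ℝ)⁻¹)) := by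
        rw [← Finset.sum_mul, ← ENNReal.ofReal_sum_of_nonneg fun r _ => by positivity,
          ← Finset.mul_sum, ← ENNReal.ofReal_mul (by positivity)]
    _ ≤ _ := by
        refine ENNReal.ofReal_le_ofReal ?_
        calc _ ≤ (2 * (2 * √(w : ℝ))) * (C * β * (L : ℝ) ^ ((2 * s : ℕ) : ℝ)⁻¹) := by
              gcongr; exact sum_inv_sqrt_le w
          _ = _ := by ring

end Hilbert

/-! ### Causal functionals of an i.i.d. sequence -/

section Hilbert

variable {H : Type*} [NormedAddCommGroup H] [InnerProductSpace ℝ H] [CompleteSpace H]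
  [SecondCountableTopology H] [MeasurableSpace H] [BorelSpace H]
  {S : Type*} [MeasurableSpace S]

/-- The conditional expectation of `G` given the first `m` coordinates, as a function of the whole
sequence: the other coordinates are replaced by independent ones and integrated out. -/
noncomputable def windowMean (μ : Measure S) (G : (ℕ → S) → H) (m : ℕ) (x : ℕ → S) : H :=
  ∫ y, G (splice m (x, y)) ∂(seqLaw μ)

/-- The `L²` distance between `G` and its copy with all but the first `m` coordinates resampled. -/
noncomputable def resamplingError (μ : Measure S) (G : (ℕ → S) → H) (m : ℕ) : ℝ≥0∞ :=
  eLpNorm (fun z => G z.1 - G (splice m z)) 2 ((seqLaw μ).prod (seqLaw μ))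

variable {μ : Measure S} [IsProbabilityMeasure μ] {G : (ℕ → S) → H}

lemma measurable_windowMean (hG : Measurable G) (m : ℕ) : Measurable (windowMean μ G m) := by
  have : StronglyMeasurable fun z : (ℕ → S) × (ℕ → S) => G (splice m z) :=
    (hG.comp (measurable_splice m)).stronglyMeasurable
  exact this.integral_prod_right.measurable

lemma windowMean_congr (m : ℕ) {x y : ℕ → S} (h : ∀ k < m, x k = y k) :
    windowMean μ G m x = windowMean μ G m y := by
  unfold windowMean
  congr 1 with z
  congr 1
  ext k
  unfold splice
  split_ifs with hk
  · exact h k hk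
  · rfl

lemma memLp_comp_splice (h2 : MemLp G 2 (seqLaw μ)) (m : ℕ) :
    MemLp (fun z => G (splice m z)) 2 ((seqLaw μ).prod (seqLaw μ)) :=
  h2.comp_measurePreserving (measurePreserving_splice μ m)

lemma memLp_comp_fst (h2 : MemLp G 2 (seqLaw μ)) :
    MemLp (fun z : (ℕ → S) × (ℕ → S) => G z.1) 2 ((seqLaw μ).prod (seqLaw μ)) :=
  h2.comp_measurePreserving measurePreserving_fst

lemma resamplingError_ne_top (h2 : MemLp G 2 (seqLaw μ)) (m : ℕ) :
    resamplingError μ G m ≠ ∞ :=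
  ((memLp_comp_fst h2).sub (memLp_comp_splice h2 m)).eLpNorm_ne_top

lemma integral_windowMean (h2 : MemLp G 2 (seqLaw μ)) (m : ℕ) :
    ∫ x, windowMean μ G m x ∂(seqLaw μ) = ∫ x, G x ∂(seqLaw μ) := by
  have hi : Integrable (fun z => G (splice m z)) ((seqLaw μ).prod (seqLaw μ)) :=
    (memLp_comp_splice h2 m).integrable (by norm_num)
  have hp := measurePreserving_splice μ m
  unfold windowMean
  rw [← integral_prod _ hi]
  have := integral_map hp.measurable.aemeasurable (f := G) (μ := (seqLaw μ).prod (seqLaw μ))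
    (by rw [hp.map_eq]; exact h2.aestronglyMeasurable)
  rw [hp.map_eq] at this
  exact this.symm

/-- Conditional averaging is closer to `G` than resampling is (Jensen's inequality). -/
lemma eLpNorm_sub_windowMean_le (hG : Measurable G) (h2 : MemLp G 2 (seqLaw μ)) (m : ℕ) :
    eLpNorm (fun x => G x - windowMean μ G m x) 2 (seqLaw μ) ≤ resamplingError μ G m := by
  set Q := seqLaw μ
  have hi : Integrable (fun z => G (splice m z)) (Q.prod Q) :=
    (memLp_comp_splice h2 m).integrable (by norm_num)
  have hdm : Measurable fun z : (ℕ → S) × (ℕ → S) => G z.1 - G (splice m z) :=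
    (hG.comp measurable_fst).sub (hG.comp (measurable_splice m))
  have hpt : ∀ᵐ x ∂Q, ‖G x - windowMean μ G m x‖ₑ ^ (2 : ℝ) ≤
      ∫⁻ y, ‖G x - G (splice m (x, y))‖ₑ ^ (2 : ℝ) ∂Q := by
    filter_upwards [hi.prod_right_ae] with x hx
    have hsm : Measurable fun y : ℕ → S => G x - G (splice m (x, y)) :=
      hdm.comp (measurable_const.prodMk measurable_id)
    have e : G x - windowMean μ G m x = ∫ y, (G x - G (splice m (x, y))) ∂Q := by
      rw [integral_sub (integrable_const _) hx]
      simp [windowMean, Q]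
    rw [e]
    have h1 : eLpNorm (fun y => G x - G (splice m (x, y))) 1 Q ≤
        eLpNorm (fun y => G x - G (splice m (x, y))) 2 Q :=
      eLpNorm_le_eLpNorm_of_exponent_le (by norm_num) hsm.aestronglyMeasurable
    rw [eLpNorm_one_eq_lintegral_enorm, eLpNorm_eq_lintegral_rpow_enorm_toReal (by norm_num)
      (by norm_num)] at h1
    have h3 := (enorm_integral_le_lintegral_enorm (fun y => G x - G (splice m (x, y)))).trans h1
    calc _ ≤ _ := ENNReal.rpow_le_rpow h3 (by norm_num)
      _ = _ := by rw [← ENNReal.rpow_mul]; norm_num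
  unfold resamplingError
  rw [eLpNorm_eq_lintegral_rpow_enorm_toReal (by norm_num) (by norm_num),
    eLpNorm_eq_lintegral_rpow_enorm_toReal (by norm_num) (by norm_num)]
  simp only [ENNReal.toReal_ofNat]
  gcongr
  rw [lintegral_prod _ (hdm.enorm.pow_const _).aemeasurable]
  exact lintegral_mono_ae hpt

lemma memLp_windowMean (hG : Measurable G) (h2 : MemLp G 2 (seqLaw μ)) (m : ℕ) :
    MemLp (windowMean μ G m) 2 (seqLaw μ) := by
  have h : MemLp (fun x => G x - windowMean μ G m x) 2 (seqLaw μ) :=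
    ⟨(hG.sub (measurable_windowMean hG m)).aestronglyMeasurable,
      (eLpNorm_sub_windowMean_le hG h2 m).trans_lt (resamplingError_ne_top h2 m).lt_top⟩
  convert h2.sub h using 1
  ext x
  simp

variable {Ω : Type*} [MeasurableSpace Ω] {P : Measure Ω} [IsProbabilityMeasure P]

lemma maxRatio_sum_add_le (f g : ℕ → H) (N : ℕ) :
    maxRatio (fun k => ∑ i ∈ Finset.range k, (f i + g i)) N ≤
      maxRatio (fun k => ∑ i ∈ Finset.range k, f i) N +
      maxRatio (fun k => ∑ i ∈ Finset.range k, g i) N := by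
  refine maxRatio_le fun k h1 h2 => ?_
  refine le_trans ?_ (add_le_add (le_maxRatio (fun k => ∑ i ∈ Finset.range k, f i) h1 h2)
    (le_maxRatio (fun k => ∑ i ∈ Finset.range k, g i) h1 h2))
  rw [← ENNReal.ofReal_add (by positivity) (by positivity), ← add_div, Finset.sum_add_distrib]
  refine ENNReal.ofReal_le_ofReal ?_
  gcongr
  exact norm_add_le _ _

lemma maxRatio_sum_finsetSum_le (f : ℕ → ℕ → H) (n N : ℕ) :
    maxRatio (fun k => ∑ i ∈ Finset.range k, ∑ l ∈ Finset.range n, f l i) N ≤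
      ∑ l ∈ Finset.range n, maxRatio (fun k => ∑ i ∈ Finset.range k, f l i) N := by
  induction n with
  | zero => simp [maxRatio]
  | succ n ih =>
    simp_rw [Finset.sum_range_succ _ n]
    exact (maxRatio_sum_add_le _ _ N).trans (by gcongr)

lemma maxRatio_sum_le_sum_enorm (f : ℕ → H) (N : ℕ) :
    maxRatio (fun k => ∑ i ∈ Finset.range k, f i) N ≤ ∑ i ∈ Finset.range N, ‖f i‖ₑ := by
  refine maxRatio_le fun k h1 h2 => ?_
  have hk : 1 ≤ √(k : ℝ) := Real.one_le_sqrt.2 (by exact_mod_cast h1)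
  calc _ ≤ ENNReal.ofReal ‖∑ i ∈ Finset.range k, f i‖ :=
        ENNReal.ofReal_le_ofReal (div_le_self (norm_nonneg _) hk)
    _ = ‖∑ i ∈ Finset.range k, f i‖ₑ := ofReal_norm _
    _ ≤ ∑ i ∈ Finset.range k, ‖f i‖ₑ := enorm_sum_le _ _
    _ ≤ _ := Finset.sum_le_sum_of_subset (Finset.range_mono h2)

/-- If the resampling errors are summable, the block `[2 ^ l, 2 ^ (l + 1))` contains a window length
whose error is at most a constant multiple of `2 ^ (-l)`. -/
lemma exists_window_lengths {d : ℕ → ℝ} (hd : ∀ m, 0 ≤ d m) (hs : Summable d) :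
    ∃ M : ℕ → ℕ, M 0 = 0 ∧ (∀ l, M l ≤ 2 ^ l) ∧
      ∀ l, d (M (l + 1)) ≤ (∑' m, d m) / 2 ^ l := by
  have hex : ∀ l : ℕ, ∃ m ∈ Finset.Ico (2 ^ l) (2 ^ (l + 1)), d m ≤ (∑' m, d m) / 2 ^ l := by
    intro l
    by_contra! hc
    have hne : (Finset.Ico (2 ^ l) (2 ^ (l + 1))).Nonempty := by
      rw [Finset.nonempty_Ico]; exact Nat.pow_lt_pow_right (by norm_num) (by omega)
    have h1 := Finset.sum_lt_sum_of_nonempty hne hc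
    have h2 : ∑ m ∈ Finset.Ico (2 ^ l) (2 ^ (l + 1)), d m ≤ ∑' m, d m :=
      hs.sum_le_tsum _ fun m _ => hd m
    have hcard : ((2 ^ (l + 1) - 2 ^ l : ℕ) : ℝ) = 2 ^ l := by
      rw [pow_succ, mul_two, Nat.add_sub_cancel]; push_cast; rfl
    rw [Finset.sum_const, Nat.card_Ico, nsmul_eq_mul, hcard] at h1
    have h3 : (2 : ℝ) ^ l * ((∑' m, d m) / 2 ^ l) = ∑' m, d m := by field_simp
    linarith
  choose m hm hdm using hex
  refine ⟨fun l => match l with | 0 => 0 | l + 1 => m l, rfl, fun l => ?_, hdm⟩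
  cases l with
  | zero => simp
  | succ l => exact (Finset.mem_Ico.1 (hm l)).2.le

/-- For a centred square integrable causal functional with summable resampling errors, the
self-normalized maxima of the partial sums over `n ≤ N` grow slower than every power of `log N`.
The functional is decomposed into increments of its conditional expectations over windows of
geometrically growing length. -/
theorem exists_lintegral_maxRatio_shift_le (s : ℕ) (hs : 1 ≤ s) {ε : ℤ → Ω → S}
    (hm : ∀ n, Measurable (ε n)) (hind : iIndepFun ε P) (hid : ∀ n, P.map (ε n) = μ)
    (hG : Measurable G) (h2 : MemLp G 2 (seqLaw μ)) (h0 : ∫ x, G x ∂(seqLaw μ) = 0)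
    (hsum : ∑' m, resamplingError μ G m ≠ ∞) :
    ∃ K : ℝ, 0 ≤ K ∧ ∀ L N : ℕ, 1 ≤ L → N < 2 ^ L →
      ∫⁻ ω, maxRatio (fun k => ∑ i ∈ Finset.range k, G (past ε ((i + 1 : ℕ) : ℤ) ω)) N ∂P
        ≤ ENNReal.ofReal (K * (L : ℝ) ^ ((2 * s : ℕ) : ℝ)⁻¹) := by
  obtain ⟨C, hC, hwin⟩ := exists_lintegral_maxRatio_window_le (H := H) (S := S) (P := P) s hs
  set Q := seqLaw μ with hQ
  set d : ℕ → ℝ := fun m => (resamplingError μ G m).toReal with hd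
  have hd0 : ∀ m, 0 ≤ d m := fun m => ENNReal.toReal_nonneg
  have hds : Summable d := ENNReal.summable_toReal hsum
  obtain ⟨M, hM0, hMle, hMd⟩ := exists_window_lengths hd0 hds
  set T := ∑' m, d m with hT
  have hT0 : 0 ≤ T := tsum_nonneg hd0
  set B := 3 * T + d 0 + 1 with hB
  have hBpos : 0 < B := by have := hd0 0; positivity
  set h : ℕ → (ℕ → S) → H := fun l x => windowMean μ G (M (l + 1)) x - windowMean μ G (M l) x
    with hh
  have hdist : ∀ m, eLpNorm (fun x => G x - windowMean μ G m x) 2 Q ≤ ENNReal.ofReal (d m) := by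
    intro m
    rw [hd, ENNReal.ofReal_toReal (resamplingError_ne_top h2 m)]
    exact eLpNorm_sub_windowMean_le hG h2 m
  have hβ : ∀ l, d (M (l + 1)) + d (M l) ≤ B / 2 ^ l := by
    intro l
    cases l with
    | zero =>
      have := hMd 0
      simp only [pow_zero, div_one] at this ⊢
      rw [hM0]; linarith
    | succ l =>
      have h1 := hMd (l + 1)
      have h3 := hMd l
      have e : T / 2 ^ l = 2 * T / 2 ^ (l + 1) := by rw [pow_succ]; field_simp
      rw [e] at h3
      calc _ ≤ T / 2 ^ (l + 1) + 2 * T / 2 ^ (l + 1) := add_le_add h1 h3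
        _ = (3 * T) / 2 ^ (l + 1) := by ring
        _ ≤ B / 2 ^ (l + 1) := by gcongr; have := hd0 0; rw [hB]; linarith
  have hhm : ∀ l, Measurable (h l) := fun l =>
    (measurable_windowMean hG _).sub (measurable_windowMean hG _)
  have hhL2 : ∀ l, MemLp (h l) 2 Q := fun l =>
    (memLp_windowMean hG h2 _).sub (memLp_windowMean hG h2 _)
  have hh0 : ∀ l, ∫ x, h l x ∂Q = 0 := fun l => by
    rw [hh]
    simp only
    rw [integral_sub ((memLp_windowMean hG h2 _).integrable (by norm_num))
      ((memLp_windowMean hG h2 _).integrable (by norm_num)), integral_windowMean h2,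
      integral_windowMean h2, sub_self]
  have hhnorm : ∀ l, ∫ x, ‖h l x‖ ^ 2 ∂Q ≤ (B / 2 ^ l) ^ 2 := by
    intro l
    have hle : eLpNorm (h l) 2 Q ≤ ENNReal.ofReal (B / 2 ^ l) := by
      have e : h l = (fun x => G x - windowMean μ G (M l) x) -
          fun x => G x - windowMean μ G (M (l + 1)) x := by
        ext x; simp [hh]
      rw [e]
      refine (eLpNorm_sub_le (hG.sub (measurable_windowMean hG _)).aestronglyMeasurable
        (hG.sub (measurable_windowMean hG _)).aestronglyMeasurable (by norm_num)).trans ?_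
      refine (add_le_add (hdist _) (hdist _)).trans ?_
      rw [← ENNReal.ofReal_add (hd0 _) (hd0 _)]
      exact ENNReal.ofReal_le_ofReal (by linarith [hβ l])
    rw [(hhL2 l).eLpNorm_eq_integral_rpow_norm (by norm_num) (by norm_num)] at hle
    have h4 := (ENNReal.ofReal_le_ofReal_iff (by positivity)).1 hle
    simp only [ENNReal.toReal_ofNat, Real.rpow_ofNat] at h4
    have hnn : 0 ≤ ∫ x, ‖h l x‖ ^ 2 ∂Q := integral_nonneg fun x => by positivity
    calc ∫ x, ‖h l x‖ ^ 2 ∂Q = ((∫ x, ‖h l x‖ ^ 2 ∂Q) ^ (2 : ℝ)⁻¹) ^ 2 := by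
          rw [← Real.rpow_natCast, ← Real.rpow_mul hnn]; norm_num
      _ ≤ _ := by gcongr
  set q : ℝ := (√2)⁻¹ with hq
  have hq0 : 0 ≤ q := by positivity
  have hq1 : q < 1 := inv_lt_one_of_one_lt₀ (Real.lt_sqrt_of_sq_lt (by norm_num))
  -- the factor `√w` lost for windows of length `w = 2 ^ (l + 1)` is beaten by the size `B / 2 ^ l`
  -- of the increments
  have hgeo : ∀ l : ℕ, √((2 ^ (l + 1) : ℕ) : ℝ) * (B / 2 ^ l) = √2 * B * q ^ l := by
    intro l
    have e1 : √((2 ^ (l + 1) : ℕ) : ℝ) = √2 ^ (l + 1) := by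
      push_cast
      rw [Real.sqrt_eq_iff_eq_sq (by positivity) (by positivity), ← pow_mul, mul_comm, pow_mul,
        Real.sq_sqrt (by norm_num)]
    have e2 : (2 : ℝ) ^ l = √2 ^ l * √2 ^ l := by
      rw [← mul_pow, Real.mul_self_sqrt (by norm_num)]
    rw [e1, e2, hq, inv_pow, pow_succ]
    field_simp
  refine ⟨C * (√2 * B * (1 - q)⁻¹), by have := sub_pos.2 hq1; positivity,
    fun L N hL hN => ?_⟩
  set x₀ := (L : ℝ) ^ ((2 * s : ℕ) : ℝ)⁻¹ with hx0
  have hx0' : 0 ≤ x₀ := by positivity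
  have hpiece : ∀ l, ∫⁻ ω, maxRatio (fun k => ∑ i ∈ Finset.range k,
      h l (past ε ((i + 1 : ℕ) : ℤ) ω)) N ∂P ≤ ENNReal.ofReal (C * (√2 * B * q ^ l) * x₀) := by
    intro l
    rw [← hgeo l]
    refine hwin ε μ hm hind hid (h l) (2 ^ (l + 1)) (by positivity) (hhm l) (fun x y hxy => ?_)
      (hhL2 l) (hh0 l) (B / 2 ^ l) (by positivity) (hhnorm l) L N hL hN
    have h5 : M l ≤ 2 ^ (l + 1) := (hMle l).trans (Nat.pow_le_pow_right (by norm_num) (by omega))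
    simp only [hh]
    rw [windowMean_congr (M (l + 1)) fun k hk => hxy k (hk.trans_le (hMle _)),
      windowMean_congr (M l) fun k hk => hxy k (hk.trans_le h5)]
  have hW0 : ∀ x, windowMean μ G (M 0) x = 0 := fun x => by
    rw [hM0, windowMean]
    simp only [splice_zero]
    exact h0
  have hrest : ∀ n i, ∫⁻ ω, ‖G (past ε ((i + 1 : ℕ) : ℤ) ω) -
      windowMean μ G (M n) (past ε ((i + 1 : ℕ) : ℤ) ω)‖ₑ ∂P ≤ ENNReal.ofReal (d (M n)) := by
    intro n i
    have hmm : Measurable fun x => G x - windowMean μ G (M n) x :=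
      hG.sub (measurable_windowMean hG _)
    have e : ∫⁻ ω, ‖G (past ε ((i + 1 : ℕ) : ℤ) ω) -
        windowMean μ G (M n) (past ε ((i + 1 : ℕ) : ℤ) ω)‖ₑ ∂P =
        ∫⁻ x, ‖G x - windowMean μ G (M n) x‖ₑ ∂Q := by
      rw [hQ, ← map_past hm hind hid ((i + 1 : ℕ) : ℤ), lintegral_map hmm.enorm
        (measurable_past hm _)]
    rw [e, ← eLpNorm_one_eq_lintegral_enorm]
    exact (eLpNorm_le_eLpNorm_of_exponent_le (by norm_num) hmm.aestronglyMeasurable).trans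
      (hdist _)
  -- `N` is fixed while `n → ∞`, so a crude bound suffices for the remainder
  have hn : ∀ n, ∫⁻ ω, maxRatio (fun k => ∑ i ∈ Finset.range k,
      G (past ε ((i + 1 : ℕ) : ℤ) ω)) N ∂P ≤
      ENNReal.ofReal (C * (√2 * B * (1 - q)⁻¹) * x₀) + ENNReal.ofReal (N * d (M n)) := by
    intro n
    have hpt : ∀ ω, maxRatio (fun k => ∑ i ∈ Finset.range k, G (past ε ((i + 1 : ℕ) : ℤ) ω)) N ≤
        ∑ l ∈ Finset.range n, maxRatio (fun k => ∑ i ∈ Finset.range k,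
          h l (past ε ((i + 1 : ℕ) : ℤ) ω)) N +
        ∑ i ∈ Finset.range N, ‖G (past ε ((i + 1 : ℕ) : ℤ) ω) -
          windowMean μ G (M n) (past ε ((i + 1 : ℕ) : ℤ) ω)‖ₑ := by
      intro ω
      have htel : ∀ x, G x = ∑ l ∈ Finset.range n, h l x + (G x - windowMean μ G (M n) x) := by
        intro x
        simp only [hh]
        rw [Finset.sum_range_sub (fun l => windowMean μ G (M l) x), hW0 x]
        abel
      calc _ = maxRatio (fun k => ∑ i ∈ Finset.range k,
            (∑ l ∈ Finset.range n, h l (past ε ((i + 1 : ℕ) : ℤ) ω) +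
              (G (past ε ((i + 1 : ℕ) : ℤ) ω) -
                windowMean μ G (M n) (past ε ((i + 1 : ℕ) : ℤ) ω)))) N := by
            congr 1
            ext k
            exact Finset.sum_congr rfl fun i _ => htel _
        _ ≤ _ := maxRatio_sum_add_le _ _ N
        _ ≤ _ := add_le_add (maxRatio_sum_finsetSum_le
            (fun l i => h l (past ε ((i + 1 : ℕ) : ℤ) ω)) n N) (maxRatio_sum_le_sum_enorm _ N)
    have hmeas1 : ∀ l, Measurable fun ω => maxRatio (fun k => ∑ i ∈ Finset.range k,
          h l (past ε ((i + 1 : ℕ) : ℤ) ω)) N := fun l =>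
      measurable_maxRatio (fun k => Finset.measurable_sum _ fun i _ =>
        (hhm l).comp (measurable_past hm _)) N
    have hmeas2 : ∀ i, Measurable fun ω => ‖G (past ε ((i + 1 : ℕ) : ℤ) ω) -
          windowMean μ G (M n) (past ε ((i + 1 : ℕ) : ℤ) ω)‖ₑ := fun i =>
      ((hG.sub (measurable_windowMean hG _)).comp (measurable_past hm ((i + 1 : ℕ) : ℤ))).enorm
    refine (lintegral_mono hpt).trans ?_
    rw [lintegral_add_left (Finset.measurable_fun_sum _ fun l _ => hmeas1 l),
      lintegral_finsetSum _ fun l _ => hmeas1 l, lintegral_finsetSum _ fun i _ => hmeas2 i]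
    refine add_le_add ?_ ?_
    · calc _ ≤ ∑ l ∈ Finset.range n, ENNReal.ofReal (C * (√2 * B * q ^ l) * x₀) :=
            Finset.sum_le_sum fun l _ => hpiece l
        _ = ENNReal.ofReal (∑ l ∈ Finset.range n, C * (√2 * B * q ^ l) * x₀) :=
            (ENNReal.ofReal_sum_of_nonneg fun l _ => by positivity).symm
        _ ≤ _ := by
            refine ENNReal.ofReal_le_ofReal ?_
            rw [← Finset.sum_mul, ← Finset.mul_sum, ← Finset.mul_sum,
              ← tsum_geometric_of_lt_one hq0 hq1]
            gcongr
            exact (summable_geometric_of_lt_one hq0 hq1).sum_le_tsum _ fun _ _ => by positivity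
    · calc _ ≤ ∑ i ∈ Finset.range N, ENNReal.ofReal (d (M n)) :=
            Finset.sum_le_sum fun i _ => hrest n i
        _ = _ := by
            rw [Finset.sum_const, Finset.card_range, nsmul_eq_mul,
              ENNReal.ofReal_mul (by positivity), ENNReal.ofReal_natCast]
  have hlim : Tendsto (fun n : ℕ => ENNReal.ofReal (C * (√2 * B * (1 - q)⁻¹) * x₀) +
      ENNReal.ofReal (N * d (M (n + 1)))) atTop
      (𝓝 (ENNReal.ofReal (C * (√2 * B * (1 - q)⁻¹) * x₀) + ENNReal.ofReal (N * 0))) := by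
    refine tendsto_const_nhds.add (ENNReal.tendsto_ofReal (Tendsto.const_mul _ ?_))
    refine squeeze_zero (fun n => hd0 _) hMd ?_
    simp_rw [div_eq_mul_inv, ← inv_pow]
    simpa using (tendsto_pow_atTop_nhds_zero_of_lt_one (by norm_num : (0 : ℝ) ≤ 2⁻¹)
      (by norm_num)).const_mul T
  simpa using ge_of_tendsto hlim (Eventually.of_forall fun n => hn (n + 1))

end Hilbert

/-! ### Leading eigenvectors of compact positive operators -/

section Spectral

variable {E : Type*} [NormedAddCommGroup E] [InnerProductSpace ℝ E]

/-- A compact, symmetric and positive semidefinite operator. -/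
structure IsCompactPositive (T : E →L[ℝ] E) : Prop where
  symm : ∀ x y, inner ℝ (T x) y = inner ℝ x (T y)
  nonneg : ∀ x, 0 ≤ inner ℝ (T x) x
  compact : IsCompactOperator T

/-- `f 0, …, f (n - 1)` are orthonormal eigenvectors of `T` with eigenvalues `ν 0, …, ν (n - 1)`,
and each `f i` maximizes the Rayleigh quotient on the orthogonal complement of the preceding
ones. Only the values at indices below `n` matter. -/
structure IsLeading (T : E →L[ℝ] E) (n : ℕ) (f : ℕ → E) (ν : ℕ → ℝ) : Prop where
  orth : ∀ i < n, ∀ k < n, inner ℝ (f i) (f k) = if i = k then 1 else 0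
  eig : ∀ i < n, T (f i) = ν i • f i
  max : ∀ i < n, ∀ y, (∀ k < i, inner ℝ (f k) y = 0) → inner ℝ (T y) y ≤ ν i * ‖y‖ ^ 2

lemma IsLeading.mono {T : E →L[ℝ] E} {n m : ℕ} {f : ℕ → E} {ν : ℕ → ℝ} (h : IsLeading T n f ν)
    (hm : m ≤ n) : IsLeading T m f ν :=
  ⟨fun i hi k hk => h.orth i (hi.trans_le hm) k (hk.trans_le hm),
    fun i hi => h.eig i (hi.trans_le hm),
    fun i hi => h.max i (hi.trans_le hm)⟩

lemma IsLeading.norm_eq {T : E →L[ℝ] E} {n : ℕ} {f : ℕ → E} {ν : ℕ → ℝ} (h : IsLeading T n f ν)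
    {i : ℕ} (hi : i < n) : ‖f i‖ = 1 := by
  have := h.orth i hi i hi
  rw [if_pos rfl, real_inner_self_eq_norm_sq] at this
  nlinarith [norm_nonneg (f i)]

lemma IsLeading.orthonormal {T : E →L[ℝ] E} {n : ℕ} {f : ℕ → E} {ν : ℕ → ℝ}
    (h : IsLeading T n f ν) : Orthonormal ℝ fun i : Fin n => f i := by
  classical
  rw [orthonormal_iff_ite]
  intro i k
  rw [h.orth i i.2 k k.2]
  simp [Fin.ext_iff]

lemma IsLeading.antitone {T : E →L[ℝ] E} {n : ℕ} {f : ℕ → E} {ν : ℕ → ℝ}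
    (h : IsLeading T n f ν) {i k : ℕ} (hik : i ≤ k) (hk : k < n) : ν k ≤ ν i := by
  have h1 := h.max i (hik.trans_lt hk) (f k) fun l hl => by
    rw [h.orth l (hl.trans (hik.trans_lt hk)) k hk, if_neg (by omega)]
  rw [h.eig k hk, real_inner_smul_left, real_inner_self_eq_norm_sq, h.norm_eq hk] at h1
  simpa using h1

/-- A dimension count: some unit vector in the span of `j + 1` orthonormal vectors is orthogonal
to `j` given vectors. -/
lemma exists_combination_orthogonal {j : ℕ} {g : Fin (j + 1) → E} (hg : Orthonormal ℝ g)
    (h : ℕ → E) : ∃ a : Fin (j + 1) → ℝ, ‖∑ i, a i • g i‖ = 1 ∧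
      ∀ k < j, inner ℝ (h k) (∑ i, a i • g i) = 0 := by
  let Λ : (Fin (j + 1) → ℝ) →ₗ[ℝ] (Fin j → ℝ) :=
    { toFun := fun a k => inner ℝ (h k) (∑ i, a i • g i)
      map_add' := fun a b => by
        ext k; simp [add_smul, Finset.sum_add_distrib, inner_add_right]
      map_smul' := fun c a => by
        ext k; simp [mul_smul, ← Finset.smul_sum, inner_smul_right] }
  have hker : LinearMap.ker Λ ≠ ⊥ := LinearMap.ker_ne_bot_of_finrank_lt (by simp)
  obtain ⟨a, ha, hne⟩ := Submodule.exists_mem_ne_zero_of_ne_bot hker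
  have hx : ∑ i, a i • g i ≠ 0 := by
    intro h0
    have := Fintype.linearIndependent_iff.1 hg.linearIndependent a h0
    exact hne (funext this)
  refine ⟨fun i => ‖∑ i, a i • g i‖⁻¹ * a i, ?_, fun k hk => ?_⟩
  · simp_rw [mul_smul, ← Finset.smul_sum]
    rw [norm_smul, norm_inv, norm_norm, inv_mul_cancel₀ (norm_ne_zero_iff.2 hx)]
  · simp_rw [mul_smul, ← Finset.smul_sum]
    rw [inner_smul_right]
    have := congrFun (LinearMap.mem_ker.1 ha) ⟨k, hk⟩
    change inner ℝ (h k) (∑ i, a i • g i) = 0 at this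
    rw [this, mul_zero]

/-- On the span of orthonormal eigenvectors the quadratic form is bounded below by the smallest
eigenvalue. -/
lemma le_inner_of_eigenvectors {T : E →L[ℝ] E} {j : ℕ} {g : Fin j → E} (hg : Orthonormal ℝ g)
    {ρ : Fin j → ℝ} (hT : ∀ i, T (g i) = ρ i • g i) {c : ℝ} (hc : ∀ i, c ≤ ρ i)
    (a : Fin j → ℝ) :
    c * ‖∑ i, a i • g i‖ ^ 2 ≤ inner ℝ (T (∑ i, a i • g i)) (∑ i, a i • g i) := by
  have e1 : T (∑ i, a i • g i) = ∑ i, (ρ i * a i) • g i := by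
    rw [map_sum]
    refine Finset.sum_congr rfl fun i _ => ?_
    rw [map_smul, hT, smul_smul, mul_comm]
  rw [← real_inner_self_eq_norm_sq, e1, hg.inner_sum, hg.inner_sum, Finset.mul_sum]
  refine Finset.sum_le_sum fun i _ => ?_
  simp only [conj_trivial]
  nlinarith [mul_nonneg (sub_nonneg.2 (hc i)) (mul_self_nonneg (a i))]

/-- The max-min principle. -/
lemma IsLeading.le_of_forall_span {T : E →L[ℝ] E} {n : ℕ} {f : ℕ → E} {ν : ℕ → ℝ}
    (h : IsLeading T n f ν) {j : ℕ} (hj : j < n) {g : Fin (j + 1) → E} (hg : Orthonormal ℝ g)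
    {c : ℝ} (hc : ∀ a : Fin (j + 1) → ℝ, c * ‖∑ i, a i • g i‖ ^ 2 ≤
      inner ℝ (T (∑ i, a i • g i)) (∑ i, a i • g i)) : c ≤ ν j := by
  obtain ⟨a, h1, h2⟩ := exists_combination_orthogonal hg f
  have h3 := (hc a).trans (h.max j hj _ h2)
  simpa [h1] using h3

/-- The min-max principle. -/
lemma IsLeading.le_of_forall_orthogonal {T : E →L[ℝ] E} {n : ℕ} {f : ℕ → E} {ν : ℕ → ℝ}
    (h : IsLeading T n f ν) {j : ℕ} (hj : j < n) (u : ℕ → E) {c : ℝ}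
    (hc : ∀ x, (∀ k < j, inner ℝ (u k) x = 0) → inner ℝ (T x) x ≤ c * ‖x‖ ^ 2) : ν j ≤ c := by
  have hlead := h.mono (m := j + 1) hj
  obtain ⟨a, h1, h2⟩ := exists_combination_orthogonal hlead.orthonormal u
  have h3 := le_inner_of_eigenvectors hlead.orthonormal (ρ := fun i => ν i)
    (fun i => h.eig i (by omega)) (c := ν j)
    (fun i => h.antitone (by omega) hj) a
  have h4 := h3.trans (hc _ h2)
  simpa [h1] using h4

/-- The `j`-th value of a leading system is the largest `c` for which there are `j + 1` orthonormal
eigenvectors with eigenvalues at least `c`. -/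
lemma IsLeading.isGreatest {T : E →L[ℝ] E} {n : ℕ} {f : ℕ → E} {ν : ℕ → ℝ}
    (h : IsLeading T n f ν) {j : ℕ} (hj : j < n) :
    IsGreatest {c : ℝ | ∃ (g : Fin (j + 1) → E) (ρ : Fin (j + 1) → ℝ), Orthonormal ℝ g ∧
      ∀ i, T (g i) = ρ i • g i ∧ c ≤ ρ i} (ν j) := by
  constructor
  · exact ⟨fun i => f i, fun i => ν i, (h.mono (m := j + 1) hj).orthonormal, fun i =>
      ⟨h.eig i (by omega), h.antitone (by omega) hj⟩⟩
  · rintro c ⟨g, ρ, hg, hgρ⟩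
    exact h.le_of_forall_span hj hg fun a =>
      le_inner_of_eigenvectors hg (fun i => (hgρ i).1) (fun i => (hgρ i).2) a

lemma IsLeading.update {T : E →L[ℝ] E} {n : ℕ} {f : ℕ → E} {ν : ℕ → ℝ}
    (h : IsLeading T n f ν) {x : E} {r : ℝ} (hx : ‖x‖ = 1) (hxf : ∀ k < n, inner ℝ (f k) x = 0)
    (hT : T x = r • x) (hmax : ∀ y, (∀ k < n, inner ℝ (f k) y = 0) →
      inner ℝ (T y) y ≤ r * ‖y‖ ^ 2) :
    IsLeading T (n + 1) (Function.update f n x) (Function.update ν n r) := by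
  have hlt : ∀ i < n, Function.update f n x i = f i ∧ Function.update ν n r i = ν i :=
    fun i hi => ⟨Function.update_of_ne hi.ne _ _, Function.update_of_ne hi.ne _ _⟩
  have hn : Function.update f n x n = x ∧ Function.update ν n r n = r :=
    ⟨Function.update_self _ _ _, Function.update_self _ _ _⟩
  refine ⟨fun i hi k hk => ?_, fun i hi => ?_, fun i hi y hy => ?_⟩
  · rcases Nat.lt_succ_iff_lt_or_eq.1 hi with hi | rfl <;>
      rcases Nat.lt_succ_iff_lt_or_eq.1 hk with hk | rfl
    · rw [(hlt i hi).1, (hlt k hk).1]; exact h.orth i hi k hk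
    · rw [(hlt i hi).1, hn.1, hxf i hi, if_neg hi.ne]
    · rw [(hlt k hk).1, hn.1, real_inner_comm, hxf k hk, if_neg hk.ne']
    · rw [hn.1, real_inner_self_eq_norm_sq, hx]; simp
  · rcases Nat.lt_succ_iff_lt_or_eq.1 hi with hi | rfl
    · rw [(hlt i hi).1, (hlt i hi).2]; exact h.eig i hi
    · rw [hn.1, hn.2]; exact hT
  · rcases Nat.lt_succ_iff_lt_or_eq.1 hi with hi | rfl
    · rw [(hlt i hi).2]
      exact h.max i hi y fun k hk => by
        rw [← (hlt k (hk.trans hi)).1]; exact hy k hk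
    · rw [hn.2]
      exact hmax y fun k hk => by rw [← (hlt k hk).1]; exact hy k hk

/-- If there are `n + 1` orthonormal vectors, the Rayleigh quotient of a compact positive operator
attains its maximum on the orthogonal complement of `n` leading eigenvectors, at an eigenvector. -/
lemma IsLeading.exists_next {T : E →L[ℝ] E} (hT : IsCompactPositive T) {n : ℕ} {f : ℕ → E}
    {ν : ℕ → ℝ} (h : IsLeading T n f ν) (hdim : ∃ g : Fin (n + 1) → E, Orthonormal ℝ g) :
    ∃ (x : E) (r : ℝ), ‖x‖ = 1 ∧ (∀ k < n, inner ℝ (f k) x = 0) ∧ T x = r • x ∧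
      ∀ y, (∀ k < n, inner ℝ (f k) y = 0) → inner ℝ (T y) y ≤ r * ‖y‖ ^ 2 := by
  obtain ⟨g, hg⟩ := hdim
  obtain ⟨a, ha1, ha2⟩ := exists_combination_orthogonal hg f
  set R : Set ℝ := {c | ∃ y, ‖y‖ = 1 ∧ (∀ k < n, inner ℝ (f k) y = 0) ∧ inner ℝ (T y) y = c} with hR
  have hRne : R.Nonempty := ⟨_, _, ha1, ha2, rfl⟩
  have hRbdd : BddAbove R := by
    refine ⟨‖T‖, ?_⟩
    rintro c ⟨y, hy, -, rfl⟩
    have h1 := real_inner_le_norm (T y) y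
    have h2 := T.le_opNorm y
    rw [hy, mul_one] at h1 h2
    exact h1.trans h2
  set r := sSup R with hr
  have hmax : ∀ y, (∀ k < n, inner ℝ (f k) y = 0) → inner ℝ (T y) y ≤ r * ‖y‖ ^ 2 := by
    intro y hy
    rcases eq_or_ne y 0 with rfl | hy0
    · simp
    have hny : ‖y‖ ≠ 0 := norm_ne_zero_iff.2 hy0
    have hmem : inner ℝ (T (‖y‖⁻¹ • y)) (‖y‖⁻¹ • y) ∈ R := by
      refine ⟨_, ?_, fun k hk => ?_, rfl⟩
      · rw [norm_smul, norm_inv, norm_norm, inv_mul_cancel₀ hny]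
      · rw [inner_smul_right, hy k hk, mul_zero]
    have h1 := le_csSup hRbdd hmem
    rw [map_smul, real_inner_smul_left, real_inner_smul_right, ← mul_assoc] at h1
    have hpos : 0 < ‖y‖ := norm_pos_iff.2 hy0
    calc inner ℝ (T y) y = (‖y‖⁻¹ * ‖y‖⁻¹ * inner ℝ (T y) y) * ‖y‖ ^ 2 := by field_simp
      _ ≤ r * ‖y‖ ^ 2 := by gcongr
  have hr0 : 0 ≤ r := by
    obtain ⟨c, hc⟩ := hRne
    obtain ⟨y, -, -, hy⟩ := id hc
    exact (hy ▸ hT.nonneg y).trans (le_csSup hRbdd hc)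
  have hinv : ∀ y, (∀ k < n, inner ℝ (f k) y = 0) → ∀ k < n, inner ℝ (f k) (T y) = 0 := by
    intro y hy k hk
    rw [← hT.symm, h.eig k hk, real_inner_smul_left, hy k hk, mul_zero]
  -- the Cauchy–Schwarz inequality for the semidefinite form of `T`
  have hCS : ∀ y, (∀ k < n, inner ℝ (f k) y = 0) → ‖T y‖ ^ 2 ≤ r * inner ℝ (T y) y := by
    intro y hy
    have key : ∀ t : ℝ, 0 ≤ inner ℝ (T y) y - 2 * t * ‖T y‖ ^ 2 + t ^ 2 * (r * ‖T y‖ ^ 2) := by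
      intro t
      have h1 := hT.nonneg (y - t • T y)
      have h2 := hmax (T y) (hinv y hy)
      have h3 : inner ℝ (T (T y)) y = ‖T y‖ ^ 2 := by
        rw [hT.symm, real_inner_self_eq_norm_sq]
      rw [map_sub, map_smul, inner_sub_left, inner_sub_right, inner_sub_right,
        real_inner_smul_left, real_inner_smul_right, real_inner_smul_left, real_inner_smul_right,
        h3, real_inner_self_eq_norm_sq] at h1
      nlinarith [mul_le_mul_of_nonneg_left h2 (sq_nonneg t)]
    rcases hr0.eq_or_lt with h0 | hpos
    · have h1 := key 1
      have h2 := hmax y hy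
      rw [← h0] at h1 h2 ⊢
      nlinarith [sq_nonneg ‖T y‖]
    · have h1 := key r⁻¹
      have e : inner ℝ (T y) y - 2 * r⁻¹ * ‖T y‖ ^ 2 + r⁻¹ ^ 2 * (r * ‖T y‖ ^ 2) =
          inner ℝ (T y) y - ‖T y‖ ^ 2 / r := by field_simp; ring
      rw [e] at h1
      have h2 : ‖T y‖ ^ 2 / r ≤ inner ℝ (T y) y := by linarith
      rw [div_le_iff₀ hpos] at h2
      linarith
  suffices hx : ∃ x : E, ‖x‖ = 1 ∧ (∀ k < n, inner ℝ (f k) x = 0) ∧ T x = r • x by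
    obtain ⟨x, h1, h2, h3⟩ := hx
    exact ⟨x, r, h1, h2, h3, hmax⟩
  rcases hr0.eq_or_lt with h0 | hpos
  · refine ⟨_, ha1, ha2, ?_⟩
    have h1 := hCS _ ha2
    rw [← h0, zero_mul] at h1
    rw [← h0, zero_smul, ← norm_eq_zero]
    exact pow_eq_zero_iff (two_ne_zero) |>.1 (le_antisymm h1 (sq_nonneg _))
  · -- a maximizing sequence; compactness of `T` makes a subsequence converge
    obtain ⟨u, -, hu, huR⟩ := exists_seq_tendsto_sSup hRne hRbdd
    choose y hy1 hy2 hy3 using huR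
    obtain ⟨K, hK, hKsub⟩ := hT.compact.image_closedBall_subset_compact (f := (T : E →ₗ[ℝ] E)) 1
    have hyK : ∀ m, T (y m) ∈ K := fun m => hKsub ⟨y m, by simp [hy1 m], rfl⟩
    obtain ⟨w, -, φ, hφ, hlim⟩ := hK.tendsto_subseq hyK
    have hdiff : Tendsto (fun m => T (y (φ m)) - r • y (φ m)) atTop (𝓝 0) := by
      rw [tendsto_zero_iff_norm_tendsto_zero]
      have hsq : Tendsto (fun m => √(r ^ 2 - r * u (φ m))) atTop (𝓝 0) := by
        have h1 : Tendsto (fun m => r ^ 2 - r * u (φ m)) atTop (𝓝 (r ^ 2 - r * r)) :=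
          tendsto_const_nhds.sub ((hu.comp hφ.tendsto_atTop).const_mul r)
        have h2 := (Real.continuous_sqrt.tendsto _).comp h1
        simpa [Function.comp_def, ← pow_two] using h2
      refine squeeze_zero (fun _ => norm_nonneg _) (fun m => ?_) hsq
      refine Real.le_sqrt_of_sq_le ?_
      have h1 := hCS (y (φ m)) (hy2 _)
      rw [norm_sub_sq_real, real_inner_smul_right, norm_smul, hy1, hy3, mul_one,
        Real.norm_of_nonneg hr0]
      rw [hy3] at h1
      linarith
    have hylim : Tendsto (fun m => y (φ m)) atTop (𝓝 (r⁻¹ • w)) := by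
      have h1 : Tendsto (fun m => r⁻¹ • (T (y (φ m)) - (T (y (φ m)) - r • y (φ m)))) atTop
          (𝓝 (r⁻¹ • (w - 0))) := (hlim.sub hdiff).const_smul _
      simpa [smul_smul, inv_mul_cancel₀ hpos.ne'] using h1
    refine ⟨r⁻¹ • w, ?_, fun k hk => ?_, ?_⟩
    · have := hylim.norm
      simp only [hy1] at this
      exact tendsto_nhds_unique this tendsto_const_nhds |>.symm ▸ rfl
    · have h1 : Tendsto (fun m => inner ℝ (f k) (y (φ m))) atTop (𝓝 (inner ℝ (f k) (r⁻¹ • w))) :=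
        tendsto_const_nhds.inner hylim
      simp only [hy2 _ k hk] at h1
      exact tendsto_nhds_unique h1 tendsto_const_nhds
    · have h1 : Tendsto (fun m => T (y (φ m))) atTop (𝓝 (T (r⁻¹ • w))) :=
        (T.continuous.tendsto _).comp hylim
      rw [smul_smul, mul_inv_cancel₀ hpos.ne', one_smul]
      exact tendsto_nhds_unique h1 hlim

/-- A leading system extends to any length that the dimension allows. -/
lemma IsLeading.exists_extend {T : E →L[ℝ] E} (hT : IsCompactPositive T) {n : ℕ} {f : ℕ → E}
    {ν : ℕ → ℝ} (h : IsLeading T n f ν) {m : ℕ} (hnm : n ≤ m)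
    (hdim : ∃ g : Fin m → E, Orthonormal ℝ g) :
    ∃ (f' : ℕ → E) (ν' : ℕ → ℝ), IsLeading T m f' ν' ∧ ∀ i < n, f' i = f i ∧ ν' i = ν i := by
  induction m, hnm using Nat.le_induction with
  | base => exact ⟨f, ν, h, fun _ _ => ⟨rfl, rfl⟩⟩
  | succ m hnm ih =>
    obtain ⟨g, hg⟩ := hdim
    obtain ⟨f', ν', h', he⟩ := ih ⟨_, hg.comp Fin.castSucc (Fin.castSucc_injective m)⟩
    obtain ⟨x, r, h1, h2, h3, h4⟩ := h'.exists_next hT ⟨g, hg⟩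
    refine ⟨_, _, h'.update h1 h2 h3 h4, fun i hi => ?_⟩
    have : i ≠ m := by omega
    rw [Function.update_of_ne this, Function.update_of_ne this]
    exact he i hi

lemma exists_isLeading {T : E →L[ℝ] E} (hT : IsCompactPositive T) {m : ℕ}
    (hdim : ∃ g : Fin m → E, Orthonormal ℝ g) :
    ∃ (f : ℕ → E) (ν : ℕ → ℝ), IsLeading T m f ν := by
  have h0 : IsLeading T 0 (fun _ => 0) (fun _ => 0) :=
    ⟨fun i hi => absurd hi (by omega), fun i hi => absurd hi (by omega),
      fun i hi => absurd hi (by omega)⟩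
  obtain ⟨f, ν, h, -⟩ := h0.exists_extend hT (Nat.zero_le m) hdim
  exact ⟨f, ν, h⟩

end Spectral

/-! ### Perturbation of simple eigenvalues -/

section Spectral

variable {E : Type*} [NormedAddCommGroup E] [InnerProductSpace ℝ E]

/-- The values of two leading systems of the same operator agree. -/
lemma IsLeading.value_eq {T : E →L[ℝ] E} {n m : ℕ} {f f' : ℕ → E} {ν ν' : ℕ → ℝ}
    (h : IsLeading T n f ν) (h' : IsLeading T m f' ν') {j : ℕ} (hn : j < n) (hm : j < m) :
    ν j = ν' j :=
  (h.isGreatest hn).unique (h'.isGreatest hm)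

/-- A unit eigenvector for an eigenvalue strictly below the preceding ones may be taken as the
corresponding member of a leading system. -/
lemma IsLeading.exists_through {T : E →L[ℝ] E} (hT : IsCompactPositive T) {n : ℕ} {f : ℕ → E}
    {ν : ℕ → ℝ} (h : IsLeading T n f ν) {j : ℕ} (hj : j < n) {v : E} (hv : ‖v‖ = 1)
    (hTv : T v = ν j • v) (hgap : ∀ i < j, ν j < ν i) :
    ∃ (f' : ℕ → E), IsLeading T n f' ν ∧ f' j = v := by
  have hort : ∀ k < j, inner ℝ (f k) v = 0 := by
    intro k hk
    have h1 := hT.symm (f k) v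
    rw [h.eig k (hk.trans hj), hTv, real_inner_smul_left, real_inner_smul_right] at h1
    have h2 : (ν k - ν j) * inner ℝ (f k) v = 0 := by linarith
    exact (mul_eq_zero.1 h2).resolve_left (sub_pos.2 (hgap k hk)).ne'
  have h1 := (h.mono hj.le).update hv hort hTv fun y hy => h.max j hj y hy
  obtain ⟨f', ν', h', he⟩ := h1.exists_extend hT (Nat.succ_le_of_lt hj) ⟨_, h.orthonormal⟩
  refine ⟨f', ⟨h'.orth, fun i hi => ?_, fun i hi => ?_⟩, ?_⟩
  · rw [h.value_eq h' hi hi]; exact h'.eig i hi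
  · rw [h.value_eq h' hi hi]; exact h'.max i hi
  · rw [(he j (Nat.lt_succ_self j)).1, Function.update_self]

/-- Weyl's inequality. -/
lemma IsLeading.abs_sub_le {A B : E →L[ℝ] E} {n m : ℕ} {f f' : ℕ → E} {ν ν' : ℕ → ℝ}
    (hA : IsLeading A n f ν) (hB : IsLeading B m f' ν') {j : ℕ} (hn : j < n) (hm : j < m) {D : ℝ}
    (hD : ∀ x y, |inner ℝ ((B - A) x) y| ≤ D * ‖x‖ * ‖y‖) : |ν' j - ν j| ≤ D := by
  have hquad : ∀ x, |inner ℝ (B x) x - inner ℝ (A x) x| ≤ D * ‖x‖ ^ 2 := fun x => by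
    have := hD x x
    rw [sub_apply, inner_sub_left] at this
    rwa [pow_two, ← mul_assoc]
  have hlead := hA.mono (m := j + 1) hn
  have hlo : ν j - D ≤ ν' j := by
    refine hB.le_of_forall_span hm hlead.orthonormal fun a => ?_
    have h1 := le_inner_of_eigenvectors hlead.orthonormal (ρ := fun i => ν i)
      (fun i => hA.eig i (by omega)) (c := ν j) (fun i => hA.antitone (by omega) hn) a
    have h2 := abs_le.1 (hquad (∑ i, a i • f i))
    linarith
  have hhi : ν' j ≤ ν j + D := by
    refine hB.le_of_forall_orthogonal hm f fun x hx => ?_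
    have h1 := hA.max j hn x hx
    have h2 := abs_le.1 (hquad x)
    linarith
  rw [abs_le]; constructor <;> linarith

/-- Expansion of a perturbed quadratic form along an eigenvector `v` and a vector orthogonal
to it. -/
lemma abs_inner_perturbation_sub_le {A B : E →L[ℝ] E}
    (hB : ∀ x y, inner ℝ (B x) y = inner ℝ x (B y)) {D : ℝ}
    (hD : ∀ x y, |inner ℝ ((B - A) x) y| ≤ D * ‖x‖ * ‖y‖) {v y : E} {r : ℝ} (hv : ‖v‖ = 1)
    (hAv : A v = r • v) (hvy : inner ℝ v y = 0) (a : ℝ) :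
    |inner ℝ (B (a • v + y)) (a • v + y) - (a ^ 2 * (r + inner ℝ ((B - A) v) v) +
      inner ℝ (A y) y)| ≤ 2 * |a| * (D * ‖y‖) + D * ‖y‖ ^ 2 := by
  have hyv : inner ℝ y v = 0 := by rw [real_inner_comm]; exact hvy
  have e1 : inner ℝ (A v) v = r := by
    rw [hAv, real_inner_smul_left, real_inner_self_eq_norm_sq, hv]; ring
  have e2 : inner ℝ (A v) y = 0 := by rw [hAv, real_inner_smul_left, hvy, mul_zero]
  have e4 : inner ℝ (B y) v = inner ℝ (B v) y := by rw [hB, real_inner_comm]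
  have e5 : inner ℝ (B (a • v + y)) (a • v + y) - (a ^ 2 * (r + inner ℝ ((B - A) v) v) +
      inner ℝ (A y) y) = 2 * a * inner ℝ ((B - A) v) y + inner ℝ ((B - A) y) y := by
    simp only [map_add, map_smul, sub_apply, inner_add_left, inner_add_right,
      inner_sub_left, real_inner_smul_left, real_inner_smul_right, e1, e2, e4]
    ring
  rw [e5]
  have h1 := hD v y
  have h2 := hD y y
  rw [hv, mul_one] at h1
  calc _ ≤ |2 * a * inner ℝ ((B - A) v) y| + |inner ℝ ((B - A) y) y| := abs_add_le _ _
    _ = 2 * |a| * |inner ℝ ((B - A) v) y| + |inner ℝ ((B - A) y) y| := by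
      rw [abs_mul, abs_mul, abs_two]
    _ ≤ 2 * |a| * (D * ‖y‖) + D * ‖y‖ * ‖y‖ := by gcongr
    _ = _ := by ring

/-- First-order perturbation of a simple eigenvalue, with an error that is quadratic in the size
of the perturbation: the quadratic form of `B` is compared with that of `A` on the complement, and
on the span, of the leading eigenvectors of `A`. -/
lemma IsLeading.abs_sub_sub_le {A B : E →L[ℝ] E}
    (hBs : ∀ x y, inner ℝ (B x) y = inner ℝ x (B y)) {n m : ℕ} {f f' : ℕ → E} {ν ν' : ℕ → ℝ}
    (hA : IsLeading A n f ν) (hB : IsLeading B m f' ν') {j : ℕ} (hn : j + 1 < n) (hm : j < m)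
    {D gap : ℝ} (hD0 : 0 ≤ D) (hD : ∀ x y, |inner ℝ ((B - A) x) y| ≤ D * ‖x‖ * ‖y‖)
    (hgap : 0 < gap) (hgap1 : ν (j + 1) + gap ≤ ν j) (hgap2 : ∀ i < j, ν j + gap ≤ ν i) :
    |ν' j - ν j - inner ℝ ((B - A) (f j)) (f j)| ≤ 8 / gap * D ^ 2 := by
  have hjn : j < n := by omega
  set v := f j with hv_def
  set δ := inner ℝ ((B - A) v) v with hδ
  have hv : ‖v‖ = 1 := hA.norm_eq hjn
  have hAv : A v = ν j • v := hA.eig j hjn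
  have hδD : |δ| ≤ D := by have := hD v v; rwa [hv, mul_one, mul_one] at this
  -- for large perturbations Weyl's inequality suffices
  rcases le_or_gt gap (4 * D) with hbig | hsmall
  · have h1 := hA.abs_sub_le hB hjn hm hD
    calc |ν' j - ν j - δ| ≤ |ν' j - ν j| + |δ| := abs_sub _ _
      _ ≤ D + D := add_le_add h1 hδD
      _ = 8 / gap * (D * (gap / 4)) := by field_simp; ring
      _ ≤ 8 / gap * (D * D) := by gcongr; linarith
      _ = _ := by ring
  obtain ⟨hδ1, hδ2⟩ := abs_le.1 hδD
  set κ := 2 / gap with hκ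
  have hκ0 : 0 < κ := by positivity
  have hκg : κ * gap = 2 := by rw [hκ]; field_simp
  -- completing the square
  have hsq : ∀ a Y : ℝ, 2 * |a| * (D * Y) ≤ κ * D ^ 2 * a ^ 2 + gap / 2 * Y ^ 2 := by
    intro a Y
    have h1 : 0 ≤ κ * (D * |a| - gap / 2 * Y) ^ 2 := by positivity
    have h2 : κ * (D * |a| - gap / 2 * Y) ^ 2 =
        κ * D ^ 2 * |a| ^ 2 - κ * gap * (|a| * (D * Y)) + κ * gap * (gap / 4 * Y ^ 2) := by ring
    rw [h2, hκg, sq_abs] at h1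
    linarith
  have hκD : 0 ≤ κ * D ^ 2 := by positivity
  have hnorm : ∀ (a : ℝ) (y : E), inner ℝ v y = 0 → ‖a • v + y‖ ^ 2 = a ^ 2 + ‖y‖ ^ 2 := by
    intro a y hy
    rw [norm_add_sq_real, real_inner_smul_left, hy, norm_smul, hv, mul_one, Real.norm_eq_abs,
      sq_abs]
    ring
  have hhi : ν' j ≤ ν j + δ + κ * D ^ 2 := by
    refine hB.le_of_forall_orthogonal hm f fun x hx => ?_
    set a := inner ℝ v x with ha
    set y := x - a • v with hy
    have hvy : inner ℝ v y = 0 := by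
      rw [hy, inner_sub_right, real_inner_smul_right, real_inner_self_eq_norm_sq, hv]; ring
    have hxe : x = a • v + y := by rw [hy]; abel
    have hyk : ∀ k < j + 1, inner ℝ (f k) y = 0 := by
      intro k hk
      rcases Nat.lt_succ_iff_lt_or_eq.1 hk with hk | rfl
      · rw [hy, inner_sub_right, real_inner_smul_right, hx k hk, hA.orth k (by omega) j hjn,
          if_neg hk.ne]; ring
      · exact hvy
    have h1 := hA.max (j + 1) hn y hyk
    have h2 := abs_le.1 (abs_inner_perturbation_sub_le hBs hD hv hAv hvy a)
    have h3 := hsq a ‖y‖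
    rw [hxe, hnorm a y hvy]
    have h4 : (ν (j + 1) + D + gap / 2) * ‖y‖ ^ 2 ≤ (ν j + δ + κ * D ^ 2) * ‖y‖ ^ 2 := by
      exact mul_le_mul_of_nonneg_right (by linarith) (by positivity)
    linarith [h2.2]
  have hlo : ν j + δ - κ * D ^ 2 ≤ ν' j := by
    have hlead := hA.mono (m := j + 1) hjn
    refine hB.le_of_forall_span hm hlead.orthonormal fun b => ?_
    have hsplit : ∑ i, b i • f i = b (Fin.last j) • v + ∑ i : Fin j, b (Fin.castSucc i) • f i := by
      rw [Fin.sum_univ_castSucc, add_comm]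
      rfl
    rw [hsplit]
    have hlead' := hA.mono (m := j) hjn.le
    have h1 := le_inner_of_eigenvectors hlead'.orthonormal (ρ := fun i => ν i)
      (fun i => hA.eig i (by omega)) (c := ν j + gap) (fun i => hgap2 i i.2)
      (fun i => b (Fin.castSucc i))
    set y := ∑ i : Fin j, b (Fin.castSucc i) • f i with hy
    set a := b (Fin.last j)
    have hvy : inner ℝ v y = 0 := by
      rw [hy, inner_sum]
      refine Finset.sum_eq_zero fun i _ => ?_
      rw [real_inner_smul_right, hA.orth j hjn i (by omega), if_neg (by omega), mul_zero]
    have h2 := abs_le.1 (abs_inner_perturbation_sub_le hBs hD hv hAv hvy a)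
    have h3 := hsq a ‖y‖
    rw [hnorm a y hvy]
    have h4 : (ν j + δ - κ * D ^ 2) * ‖y‖ ^ 2 ≤ (ν j + gap - D - gap / 2) * ‖y‖ ^ 2 := by
      exact mul_le_mul_of_nonneg_right (by linarith) (by positivity)
    linarith [h2.1]
  have hκ8 : κ * D ^ 2 ≤ 8 / gap * D ^ 2 := by rw [hκ]; gcongr; norm_num
  rw [abs_le]; constructor <;> linarith

end Spectral

/-! ### Square integrable kernels and their integral operators -/

/-- The Hilbert space `L²([0,1]²)` of square integrable kernels. -/
abbrev L2Kernel : Type :=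
  Lp ℝ 2 ((volume : Measure unitInterval).prod (volume : Measure unitInterval))

noncomputable instance measurableSpaceL2Kernel : MeasurableSpace L2Kernel := borel _

instance borelSpaceL2Kernel : BorelSpace L2Kernel := ⟨rfl⟩

instance secondCountableTopologyL2Kernel : SecondCountableTopology L2Kernel :=
  have : Fact ((2 : ℝ≥0∞) ≠ ∞) := ⟨by simp⟩
  have : IsSeparable ((volume : Measure unitInterval).prod (volume : Measure unitInterval)) := by
    -- instance search does not find this through the type of the product measure
    have : MeasurableSpace.CountablyGenerated (unitInterval × unitInterval) := inferInstance
    exact isSeparable_of_sigmaFinite _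
  Lp.SecondCountableTopology

lemma memLp_tensor (f g : L2I) :
    MemLp (fun z : unitInterval × unitInterval => f z.1 * g z.2) 2
      ((volume : Measure unitInterval).prod volume) := by
  have hm : AEStronglyMeasurable (fun z : unitInterval × unitInterval => f z.1 * g z.2)
      ((volume : Measure unitInterval).prod volume) :=
    (Lp.aestronglyMeasurable f).comp_fst.mul (Lp.aestronglyMeasurable g).comp_snd
  rw [memLp_two_iff_integrable_sq hm]
  simp_rw [mul_pow]
  exact ((memLp_two_iff_integrable_sq (Lp.aestronglyMeasurable f)).1 (Lp.memLp f)).mul_prod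
    ((memLp_two_iff_integrable_sq (Lp.aestronglyMeasurable g)).1 (Lp.memLp g))

/-- The kernel `f(s) g(t)`, as an element of `L²([0,1]²)`. -/
noncomputable def tensorFun (f g : L2I) : L2Kernel := (memLp_tensor f g).toLp _

lemma coeFn_tensorFun (f g : L2I) :
    tensorFun f g =ᵐ[(volume : Measure unitInterval).prod volume] fun z => f z.1 * g z.2 :=
  MemLp.coeFn_toLp _

lemma inner_tensorFun (f g f' g' : L2I) :
    inner ℝ (tensorFun f g) (tensorFun f' g') = inner ℝ f f' * inner ℝ g g' := by
  rw [L2.inner_def, L2.inner_def, L2.inner_def, ← integral_prod_mul]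
  refine integral_congr_ae ?_
  filter_upwards [coeFn_tensorFun f g, coeFn_tensorFun f' g'] with z h1 h2
  rw [h1, h2]
  simp only [RCLike.inner_apply, conj_trivial]
  ring

lemma norm_tensorFun (f g : L2I) : ‖tensorFun f g‖ = ‖f‖ * ‖g‖ := by
  have h : ‖tensorFun f g‖ ^ 2 = (‖f‖ * ‖g‖) ^ 2 := by
    rw [← real_inner_self_eq_norm_sq, inner_tensorFun, real_inner_self_eq_norm_sq,
      real_inner_self_eq_norm_sq, mul_pow]
  exact (pow_left_inj₀ (norm_nonneg _) (by positivity) two_ne_zero).1 h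

/-- The tensor product `(f, g) ↦ f(s) g(t)` as a continuous bilinear map. -/
noncomputable def tensor : L2I →L[ℝ] L2I →L[ℝ] L2Kernel :=
  LinearMap.mkContinuous₂
    (LinearMap.mk₂ ℝ tensorFun
      (fun f f' g => by
        refine Lp.ext ?_
        filter_upwards [coeFn_tensorFun (f + f') g, coeFn_tensorFun f g, coeFn_tensorFun f' g,
          Lp.coeFn_add (tensorFun f g) (tensorFun f' g),
          Measure.quasiMeasurePreserving_fst.ae_eq (Lp.coeFn_add f f')] with z h1 h2 h3 h4 h5
        simp only [Function.comp_apply, Pi.add_apply] at h4 h5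
        rw [h1, h4, h2, h3, h5, add_mul])
      (fun c f g => by
        refine Lp.ext ?_
        filter_upwards [coeFn_tensorFun (c • f) g, coeFn_tensorFun f g,
          Lp.coeFn_smul c (tensorFun f g),
          Measure.quasiMeasurePreserving_fst.ae_eq (Lp.coeFn_smul c f)] with z h1 h2 h4 h5
        simp only [Function.comp_apply, Pi.smul_apply, smul_eq_mul] at h4 h5
        rw [h1, h4, h2, h5, mul_assoc])
      (fun f g g' => by
        refine Lp.ext ?_
        filter_upwards [coeFn_tensorFun f (g + g'), coeFn_tensorFun f g, coeFn_tensorFun f g',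
          Lp.coeFn_add (tensorFun f g) (tensorFun f g'),
          Measure.quasiMeasurePreserving_snd.ae_eq (Lp.coeFn_add g g')] with z h1 h2 h3 h4 h5
        simp only [Function.comp_apply, Pi.add_apply] at h4 h5
        rw [h1, h4, h2, h3, h5, mul_add])
      (fun c f g => by
        refine Lp.ext ?_
        filter_upwards [coeFn_tensorFun f (c • g), coeFn_tensorFun f g,
          Lp.coeFn_smul c (tensorFun f g),
          Measure.quasiMeasurePreserving_snd.ae_eq (Lp.coeFn_smul c g)] with z h1 h2 h4 h5
        simp only [Function.comp_apply, Pi.smul_apply, smul_eq_mul] at h4 h5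
        rw [h1, h4, h2, h5]; ring)) 1
    (fun f g => by rw [LinearMap.mk₂_apply, norm_tensorFun, one_mul])

lemma coeFn_tensor (f g : L2I) :
    tensor f g =ᵐ[(volume : Measure unitInterval).prod volume] fun z => f z.1 * g z.2 :=
  coeFn_tensorFun f g

lemma norm_tensor (f g : L2I) : ‖tensor f g‖ = ‖f‖ * ‖g‖ := norm_tensorFun f g

lemma inner_tensor (f g f' g' : L2I) :
    inner ℝ (tensor f g) (tensor f' g') = inner ℝ f f' * inner ℝ g g' := inner_tensorFun f g f' g'

lemma norm_tensor_flip_le (f : L2I) : ‖tensor.flip f‖ ≤ ‖f‖ :=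
  ContinuousLinearMap.opNorm_le_bound _ (norm_nonneg _) fun g => by
    rw [ContinuousLinearMap.flip_apply, norm_tensor, mul_comm]

/-- The integral operator with kernel `K`, depending linearly and continuously on `K`; it is
characterized by `inner_kernelOp`. -/
noncomputable def kernelOp : L2Kernel →L[ℝ] L2I →L[ℝ] L2I :=
  LinearMap.mkContinuous₂
    (LinearMap.mk₂ ℝ (fun K f => ContinuousLinearMap.adjoint (tensor.flip f) K)
      (fun K K' f => map_add _ _ _)
      (fun c K f => map_smul _ _ _)
      (fun K f f' => by simp)
      (fun c K f => by simp)) 1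
    (fun K f => by
      rw [LinearMap.mk₂_apply, one_mul, mul_comm]
      refine (ContinuousLinearMap.le_opNorm _ _).trans ?_
      rw [LinearIsometryEquiv.norm_map]
      gcongr
      exact norm_tensor_flip_le f)

lemma inner_kernelOp (K : L2Kernel) (f g : L2I) :
    inner ℝ (kernelOp K f) g = inner ℝ K (tensor g f) := by
  have h : kernelOp K f = ContinuousLinearMap.adjoint (tensor.flip f) K := rfl
  rw [h, ContinuousLinearMap.adjoint_inner_left, ContinuousLinearMap.flip_apply]

lemma abs_inner_kernelOp_le (K : L2Kernel) (f g : L2I) :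
    |inner ℝ (kernelOp K f) g| ≤ ‖K‖ * ‖f‖ * ‖g‖ := by
  rw [inner_kernelOp]
  refine (abs_real_inner_le_norm _ _).trans (le_of_eq ?_)
  rw [norm_tensor]; ring

/-- A kernel function that represents `K` pairs with product functions like `K` does. -/
lemma integral_integral_mul_eq_inner {k : unitInterval → unitInterval → ℝ} {K : L2Kernel}
    (hk : (fun z : unitInterval × unitInterval => k z.1 z.2)
      =ᵐ[(volume : Measure unitInterval).prod volume] K) (f g : L2I) :
    ∫ s, ∫ t, k s t * f s * g t = inner ℝ K (tensor f g) := by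
  have hae : (fun z : unitInterval × unitInterval => k z.1 z.2 * f z.1 * g z.2)
      =ᵐ[(volume : Measure unitInterval).prod volume]
      fun z => inner ℝ (K z) (tensor f g z) := by
    filter_upwards [hk, coeFn_tensor f g] with z h1 h2
    rw [h1, h2]
    simp only [RCLike.inner_apply, conj_trivial]
    ring
  have hint := (L2.integrable_inner K (tensor f g) (𝕜 := ℝ)).congr hae.symm
  rw [L2.inner_def, ← integral_congr_ae hae, integral_prod _ hint]

/-- The operator `kernelOp K` is integration against any function representing `K`. -/
lemma coeFn_kernelOp {k : unitInterval → unitInterval → ℝ} {K : L2Kernel}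
    (hk : (fun z : unitInterval × unitInterval => k z.1 z.2)
      =ᵐ[(volume : Measure unitInterval).prod volume] K) (f : L2I) :
    kernelOp K f =ᵐ[volume] fun s => ∫ t, k s t * f t := by
  have hone : ∀ {A : Set unitInterval} (hA : MeasurableSet A),
      (fun z : unitInterval × unitInterval => A.indicator (fun _ => k z.1 z.2 * f z.2) z.1)
      =ᵐ[(volume : Measure unitInterval).prod volume] fun z =>
        inner ℝ (K z) (tensor (indicatorConstLp 2 hA (measure_ne_top _ _) (1 : ℝ)) f z) := by
    intro A hA
    filter_upwards [hk, coeFn_tensor (indicatorConstLp 2 hA (measure_ne_top _ _) (1 : ℝ)) f,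
      Measure.quasiMeasurePreserving_fst.ae_eq (indicatorConstLp_coeFn (p := 2) (hs := hA)
        (hμs := measure_ne_top _ _) (c := (1 : ℝ)))] with z h1 h2 h3
    simp only [Function.comp_apply] at h3
    rw [h2, h3, ← h1]
    by_cases hz : z.1 ∈ A <;> simp [hz, mul_comm]
  have hint : ∀ {A : Set unitInterval} (hA : MeasurableSet A),
      Integrable (fun z : unitInterval × unitInterval =>
        A.indicator (fun _ => k z.1 z.2 * f z.2) z.1)
      ((volume : Measure unitInterval).prod volume) := fun hA =>
    (L2.integrable_inner K _ (𝕜 := ℝ)).congr (hone hA).symm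
  have hF : Integrable (fun s => ∫ t, k s t * f t) (volume : Measure unitInterval) := by
    have := (hint MeasurableSet.univ).integral_prod_left
    simpa using this
  refine Integrable.ae_eq_of_forall_setIntegral_eq _ _
    ((Lp.memLp (kernelOp K f)).integrable (by norm_num)) hF fun A hA _ => ?_
  rw [← L2.inner_indicatorConstLp_one (𝕜 := ℝ) hA (measure_ne_top _ _), real_inner_comm,
    inner_kernelOp, L2.inner_def, ← integral_congr_ae (hone hA), integral_prod _ (hint hA),
    ← integral_indicator hA]
  refine integral_congr_ae (Eventually.of_forall fun s => ?_)
  by_cases hs : s ∈ A <;> simp [hs]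

lemma isEigenfunction_iff {k : unitInterval → unitInterval → ℝ} {K : L2Kernel}
    (hk : (fun z : unitInterval × unitInterval => k z.1 z.2)
      =ᵐ[(volume : Measure unitInterval).prod volume] K) (r : ℝ) (f : L2I) :
    IsEigenfunction k r f ↔ kernelOp K f = r • f := by
  have h1 := coeFn_kernelOp hk f
  have h2 := Lp.coeFn_smul r f
  constructor
  · intro h
    refine Lp.ext ?_
    filter_upwards [h1, h2, h] with s e1 e2 e3
    rw [e1, e2, e3]; rfl
  · intro h
    rw [h] at h1
    filter_upwards [h1, h2] with s e1 e2
    rw [← e1, e2]; rfl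

lemma kernelEigenvalue_succ_eq_sSup {k : unitInterval → unitInterval → ℝ} {K : L2Kernel}
    (hk : (fun z : unitInterval × unitInterval => k z.1 z.2)
      =ᵐ[(volume : Measure unitInterval).prod volume] K) (j : ℕ) :
    kernelEigenvalue k (j + 1) = sSup {c : ℝ | ∃ (g : Fin (j + 1) → L2I) (ρ : Fin (j + 1) → ℝ),
      Orthonormal ℝ g ∧ ∀ i, kernelOp K (g i) = ρ i • g i ∧ c ≤ ρ i} := by
  simp only [kernelEigenvalue, isEigenfunction_iff hk]

lemma IsLeading.kernelEigenvalue_eq {k : unitInterval → unitInterval → ℝ} {K : L2Kernel}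
    (hk : (fun z : unitInterval × unitInterval => k z.1 z.2)
      =ᵐ[(volume : Measure unitInterval).prod volume] K) {n : ℕ} {f : ℕ → L2I} {ν : ℕ → ℝ}
    (h : IsLeading (kernelOp K) n f ν) {j : ℕ} (hj : j < n) :
    kernelEigenvalue k (j + 1) = ν j := by
  rw [kernelEigenvalue_succ_eq_sSup hk]
  exact (h.isGreatest hj).csSup_eq

/-- The closed convex cone of kernels with a compact, symmetric and positive integral operator. -/
def positiveKernels : Set L2Kernel := {K | IsCompactPositive (kernelOp K)}

lemma tensor_self_mem_positiveKernels (x : L2I) : tensor x x ∈ positiveKernels := by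
  refine ⟨fun f g => ?_, fun f => ?_, ?_⟩
  · rw [real_inner_comm _ f, inner_kernelOp, inner_kernelOp, inner_tensor, inner_tensor, mul_comm]
  · rw [inner_kernelOp, inner_tensor]; exact mul_self_nonneg _
  · have h : (kernelOp (tensor x x) : L2I → L2I) = fun f => (innerSL ℝ x f) • x := by
      ext1 f
      refine ext_inner_right ℝ fun g => ?_
      rw [inner_kernelOp, inner_tensor, real_inner_smul_left, innerSL_apply_apply, mul_comm]
    have h2 : (kernelOp (tensor x x) : L2I → L2I) =
        (ContinuousLinearMap.toSpanSingleton ℝ x) ∘ (innerSL ℝ x) := by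
      rw [h]; ext1 f; simp
    rw [h2]
    exact (isCompactOperator_of_locallyCompactSpace_rng
      (ContinuousLinearMap.toSpanSingleton ℝ x)).comp_clm (innerSL ℝ x)

lemma zero_mem_positiveKernels : (0 : L2Kernel) ∈ positiveKernels := by
  simpa using tensor_self_mem_positiveKernels 0

lemma add_mem_positiveKernels {K K' : L2Kernel} (h : K ∈ positiveKernels)
    (h' : K' ∈ positiveKernels) : K + K' ∈ positiveKernels := by
  refine ⟨fun f g => ?_, fun f => ?_, ?_⟩
  · simp only [map_add, add_apply, inner_add_left, inner_add_right, h.symm, h'.symm]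
  · simp only [map_add, add_apply, inner_add_left]
    exact add_nonneg (h.nonneg f) (h'.nonneg f)
  · rw [map_add]; exact h.compact.add h'.compact

lemma smul_mem_positiveKernels {K : L2Kernel} (h : K ∈ positiveKernels) {c : ℝ} (hc : 0 ≤ c) :
    c • K ∈ positiveKernels := by
  refine ⟨fun f g => ?_, fun f => ?_, ?_⟩
  · simp only [map_smul, smul_apply, real_inner_smul_left, real_inner_smul_right, h.symm]
  · simp only [map_smul, smul_apply, real_inner_smul_left]
    exact mul_nonneg hc (h.nonneg f)
  · rw [map_smul]; exact h.compact.smul c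

lemma sum_mem_positiveKernels {ι : Type*} (s : Finset ι) {K : ι → L2Kernel}
    (h : ∀ i ∈ s, K i ∈ positiveKernels) : ∑ i ∈ s, K i ∈ positiveKernels := by
  classical
  induction s using Finset.induction_on with
  | empty => simpa using zero_mem_positiveKernels
  | insert a s ha ih =>
    rw [Finset.sum_insert ha]
    exact add_mem_positiveKernels (h a (Finset.mem_insert_self a s))
      (ih fun i hi => h i (Finset.mem_insert_of_mem hi))

lemma convex_positiveKernels : Convex ℝ positiveKernels := fun _ hK _ hK' _ _ ha hb _ =>
  add_mem_positiveKernels (smul_mem_positiveKernels hK ha) (smul_mem_positiveKernels hK' hb)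

/-- Compactness of the operator survives limits because `K ↦ kernelOp K` is continuous and the
compact operators are closed in the operator norm. -/
lemma isClosed_positiveKernels : IsClosed positiveKernels := by
  have h1 : positiveKernels = (⋂ f : L2I, ⋂ g : L2I,
      {K : L2Kernel | inner ℝ (kernelOp K f) g = inner ℝ f (kernelOp K g)}) ∩
      ((⋂ f : L2I, {K : L2Kernel | 0 ≤ inner ℝ (kernelOp K f) f}) ∩
      kernelOp ⁻¹' {T : L2I →L[ℝ] L2I | IsCompactOperator T}) := by
    ext K
    simp only [mem_inter_iff, mem_iInter, mem_ofPred_eq, mem_preimage]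
    exact ⟨fun h => ⟨h.symm, h.nonneg, h.compact⟩, fun h => ⟨h.1, h.2.1, h.2.2⟩⟩
  have hc : ∀ f : L2I, Continuous fun K : L2Kernel => kernelOp K f := fun f =>
    (ContinuousLinearMap.apply ℝ L2I f).continuous.comp kernelOp.continuous
  rw [h1]
  refine IsClosed.inter ?_ (IsClosed.inter ?_ ?_)
  · exact isClosed_iInter fun f => isClosed_iInter fun g =>
      isClosed_eq ((hc f).inner continuous_const) (continuous_const.inner (hc g))
  · exact isClosed_iInter fun f => isClosed_le continuous_const ((hc f).inner continuous_const)
  · exact isClosed_setOfPred_isCompactOperator.preimage kernelOp.continuous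

/-! ### The centred tensor squares of an approximable series -/

noncomputable instance measurableSpaceL2I : MeasurableSpace L2I := borel _

instance borelSpaceL2I : BorelSpace L2I := ⟨rfl⟩

instance secondCountableTopologyL2I : SecondCountableTopology L2I :=
  have : Fact ((2 : ℝ≥0∞) ≠ ∞) := ⟨by simp⟩
  Lp.SecondCountableTopology

lemma continuous_tensor_self : Continuous fun x : L2I => tensor x x :=
  tensor.continuous.clm_apply continuous_id

section Tensor

variable {S : Type*} [MeasurableSpace S] {μ : Measure S} [IsProbabilityMeasure μ]
  {g : (ℕ → S) → L2I}

/-- The mean of the tensor square of `g`: the covariance kernel as an element of `L²([0,1]²)`. -/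
noncomputable def meanTensor (μ : Measure S) (g : (ℕ → S) → L2I) : L2Kernel :=
  ∫ x, tensor (g x) (g x) ∂(seqLaw μ)

/-- The centred tensor square of `g`. -/
noncomputable def centredTensor (μ : Measure S) (g : (ℕ → S) → L2I) (x : ℕ → S) : L2Kernel :=
  tensor (g x) (g x) - meanTensor μ g

lemma eLpNorm_tensor_le {α : Type*} [MeasurableSpace α] {ρ : Measure α} {a b : α → L2I}
    (ha : AEStronglyMeasurable a ρ) (hb : AEStronglyMeasurable b ρ) :
    eLpNorm (fun z => tensor (a z) (b z)) 2 ρ ≤ eLpNorm a 4 ρ * eLpNorm b 4 ρ := by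
  have hh : ENNReal.HolderTriple 4 4 2 := ⟨by
    rw [← ENNReal.toReal_eq_toReal_iff' (by simp) (by simp), ENNReal.toReal_add (by simp) (by simp)]
    simp only [ENNReal.toReal_inv, ENNReal.toReal_ofNat]
    norm_num⟩
  have := eLpNorm_le_eLpNorm_mul_eLpNorm_of_nnnorm ha hb (fun x y => tensor x y) 1
    (Eventually.of_forall fun z => by
      rw [← NNReal.coe_le_coe]
      simp [norm_tensor]) (hpqr := hh)
  simpa using this

lemma memLp_tensor_self (h4 : MemLp g 4 (seqLaw μ)) :
    MemLp (fun x => tensor (g x) (g x)) 2 (seqLaw μ) :=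
  ⟨continuous_tensor_self.comp_aestronglyMeasurable h4.1,
    (eLpNorm_tensor_le h4.1 h4.1).trans_lt (ENNReal.mul_lt_top h4.2 h4.2)⟩

lemma memLp_centredTensor (h4 : MemLp g 4 (seqLaw μ)) :
    MemLp (centredTensor μ g) 2 (seqLaw μ) := (memLp_tensor_self h4).sub (memLp_const _)

lemma measurable_centredTensor (hg : Measurable g) : Measurable (centredTensor μ g) :=
  (continuous_tensor_self.measurable.comp hg).sub_const _

lemma integral_centredTensor (h4 : MemLp g 4 (seqLaw μ)) :
    ∫ x, centredTensor μ g x ∂(seqLaw μ) = 0 := by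
  unfold centredTensor
  rw [integral_sub ((memLp_tensor_self h4).integrable (by norm_num)) (integrable_const _)]
  simp [meanTensor]

lemma meanTensor_mem_positiveKernels (h4 : MemLp g 4 (seqLaw μ)) :
    meanTensor μ g ∈ positiveKernels :=
  convex_positiveKernels.integral_mem isClosed_positiveKernels
    (Eventually.of_forall fun x => tensor_self_mem_positiveKernels (g x))
    ((memLp_tensor_self h4).integrable (by norm_num))

/-- From `x ⊗ x - y ⊗ y = (x - y) ⊗ x + y ⊗ (x - y)` and Hölder's inequality. -/
lemma resamplingError_centredTensor_le (hg : Measurable g) (m : ℕ) :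
    resamplingError μ (centredTensor μ g) m ≤ 2 * eLpNorm g 4 (seqLaw μ) *
      eLpNorm (fun z => g z.1 - g (splice m z)) 4 ((seqLaw μ).prod (seqLaw μ)) := by
  set Q := seqLaw μ
  have ha : AEStronglyMeasurable (fun z : (ℕ → S) × (ℕ → S) => g z.1) (Q.prod Q) :=
    (hg.comp measurable_fst).aestronglyMeasurable
  have hb : AEStronglyMeasurable (fun z : (ℕ → S) × (ℕ → S) => g (splice m z)) (Q.prod Q) :=
    (hg.comp (measurable_splice m)).aestronglyMeasurable
  have hd : AEStronglyMeasurable (fun z : (ℕ → S) × (ℕ → S) => g z.1 - g (splice m z))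
      (Q.prod Q) := ha.sub hb
  have e : (fun z : (ℕ → S) × (ℕ → S) => centredTensor μ g z.1 - centredTensor μ g (splice m z)) =
      (fun z => tensor (g z.1 - g (splice m z)) (g z.1)) +
        fun z => tensor (g (splice m z)) (g z.1 - g (splice m z)) := by
    ext1 z
    simp only [centredTensor, Pi.add_apply, map_sub, sub_apply]
    abel
  have hea : eLpNorm (fun z : (ℕ → S) × (ℕ → S) => g z.1) 4 (Q.prod Q) = eLpNorm g 4 Q :=
    eLpNorm_comp_measurePreserving hg.aestronglyMeasurable measurePreserving_fst
  have heb : eLpNorm (fun z => g (splice m z)) 4 (Q.prod Q) = eLpNorm g 4 Q :=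
    eLpNorm_comp_measurePreserving hg.aestronglyMeasurable (measurePreserving_splice μ m)
  unfold resamplingError
  rw [e]
  refine (eLpNorm_add_le (tensor.aestronglyMeasurable_comp₂ hd ha)
    (tensor.aestronglyMeasurable_comp₂ hb hd) (by norm_num)).trans ?_
  refine (add_le_add (eLpNorm_tensor_le hd ha) (eLpNorm_tensor_le hb hd)).trans (le_of_eq ?_)
  rw [hea, heb]
  ring

end Tensor

section Series

variable {Ω S : Type*} [MeasurableSpace Ω] [MeasurableSpace S] {P : Measure Ω}
  [IsProbabilityMeasure P] {ε : ℤ → Ω → S} {g : (ℕ → S) → L2I} {X : ℤ → Ω → unitInterval → ℝ}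
  {κ : ℝ}

lemma IsApproximableSeries.measurable_g (hX : IsApproximableSeries P ε g X κ) : Measurable g :=
  hX.measurable_shift

lemma IsApproximableSeries.map_innovation (hX : IsApproximableSeries P ε g X κ) (n : ℤ) :
    P.map (ε n) = P.map (ε 0) := (hX.identDistrib_innovation n).map_eq

lemma IsApproximableSeries.isProbabilityMeasure (hX : IsApproximableSeries P ε g X κ) :
    IsProbabilityMeasure (P.map (ε 0)) :=
  Measure.isProbabilityMeasure_map (hX.measurable_innovation 0).aemeasurable

lemma IsApproximableSeries.map_past (hX : IsApproximableSeries P ε g X κ) (n : ℤ) :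
    P.map (past ε n) = seqLaw (P.map (ε 0)) :=
  _root_.map_past hX.measurable_innovation hX.iIndep_innovation hX.map_innovation n

lemma eLpNorm_four_le_lintegral_rpow {α E : Type*} [MeasurableSpace α] {ρ : Measure α}
    [IsProbabilityMeasure ρ] [NormedAddCommGroup E] {f : α → E} (hf : AEStronglyMeasurable f ρ)
    {q : ℝ} (hq : 4 ≤ q) :
    eLpNorm f 4 ρ ≤ (∫⁻ x, ‖f x‖ₑ ^ q ∂ρ) ^ (1 / q) := by
  have hq0 : 0 < q := by linarith
  have h1 : (4 : ℝ≥0∞) ≤ ENNReal.ofReal q := by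
    rw [ENNReal.le_ofReal_iff_toReal_le (by simp) hq0.le]; simpa using hq
  refine (eLpNorm_le_eLpNorm_of_exponent_le h1 hf).trans (le_of_eq ?_)
  rw [eLpNorm_eq_lintegral_rpow_enorm_toReal (by simpa using hq0) ENNReal.ofReal_ne_top,
    ENNReal.toReal_ofReal hq0.le]

lemma IsApproximableSeries.memLp_four (hX : IsApproximableSeries P ε g X κ) :
    MemLp g 4 (seqLaw (P.map (ε 0))) := by
  have := hX.isProbabilityMeasure
  refine ⟨hX.measurable_g.aestronglyMeasurable, ?_⟩
  obtain ⟨δ, hδ0, -, hδ⟩ := hX.moment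
  refine (eLpNorm_four_le_lintegral_rpow hX.measurable_g.aestronglyMeasurable
    (by linarith : (4 : ℝ) ≤ 4 + δ)).trans_lt (ENNReal.rpow_lt_top_of_nonneg (by positivity) ?_)
  have e : ∫⁻ x, ‖g x‖ₑ ^ (4 + δ) ∂(seqLaw (P.map (ε 0))) =
      ∫⁻ ω, (eLpNorm (X 0 ω) 2 volume) ^ (4 + δ) ∂P := by
    rw [← hX.map_past 0, lintegral_map (hX.measurable_g.enorm.pow_const _)
      (measurable_past hX.measurable_innovation 0)]
    refine lintegral_congr_ae ?_
    filter_upwards [hX.eq_shift 0] with ω hω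
    rw [eLpNorm_congr_ae hω, Lp.enorm_def]
  rw [e]
  exact hδ.ne

/-- The joint law of the past of the innovations and of an independent copy. -/
lemma map_past_prodMk (hX : IsApproximableSeries P ε g X κ) {ε' : ℤ → Ω → S}
    (h : IsIndepCopy P ε ε') (n : ℤ) :
    P.map (fun ω => (past ε n ω, past ε' n ω)) =
      (seqLaw (P.map (ε 0))).prod (seqLaw (P.map (ε 0))) := by
  have hm : Measurable fun (e : ℤ → S) (k : ℕ) => e (n - k) :=
    measurable_pi_lambda _ fun k => measurable_pi_apply _
  have hind : IndepFun (past ε n) (past ε' n) P := h.indep.comp hm hm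
  rw [(indepFun_iff_map_prod_eq_prod_map_map
    (measurable_past hX.measurable_innovation n).aemeasurable
    (measurable_past h.measurable n).aemeasurable).1 hind, hX.map_past n,
    _root_.map_past h.measurable h.iIndep (fun k => (h.identDistrib k).map_eq) n]

/-- Summability of the roots of order `κ` gives summability of the roots of smaller order. -/
lemma tsum_rpow_ne_top_of_le {a : ℕ → ℝ≥0∞} {p q : ℝ} (hp : 0 < p) (hpq : p ≤ q)
    (h : ∑' m, a m ^ p ≠ ∞) : ∑' m, a m ^ q ≠ ∞ := by
  set A := ∑' m, a m ^ p with hA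
  have hle : ∀ m, a m ^ q ≤ A ^ (q / p - 1) * a m ^ p := by
    intro m
    have h1 : a m ^ q = (a m ^ p) ^ (q / p - 1) * (a m ^ p) := by
      have h2 : 0 ≤ q / p - 1 := by rw [sub_nonneg, le_div_iff₀ hp]; linarith
      rw [← ENNReal.rpow_mul, ← ENNReal.rpow_add_of_nonneg _ _ (by positivity) hp.le]
      congr 1
      field_simp
      ring
    rw [h1]
    gcongr
    · rw [sub_nonneg, le_div_iff₀ hp]; linarith
    · exact ENNReal.le_tsum m
  refine ne_top_of_le_ne_top ?_ (ENNReal.tsum_le_tsum hle)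
  rw [ENNReal.tsum_mul_left]
  refine ENNReal.mul_ne_top (ENNReal.rpow_ne_top_of_nonneg ?_ h) h
  rw [sub_nonneg, le_div_iff₀ hp]; linarith

/-- The approximability hypothesis at time `0`, transferred to the tensor squares. The exponent
`1 / κ` is smaller than `1 / (4 + δ)`, so it gives summable `L^(4 + δ)` distances. -/
lemma IsApproximableSeries.tsum_resamplingError_ne_top (hX : IsApproximableSeries P ε g X κ) :
    ∑' m, resamplingError (P.map (ε 0)) (centredTensor (P.map (ε 0)) g) m ≠ ∞ := by
  have := hX.isProbabilityMeasure
  set μ := P.map (ε 0)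
  have h4 := hX.memLp_four
  have hg := hX.measurable_g
  obtain ⟨ε', hε', δ, hδ0, -, hκ, hsum⟩ := hX.approximable
  set a : ℕ → ℝ≥0∞ := fun m => ∫⁻ z, ‖g z.1 - g (splice (m + 1) z)‖ₑ ^ (4 + δ)
    ∂((seqLaw μ).prod (seqLaw μ)) with ha
  have hdm : ∀ m, Measurable fun z : (ℕ → S) × (ℕ → S) => g z.1 - g (splice m z) := fun m =>
    (hg.comp measurable_fst).sub (hg.comp (measurable_splice m))
  have hae : ∀ m : ℕ, ∫⁻ ω, ‖g (past ε 0 ω) - g (coupledPast ε (ε' 0 (m + 1)) 0 (m + 1) ω)‖ₑ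
      ^ (4 + δ) ∂P = a m := by
    intro m
    rw [ha]
    simp only
    rw [← map_past_prodMk hX (hε' 0 (m + 1)) 0, lintegral_map ((hdm _).enorm.pow_const _)
      ((measurable_past hX.measurable_innovation 0).prodMk
        (measurable_past (hε' 0 (m + 1)).measurable 0))]
    rfl
  have h1 := hsum 0
  simp only [hae] at h1
  have h2 : ∑' m, a m ^ (1 / (4 + δ)) ≠ ∞ := by
    refine tsum_rpow_ne_top_of_le (by have : 0 < κ := by linarith
                                      positivity) ?_ h1.ne
    exact one_div_le_one_div_of_le (by linarith) hκ.le
  have h3 : ∑' m, resamplingError μ (centredTensor μ g) (m + 1) ≠ ∞ := by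
    have hle : ∀ m, resamplingError μ (centredTensor μ g) (m + 1) ≤
        2 * eLpNorm g 4 (seqLaw μ) * a m ^ (1 / (4 + δ)) := fun m =>
      (resamplingError_centredTensor_le hg (m + 1)).trans (mul_le_mul_right
        (eLpNorm_four_le_lintegral_rpow (hdm _).aestronglyMeasurable (by linarith)) _)
    refine ne_top_of_le_ne_top ?_ (ENNReal.tsum_le_tsum hle)
    rw [ENNReal.tsum_mul_left]
    exact ENNReal.mul_ne_top (ENNReal.mul_ne_top (by norm_num) h4.2.ne) h2
  rw [tsum_eq_zero_add' ENNReal.summable]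
  exact ENNReal.add_ne_top.2 ⟨resamplingError_ne_top (memLp_centredTensor h4) 0, h3⟩

/-- The covariance kernel represents the mean tensor square. -/
lemma IsApproximableSeries.covKernel_ae_eq (hX : IsApproximableSeries P ε g X κ) :
    (fun z : unitInterval × unitInterval => covKernel P X z.1 z.2)
      =ᵐ[(volume : Measure unitInterval).prod volume] meanTensor (P.map (ε 0)) g := by
  have := hX.isProbabilityMeasure
  set lam := (volume : Measure unitInterval).prod (volume : Measure unitInterval) with hlam
  have hpm := measurable_past hX.measurable_innovation 1
  have hC : meanTensor (P.map (ε 0)) g =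
      ∫ ω, tensor (g (past ε 1 ω)) (g (past ε 1 ω)) ∂P := by
    rw [meanTensor, ← hX.map_past 1, integral_map hpm.aemeasurable]
    exact (continuous_tensor_self.measurable.comp hX.measurable_g).aestronglyMeasurable
  have hTi : Integrable (fun ω => tensor (g (past ε 1 ω)) (g (past ε 1 ω))) P := by
    have h := (memLp_tensor_self hX.memLp_four).integrable (by norm_num)
    rw [← hX.map_past 1] at h
    exact h.comp_measurable hpm
  have hXT : ∀ᵐ ω ∂P, (fun z : unitInterval × unitInterval => X 1 ω z.1 * X 1 ω z.2) =ᵐ[lam]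
      tensor (g (past ε 1 ω)) (g (past ε 1 ω)) := by
    filter_upwards [hX.eq_shift 1] with ω hω
    filter_upwards [coeFn_tensor (g (past ε 1 ω)) (g (past ε 1 ω)),
      Measure.quasiMeasurePreserving_fst.ae_eq hω,
      Measure.quasiMeasurePreserving_snd.ae_eq hω] with z h1 h2 h3
    simp only [Function.comp_apply] at h2 h3
    rw [h1, h2, h3]
  have hjm : Measurable fun q : (unitInterval × unitInterval) × Ω =>
      X 1 q.2 q.1.1 * X 1 q.2 q.1.2 := by
    have hj := hX.jointly_measurable 1
    exact (hj.comp (f := fun q : (unitInterval × unitInterval) × Ω => (q.1.1, q.2))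
      (by fun_prop)).mul
      (hj.comp (f := fun q : (unitInterval × unitInterval) × Ω => (q.1.2, q.2)) (by fun_prop))
  have hjint : Integrable (fun q : (unitInterval × unitInterval) × Ω =>
      X 1 q.2 q.1.1 * X 1 q.2 q.1.2) (lam.prod P) := by
    refine ⟨hjm.aestronglyMeasurable, ?_⟩
    rw [hasFiniteIntegral_iff_enorm, lintegral_prod_symm _ hjm.enorm.aemeasurable]
    refine lt_of_le_of_lt (lintegral_mono_ae ?_) hTi.2
    filter_upwards [hXT] with ω hω
    calc ∫⁻ z, ‖X 1 ω z.1 * X 1 ω z.2‖ₑ ∂lam =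
          ∫⁻ z, ‖(tensor (g (past ε 1 ω)) (g (past ε 1 ω)) : L2Kernel) z‖ₑ ∂lam := by
          refine lintegral_congr_ae ?_
          filter_upwards [hω] with z hz
          rw [hz]
      _ = eLpNorm (tensor (g (past ε 1 ω)) (g (past ε 1 ω)) : L2Kernel) 1 lam :=
          eLpNorm_one_eq_lintegral_enorm.symm
      _ ≤ eLpNorm (tensor (g (past ε 1 ω)) (g (past ε 1 ω)) : L2Kernel) 2 lam :=
          eLpNorm_le_eLpNorm_of_exponent_le (by norm_num) (Lp.aestronglyMeasurable _)
      _ = _ := (Lp.enorm_def _).symm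
  refine Integrable.ae_eq_of_forall_setIntegral_eq _ _ hjint.integral_prod_left
    ((Lp.memLp (meanTensor (P.map (ε 0)) g)).integrable (by norm_num)) fun A hA _ => ?_
  have hAint : Integrable (fun q : (unitInterval × unitInterval) × Ω =>
      X 1 q.2 q.1.1 * X 1 q.2 q.1.2) ((lam.restrict A).prod P) := by
    have h := hjint.restrict (s := A ×ˢ univ)
    rwa [← Measure.prod_restrict, Measure.restrict_univ] at h
  calc ∫ z in A, covKernel P X z.1 z.2 ∂lam =
        ∫ ω, ∫ z in A, X 1 ω z.1 * X 1 ω z.2 ∂lam ∂P := by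
        simp only [covKernel]
        exact integral_integral_swap hAint
    _ = ∫ ω, inner ℝ (indicatorConstLp 2 hA (measure_ne_top _ _) (1 : ℝ))
          (tensor (g (past ε 1 ω)) (g (past ε 1 ω))) ∂P := by
        refine integral_congr_ae ?_
        filter_upwards [hXT] with ω hω
        rw [L2.inner_indicatorConstLp_one (𝕜 := ℝ) hA (measure_ne_top _ _)]
        exact integral_congr_ae (ae_restrict_of_ae hω)
    _ = _ := by
        rw [integral_inner hTi, ← hC,
          L2.inner_indicatorConstLp_one (𝕜 := ℝ) hA (measure_ne_top _ _)]

end Series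

/-! ### Deterministic bounds for the sequential eigenvalues -/

/-- If the first `p + 1` eigenvalues of a kernel are separated, a normalized eigenfunction for one
of the first `p` belongs to a leading system, and its eigenvalue has a positive gap to the
others. -/
lemma exists_isLeading_through_eigenfunction {k : unitInterval → unitInterval → ℝ} {K : L2Kernel}
    (hk : (fun z : unitInterval × unitInterval => k z.1 z.2)
      =ᵐ[(volume : Measure unitInterval).prod volume] K) (hK : K ∈ positiveKernels) {p : ℕ}
    (hτ : ∀ i ∈ Finset.Icc 1 p, kernelEigenvalue k (i + 1) < kernelEigenvalue k i)
    (hpos : 0 < kernelEigenvalue k (p + 1)) {j : ℕ} (hj : j < p) {v : L2I} (hv : ‖v‖ = 1)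
    (hve : IsEigenfunction k (kernelEigenvalue k (j + 1)) v) :
    ∃ (f : ℕ → L2I) (ν : ℕ → ℝ) (gap : ℝ), IsLeading (kernelOp K) (p + 1) f ν ∧ f j = v ∧
      0 < gap ∧ ν (j + 1) + gap ≤ ν j ∧ ∀ i < j, ν j + gap ≤ ν i := by
  have hdim : ∃ h : Fin (p + 1) → L2I, Orthonormal ℝ h := by
    by_contra hc
    push Not at hc
    refine hpos.ne' ?_
    -- the supremum over the empty set of reals is `0`
    rw [kernelEigenvalue, show {μ : ℝ | ∃ (f : Fin (p + 1) → L2I) (ν : Fin (p + 1) → ℝ),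
      Orthonormal ℝ f ∧ ∀ i, IsEigenfunction k (ν i) (f i) ∧ μ ≤ ν i} = ∅ from
        eq_empty_of_forall_notMem fun μ ⟨f, _, hf, _⟩ => hc f hf, Real.sSup_empty]
  obtain ⟨f, ν, hlead⟩ := exists_isLeading hK hdim
  have hval : ∀ i < p + 1, kernelEigenvalue k (i + 1) = ν i := fun i hi =>
    hlead.kernelEigenvalue_eq hk hi
  have hstep : ∀ i < p, ν (i + 1) < ν i := fun i hi => by
    rw [← hval (i + 1) (by omega), ← hval i (by omega)]
    exact hτ (i + 1) (Finset.mem_Icc.2 ⟨by omega, by omega⟩)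
  have hlt : ∀ i < j, ν j < ν i := fun i hi =>
    (hlead.antitone (show i + 1 ≤ j from hi) (by omega)).trans_lt (hstep i (by omega))
  rw [hval j (by omega), isEigenfunction_iff hk] at hve
  obtain ⟨f', hlead', hf'⟩ := hlead.exists_through hK (by omega) hv hve hlt
  refine ⟨f', ν, min (ν j - ν (j + 1)) (if j = 0 then 1 else ν (j - 1) - ν j), hlead', hf',
    lt_min (sub_pos.2 (hstep j hj)) ?_, ?_, fun i hi => ?_⟩
  · split_ifs with h0
    · exact one_pos
    · exact sub_pos.2 (hlt _ (by omega))
  · linarith [min_le_left (ν j - ν (j + 1)) (if j = 0 then 1 else ν (j - 1) - ν j)]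
  · have h1 := min_le_right (ν j - ν (j + 1)) (if j = 0 then 1 else ν (j - 1) - ν j)
    rw [if_neg (by omega)] at h1
    have h2 := hlead.antitone (show i ≤ j - 1 by omega) (by omega)
    rw [if_neg (by omega)]
    linarith

/-- Zeroth and first order expansion of an eigenvalue of a perturbed kernel. -/
lemma IsLeading.abs_kernelEigenvalue_sub_le {k : unitInterval → unitInterval → ℝ}
    {K K' : L2Kernel} (hk : (fun z : unitInterval × unitInterval => k z.1 z.2)
      =ᵐ[(volume : Measure unitInterval).prod volume] K') (hK' : K' ∈ positiveKernels) {n : ℕ}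
    {f : ℕ → L2I} {ν : ℕ → ℝ} (h : IsLeading (kernelOp K) n f ν) {j : ℕ} (hj : j + 1 < n)
    {gap : ℝ} (hgap : 0 < gap) (hgap1 : ν (j + 1) + gap ≤ ν j)
    (hgap2 : ∀ i < j, ν j + gap ≤ ν i) :
    |kernelEigenvalue k (j + 1) - ν j| ≤ ‖K' - K‖ ∧
      |kernelEigenvalue k (j + 1) - ν j - inner ℝ (K' - K) (tensor (f j) (f j))| ≤
        8 / gap * ‖K' - K‖ ^ 2 := by
  obtain ⟨f', ν', h'⟩ := exists_isLeading hK'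
    ⟨_, (h.mono (m := j + 1) (by omega)).orthonormal⟩
  have hD : ∀ x y, |inner ℝ ((kernelOp K' - kernelOp K) x) y| ≤ ‖K' - K‖ * ‖x‖ * ‖y‖ :=
    fun x y => by
      rw [← map_sub]
      exact abs_inner_kernelOp_le _ x y
  rw [h'.kernelEigenvalue_eq hk (Nat.lt_succ_self j)]
  refine ⟨h.abs_sub_le h' (by omega) (Nat.lt_succ_self j) hD, ?_⟩
  have h3 := h.abs_sub_sub_le hK'.symm h' hj (Nat.lt_succ_self j) (norm_nonneg _) hD hgap hgap1
    hgap2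
  rwa [← map_sub, inner_kernelOp] at h3

/-- The passage from `k` to `r = k / N + O(1 / N)` in the first order expansion. -/
lemma abs_mul_sub_div_le {e l x c M k N r : ℝ} (hk : 1 ≤ k) (hkN : k ≤ N * r)
    (hNk : N * r < k + 1) (hN : 0 < N) (hc : 0 ≤ c) (hx0 : 0 ≤ x) (hx : x ≤ M * √k)
    (h1 : |e - l / k| ≤ c * (x / k) ^ 2) (h2 : |l| ≤ x) :
    |r * e - l / N| ≤ (2 * c * M ^ 2 + M) / N := by
  have hk0 : 0 < k := by linarith
  have hr : 0 < r := pos_of_mul_pos_right (hk0.trans_le hkN) hN.le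
  have hsq : √k ^ 2 = k := Real.sq_sqrt hk0.le
  have hsk : 1 ≤ √k := Real.one_le_sqrt.2 hk
  have hx2 : x ^ 2 ≤ M ^ 2 * k := by
    calc x ^ 2 ≤ (M * √k) ^ 2 := by gcongr
      _ = M ^ 2 * k := by rw [mul_pow, hsq]
  have hr2 : r ≤ 2 * k / N := by rw [le_div_iff₀ hN]; nlinarith
  have e1 : r * e - l / N = r * (e - l / k) + l * (r / k - 1 / N) := by ring
  have hA : |r * (e - l / k)| ≤ 2 * c * M ^ 2 / N := by
    rw [abs_mul, abs_of_pos hr]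
    calc r * |e - l / k| ≤ 2 * k / N * (c * (x / k) ^ 2) := by gcongr
      _ = 2 * c * x ^ 2 / (k * N) := by field_simp
      _ ≤ 2 * c * (M ^ 2 * k) / (k * N) := by gcongr
      _ = 2 * c * M ^ 2 / N := by field_simp
  have hB : |l * (r / k - 1 / N)| ≤ M / N := by
    have e2 : r / k - 1 / N = (N * r - k) / (k * N) := by field_simp
    have h3 : |r / k - 1 / N| ≤ 1 / (k * N) := by
      rw [e2, abs_of_nonneg (div_nonneg (by linarith) (by positivity))]
      gcongr
      linarith
    have hM : 0 ≤ M := nonneg_of_mul_nonneg_left (hx0.trans hx) (by positivity)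
    rw [abs_mul]
    calc |l| * |r / k - 1 / N| ≤ M * √k * (1 / (k * N)) := by
          gcongr
          exact h2.trans hx
      _ ≤ M * (√k * √k) * (1 / (k * N)) := by
          gcongr
          nlinarith
      _ = M / N := by
          rw [← pow_two, hsq]
          field_simp
  rw [e1, add_div]
  exact (abs_add_le _ _).trans (add_le_add hA hB)

/-- The weight `√r`, with `r` of order `k / N`, turns `‖S k‖ / k` into a multiple of
`(‖S k‖ / √k) / √N`. -/
lemma abs_sqrt_mul_le {e x M k N r : ℝ} (hk : 1 ≤ k) (hNk : N * r < k + 1)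
    (hN : 0 < N) (hx0 : 0 ≤ x) (hx : x ≤ M * √k) (h : |e| ≤ x / k) :
    |√r * e| ≤ 2 * M / √N := by
  have hk0 : 0 < k := by linarith
  have hsq : √k ^ 2 = k := Real.sq_sqrt hk0.le
  have hM : 0 ≤ M := nonneg_of_mul_nonneg_left (hx0.trans hx) (by positivity)
  have hr2 : √r ≤ 2 * √k / √N := by
    have h4 : r ≤ 4 * k / N := by rw [le_div_iff₀ hN]; nlinarith
    refine (Real.sqrt_le_sqrt h4).trans (le_of_eq ?_)
    rw [Real.sqrt_div (by positivity), Real.sqrt_mul (by norm_num),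
      show (4 : ℝ) = 2 ^ 2 by norm_num, Real.sqrt_sq (by norm_num)]
  rw [abs_mul, abs_of_nonneg (Real.sqrt_nonneg r)]
  calc √r * |e| ≤ 2 * √k / √N * (M * √k / k) := by
        gcongr
        exact h.trans (by gcongr)
    _ = 2 * M * (√k ^ 2) / (k * √N) := by field_simp
    _ = 2 * M / √N := by rw [hsq]; field_simp

section Series

variable {Ω S : Type*} [MeasurableSpace Ω] [MeasurableSpace S] {P : Measure Ω}
  [IsProbabilityMeasure P] {ε : ℤ → Ω → S} {g : (ℕ → S) → L2I} {X : ℤ → Ω → unitInterval → ℝ}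
  {κ : ℝ}

/-- The partial sums of the centred tensor squares of the series. -/
noncomputable def centredSum (P : Measure Ω) (ε : ℤ → Ω → S) (g : (ℕ → S) → L2I) (ω : Ω)
    (k : ℕ) : L2Kernel :=
  ∑ i ∈ Finset.range k, centredTensor (P.map (ε 0)) g (past ε ((i + 1 : ℕ) : ℤ) ω)

lemma sum_tensor_eq (ω : Ω) (k : ℕ) :
    ∑ n ∈ Finset.Icc 1 k, tensor (g (past ε (n : ℤ) ω)) (g (past ε (n : ℤ) ω)) =
      centredSum P ε g ω k + (k : ℝ) • meanTensor (P.map (ε 0)) g := by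
  simp only [centredSum, centredTensor, Finset.sum_sub_distrib, Finset.sum_const,
    Finset.card_range, ← Nat.cast_smul_eq_nsmul ℝ, sub_add_cancel]
  rw [Finset.range_eq_Ico, Finset.sum_Ico_add' (fun n : ℕ =>
    tensor (g (past ε (n : ℤ) ω)) (g (past ε (n : ℤ) ω))) 0 k 1]
  rfl

lemma tensor_path_ae_eq {x : unitInterval → ℝ} {y : L2I} (h : x =ᵐ[volume] y) :
    (fun z : unitInterval × unitInterval => x z.1 * x z.2)
      =ᵐ[(volume : Measure unitInterval).prod volume] tensor y y := by
  filter_upwards [coeFn_tensor y y, Measure.quasiMeasurePreserving_fst.ae_eq h,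
    Measure.quasiMeasurePreserving_snd.ae_eq h] with z h1 h2 h3
  simp only [Function.comp_apply] at h2 h3
  rw [h1, h2, h3]

lemma coeFn_sum_L2Kernel {ι : Type*} (s : Finset ι) (F : ι → L2Kernel) :
    ((∑ i ∈ s, F i : L2Kernel) : unitInterval × unitInterval → ℝ)
      =ᵐ[(volume : Measure unitInterval).prod volume] fun z => ∑ i ∈ s, F i z := by
  classical
  induction s using Finset.induction_on with
  | empty =>
    simp only [Finset.sum_empty]
    exact Lp.coeFn_zero _ _ _
  | insert a s ha ih =>
    rw [Finset.sum_insert ha]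
    filter_upwards [Lp.coeFn_add (F a) (∑ i ∈ s, F i), ih] with z h1 h2
    rw [h1, Pi.add_apply, h2, Finset.sum_insert ha]

lemma empKernel_ae_eq {ω : Ω} (hω : ∀ n, X n ω =ᵐ[volume] g (past ε n ω)) (N : ℕ) (r : ℝ) :
    (fun z : unitInterval × unitInterval => empKernel X N r ω z.1 z.2)
      =ᵐ[(volume : Measure unitInterval).prod volume]
      (((⌊(N : ℝ) * r⌋₊ : ℝ)⁻¹ • ∑ n ∈ Finset.Icc 1 ⌊(N : ℝ) * r⌋₊,
        tensor (g (past ε (n : ℤ) ω)) (g (past ε (n : ℤ) ω)) : L2Kernel) :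
          unitInterval × unitInterval → ℝ) := by
  set k := ⌊(N : ℝ) * r⌋₊ with hk
  filter_upwards [Lp.coeFn_smul (k : ℝ)⁻¹ (∑ n ∈ Finset.Icc 1 k,
      tensor (g (past ε (n : ℤ) ω)) (g (past ε (n : ℤ) ω))),
    coeFn_sum_L2Kernel (Finset.Icc 1 k) fun n : ℕ =>
      tensor (g (past ε (n : ℤ) ω)) (g (past ε (n : ℤ) ω)),
    ae_all_iff.2 fun n : ℕ => tensor_path_ae_eq (hω (n : ℤ))] with z h1 h2 h3
  rw [h1, Pi.smul_apply, h2, smul_eq_mul, empKernel]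
  simp only [← h3, ← hk]

lemma IsApproximableSeries.seqProcess_ae_eq (hX : IsApproximableSeries P ε g X κ) {ω : Ω}
    (hω : ∀ n, X n ω =ᵐ[volume] g (past ε n ω)) (N : ℕ) (r : ℝ) :
    (fun z : unitInterval × unitInterval => seqProcess P X N r ω z.1 z.2)
      =ᵐ[(volume : Measure unitInterval).prod volume]
      (((1 / √(N : ℝ)) • centredSum P ε g ω ⌊(N : ℝ) * r⌋₊ : L2Kernel) :
        unitInterval × unitInterval → ℝ) := by
  set k := ⌊(N : ℝ) * r⌋₊ with hk
  have hS : centredSum P ε g ω k = ∑ n ∈ Finset.Icc 1 k,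
      (tensor (g (past ε (n : ℤ) ω)) (g (past ε (n : ℤ) ω)) - meanTensor (P.map (ε 0)) g) := by
    rw [Finset.sum_sub_distrib, sum_tensor_eq (P := P)]
    simp [← Nat.cast_smul_eq_nsmul ℝ]
  rw [hS]
  filter_upwards [Lp.coeFn_smul (1 / √(N : ℝ)) (∑ n ∈ Finset.Icc 1 k,
      (tensor (g (past ε (n : ℤ) ω)) (g (past ε (n : ℤ) ω)) - meanTensor (P.map (ε 0)) g)),
    coeFn_sum_L2Kernel (Finset.Icc 1 k) fun n : ℕ =>
      tensor (g (past ε (n : ℤ) ω)) (g (past ε (n : ℤ) ω)) - meanTensor (P.map (ε 0)) g,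
    ae_all_iff.2 fun n : ℕ => Lp.coeFn_sub (tensor (g (past ε (n : ℤ) ω)) (g (past ε (n : ℤ) ω)))
      (meanTensor (P.map (ε 0)) g),
    ae_all_iff.2 fun n : ℕ => tensor_path_ae_eq (hω (n : ℤ)), hX.covKernel_ae_eq]
    with z h1 h2 h3 h4 h5
  rw [h1, Pi.smul_apply, h2, smul_eq_mul, seqProcess]
  simp only [h3, Pi.sub_apply, ← h4, ← hk, h5]

/-- On a path, both remainders are controlled by the self-normalized maximum of the norms of the
partial sums. The term `|ν j|` accounts for the fractions `r < 1 / N`, where the empirical kernel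
vanishes. -/
lemma IsApproximableSeries.abs_remainder_le (hX : IsApproximableSeries P ε g X κ) {ω : Ω}
    (hω : ∀ n, X n ω =ᵐ[volume] g (past ε n ω)) {n : ℕ} {f : ℕ → L2I} {ν : ℕ → ℝ}
    (h : IsLeading (kernelOp (meanTensor (P.map (ε 0)) g)) n f ν) {j : ℕ} (hj : j + 1 < n)
    {gap : ℝ} (hgap : 0 < gap) (hgap1 : ν (j + 1) + gap ≤ ν j)
    (hgap2 : ∀ i < j, ν j + gap ≤ ν i) {N : ℕ} (hN : 1 ≤ N) {M : ℝ} (hM0 : 0 ≤ M)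
    (hM : maxRatio (centredSum P ε g ω) N ≤ ENNReal.ofReal M) {r : ℝ} (hr : r ∈ Set.Icc (0 : ℝ) 1) :
    |r * (kernelEigenvalue (empKernel X N r ω) (j + 1) - ν j) -
        (1 / √(N : ℝ)) * ∫ s, ∫ t, seqProcess P X N r ω s t * f j s * f j t| ≤
      (2 * (8 / gap) * M ^ 2 + M + |ν j|) / N ∧
    |√r * (kernelEigenvalue (empKernel X N r ω) (j + 1) - ν j)| ≤ (2 * M + |ν j|) / √(N : ℝ) := by
  have hN0 : (0 : ℝ) < N := by exact_mod_cast hN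
  have hNr : 0 ≤ (N : ℝ) * r := mul_nonneg hN0.le hr.1
  rw [integral_integral_mul_eq_inner (hX.seqProcess_ae_eq hω N r), real_inner_smul_left,
    ← mul_assoc, show 1 / √(N : ℝ) * (1 / √(N : ℝ)) = (N : ℝ)⁻¹ by
      rw [← pow_two, div_pow, Real.sq_sqrt hN0.le, one_pow, one_div], inv_mul_eq_div]
  have hemp := empKernel_ae_eq hω N r
  rw [sum_tensor_eq (P := P)] at hemp
  have hfloor := Nat.floor_le hNr
  have hfloor' := Nat.lt_floor_add_one ((N : ℝ) * r)
  set k := ⌊(N : ℝ) * r⌋₊ with hk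
  rcases Nat.eq_zero_or_pos k with hk0 | hk0
  · -- the empirical kernel vanishes, and so do its eigenvalues
    rw [hk0] at hemp hfloor'
    have hS : centredSum P ε g ω 0 = 0 := by simp [centredSum]
    simp only [hS, Nat.cast_zero, inv_zero, zero_smul] at hemp
    obtain ⟨f', ν', h'⟩ := exists_isLeading zero_mem_positiveKernels
      ⟨_, (h.mono (m := j + 1) (by omega)).orthonormal⟩
    have hz : kernelEigenvalue (empKernel X N r ω) (j + 1) = 0 := by
      rw [h'.kernelEigenvalue_eq hemp (Nat.lt_succ_self j)]
      have h1 := h'.eig j (Nat.lt_succ_self j)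
      simp only [map_zero, zero_apply] at h1
      refine (smul_eq_zero.1 h1.symm).resolve_right fun h2 => ?_
      have h3 := h'.norm_eq (Nat.lt_succ_self j)
      rw [h2, norm_zero] at h3
      exact zero_ne_one h3
    have hr1 : r ≤ 1 / N := by
      rw [le_div_iff₀ hN0]
      simp only [Nat.cast_zero, zero_add] at hfloor'
      linarith
    rw [hk0, hS, inner_zero_left, zero_div, sub_zero, hz, zero_sub, abs_mul, abs_mul, abs_neg,
      abs_of_nonneg hr.1, abs_of_nonneg (Real.sqrt_nonneg r)]
    constructor
    · calc r * |ν j| ≤ 1 / N * |ν j| := by gcongr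
        _ = |ν j| / N := by ring
        _ ≤ _ := by
          gcongr
          have : 0 ≤ 2 * (8 / gap) * M ^ 2 := by positivity
          linarith
    · calc √r * |ν j| ≤ √(1 / N) * |ν j| := by gcongr
        _ = |ν j| / √N := by rw [Real.sqrt_div zero_le_one, Real.sqrt_one]; ring
        _ ≤ _ := by
          gcongr
          linarith
  · have hk1 : (1 : ℝ) ≤ k := by exact_mod_cast hk0
    have hkpos : (0 : ℝ) < k := by linarith
    have hkN : k ≤ N := by
      have : (k : ℝ) ≤ N := hfloor.trans (mul_le_of_le_one_right hN0.le hr.2)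
      exact_mod_cast this
    set T := centredSum P ε g ω k with hT
    have hx : ‖T‖ ≤ M * √(k : ℝ) := by
      have h1 := (le_maxRatio (centredSum P ε g ω) hk0 hkN).trans hM
      rwa [ENNReal.ofReal_le_ofReal_iff hM0, div_le_iff₀ (Real.sqrt_pos.2 hkpos)] at h1
    have hmem : (k : ℝ)⁻¹ • (T + (k : ℝ) • meanTensor (P.map (ε 0)) g) ∈ positiveKernels := by
      rw [hT, ← sum_tensor_eq]
      exact smul_mem_positiveKernels (sum_mem_positiveKernels _ fun i _ =>
        tensor_self_mem_positiveKernels _) (by positivity)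
    have hdiff : (k : ℝ)⁻¹ • (T + (k : ℝ) • meanTensor (P.map (ε 0)) g) -
        meanTensor (P.map (ε 0)) g = (k : ℝ)⁻¹ • T := by
      rw [smul_add, smul_smul, inv_mul_cancel₀ hkpos.ne', one_smul, add_sub_cancel_right]
    obtain ⟨h1, h2⟩ := h.abs_kernelEigenvalue_sub_le hemp hmem hj hgap hgap1 hgap2
    rw [hdiff, norm_smul, norm_inv, Real.norm_natCast, inv_mul_eq_div] at h1 h2
    rw [real_inner_smul_left, inv_mul_eq_div] at h2
    have hl : |inner ℝ T (tensor (f j) (f j))| ≤ ‖T‖ := by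
      refine (abs_real_inner_le_norm _ _).trans (le_of_eq ?_)
      rw [norm_tensor, h.norm_eq (by omega)]
      ring
    constructor
    · refine (abs_mul_sub_div_le hk1 hfloor hfloor' hN0 (by positivity) (norm_nonneg _) hx h2
        hl).trans ?_
      exact div_le_div_of_nonneg_right (by linarith [abs_nonneg (ν j)]) hN0.le
    · refine (abs_sqrt_mul_le hk1 hfloor' hN0 (norm_nonneg _) hx h1).trans ?_
      gcongr
      linarith [abs_nonneg (ν j)]

/-! ### The size of the self-normalized maximum -/

lemma IsApproximableSeries.kappa_gt (hX : IsApproximableSeries P ε g X κ) : 4 < κ := by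
  obtain ⟨_, -, δ, hδ0, -, hκ, -⟩ := hX.approximable
  linarith

lemma natLog_succ_le_four_mul_log {N : ℕ} (hN : 2 ≤ N) :
    ((Nat.log 2 N + 1 : ℕ) : ℝ) ≤ 4 * Real.log N := by
  have h2 : (1 : ℝ) / 2 < Real.log 2 := by linarith [Real.log_two_gt_d9]
  have hlog : Real.log 2 ≤ Real.log N := Real.log_le_log (by norm_num) (by exact_mod_cast hN)
  have h1 : (Nat.log 2 N : ℝ) * Real.log 2 ≤ Real.log N := by
    rw [← Real.log_pow]
    refine Real.log_le_log (by positivity) ?_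
    exact_mod_cast Nat.pow_log_le_self 2 (by omega)
  push_cast
  nlinarith [(Nat.cast_nonneg (Nat.log 2 N) : (0 : ℝ) ≤ _)]

/-- Markov's inequality for the self-normalized maximum. The moment order `2 s` of the maximal
inequality is taken at least `κ`, so that the power of `log N` is at most `1 / κ`. -/
lemma IsApproximableSeries.exists_measure_maxRatio_gt_le (hX : IsApproximableSeries P ε g X κ) :
    ∃ K : ℝ, 0 ≤ K ∧ ∀ N : ℕ, 2 ≤ N → ∀ a : ℝ, 0 < a →
      P {ω | ENNReal.ofReal a < maxRatio (centredSum P ε g ω) N} ≤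
        ENNReal.ofReal (K * Real.log N ^ (1 / κ) / a) := by
  have := hX.isProbabilityMeasure
  have hκ := hX.kappa_gt
  have hs1 : 1 ≤ ⌈κ⌉₊ := Nat.one_le_iff_ne_zero.2 (Nat.ceil_pos.2 (by linarith)).ne'
  have hm := measurable_centredTensor (μ := P.map (ε 0)) hX.measurable_g
  obtain ⟨K, hK, hmax⟩ := exists_lintegral_maxRatio_shift_le ⌈κ⌉₊ hs1 hX.measurable_innovation
    hX.iIndep_innovation hX.map_innovation hm
    (memLp_centredTensor hX.memLp_four) (integral_centredTensor hX.memLp_four)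
    hX.tsum_resamplingError_ne_top
  refine ⟨4 * K, by positivity, fun N hN a ha => ?_⟩
  have hlog : 0 ≤ Real.log N := Real.log_natCast_nonneg N
  have hL := hmax (Nat.log 2 N + 1) N (by omega) (Nat.lt_pow_succ_log_self one_lt_two N)
  have hexp : K * ((Nat.log 2 N + 1 : ℕ) : ℝ) ^ ((2 * ⌈κ⌉₊ : ℕ) : ℝ)⁻¹ ≤
      4 * K * Real.log N ^ (1 / κ) := by
    have hle : ((2 * ⌈κ⌉₊ : ℕ) : ℝ)⁻¹ ≤ 1 / κ := by
      rw [← one_div]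
      refine one_div_le_one_div_of_le (by linarith) ?_
      push_cast
      linarith [Nat.le_ceil κ]
    have h4 : (4 : ℝ) ^ (1 / κ) ≤ 4 := by
      refine (Real.rpow_le_rpow_of_exponent_le (by norm_num) ?_).trans (Real.rpow_one 4).le
      rw [div_le_one (by linarith)]
      linarith
    calc K * ((Nat.log 2 N + 1 : ℕ) : ℝ) ^ ((2 * ⌈κ⌉₊ : ℕ) : ℝ)⁻¹
        ≤ K * ((Nat.log 2 N + 1 : ℕ) : ℝ) ^ (1 / κ) := by
          gcongr
          exact_mod_cast Nat.le_add_left 1 _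
      _ ≤ K * (4 * Real.log N) ^ (1 / κ) := by
          gcongr
          exact natLog_succ_le_four_mul_log hN
      _ = K * (4 ^ (1 / κ) * Real.log N ^ (1 / κ)) := by rw [Real.mul_rpow (by norm_num) hlog]
      _ ≤ K * (4 * Real.log N ^ (1 / κ)) := by gcongr
      _ = _ := by ring
  have hmeas : Measurable fun ω => maxRatio (centredSum P ε g ω) N :=
    measurable_maxRatio (T := fun k ω => centredSum P ε g ω k) (fun k =>
      Finset.measurable_sum _ fun i _ =>
        hm.comp (measurable_past hX.measurable_innovation _)) N
  have ha' : ENNReal.ofReal a ≠ 0 := by simpa using ha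
  calc P {ω | ENNReal.ofReal a < maxRatio (centredSum P ε g ω) N}
      ≤ P {ω | ENNReal.ofReal a ≤ maxRatio (centredSum P ε g ω) N} :=
        measure_mono (Set.ofPred_subset_ofPred.2 fun _ => le_of_lt)
    _ ≤ (∫⁻ ω, maxRatio (centredSum P ε g ω) N ∂P) / ENNReal.ofReal a :=
        meas_ge_le_lintegral_div hmeas.aemeasurable ha' ENNReal.ofReal_ne_top
    _ ≤ ENNReal.ofReal (4 * K * Real.log N ^ (1 / κ)) / ENNReal.ofReal a :=
        ENNReal.div_le_div_right (hL.trans (ENNReal.ofReal_le_ofReal hexp)) _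
    _ = _ := (ENNReal.ofReal_div_of_pos ha).symm

end Series

/-! ### Sizes in probability -/

section Sizes

variable {Ω : Type*} [MeasurableSpace Ω] {P : Measure Ω} {M Y : ℕ → Ω → ℝ≥0∞} {K κ : ℝ}

/-- A quantity that is at most quadratic in a slowly growing maximum, divided by `N`. -/
lemma isLittleOP_of_le_maximum (hM : ∀ N : ℕ, 2 ≤ N → ∀ a : ℝ, 0 < a →
      P {ω | ENNReal.ofReal a < M N ω} ≤ ENNReal.ofReal (K * Real.log N ^ (1 / κ) / a))
    {b c : ℝ} (hb : 0 ≤ b) (hc : 0 ≤ c)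
    (hY : ∀ N : ℕ, 1 ≤ N → ∀ a : ℝ, 0 ≤ a → ∀ᵐ ω ∂P, M N ω ≤ ENNReal.ofReal a →
      Y N ω ≤ ENNReal.ofReal ((b * a ^ 2 + a + c) / N)) :
    IsLittleOP P Y fun N => 1 / √(N : ℝ) := by
  intro η hη
  -- any power of `N` below `1 / 4` serves as the level for the maximum
  have hlim : Tendsto (fun N : ℕ => ENNReal.ofReal
      (K * Real.log N ^ (1 / κ) / (N : ℝ) ^ (1 / 8 : ℝ))) atTop (𝓝 0) := by
    have h1 : Tendsto (fun x : ℝ => Real.log x ^ (1 / κ) / x ^ (1 / 8 : ℝ)) atTop (𝓝 0) :=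
      (isLittleO_log_rpow_rpow_atTop (1 / κ) (by norm_num)).tendsto_div_nhds_zero
    have h2 := ENNReal.tendsto_ofReal ((h1.comp tendsto_natCast_atTop_atTop).const_mul K)
    simp only [mul_zero, ENNReal.ofReal_zero] at h2
    exact h2.congr fun N => by simp only [Function.comp_apply, mul_div_assoc]
  have hsmall : ∀ᶠ N : ℕ in atTop, (b + 1 + c) * (N : ℝ) ^ (-(1 / 4) : ℝ) ≤ η := by
    have h1 := ((tendsto_rpow_neg_atTop (y := (1 / 4 : ℝ)) (by norm_num)).comp
      tendsto_natCast_atTop_atTop).const_mul (b + 1 + c)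
    rw [mul_zero] at h1
    exact (h1.eventually (ge_mem_nhds hη)).mono fun N h => h
  refine tendsto_of_tendsto_of_tendsto_of_le_of_le' tendsto_const_nhds hlim
    (Eventually.of_forall fun _ => zero_le) ?_
  filter_upwards [hsmall, eventually_ge_atTop 2] with N hN hN2
  have hN1 : (1 : ℝ) ≤ N := by exact_mod_cast (by omega : 1 ≤ N)
  have hN0 : (0 : ℝ) < N := by linarith
  refine le_trans (measure_mono_ae ?_) (hM N hN2 ((N : ℝ) ^ (1 / 8 : ℝ)) (by positivity))
  filter_upwards [hY N (by omega) ((N : ℝ) ^ (1 / 8 : ℝ)) (by positivity)] with ω hω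
    (hgt : ENNReal.ofReal (η * (1 / √(N : ℝ))) < Y N ω)
  show ENNReal.ofReal _ < M N ω
  by_contra hle
  refine (hgt.trans_le (hω (not_lt.1 hle))).not_ge (ENNReal.ofReal_le_ofReal ?_)
  set q := (N : ℝ) ^ (1 / 4 : ℝ) with hq
  have hq1 : 1 ≤ q := Real.one_le_rpow hN1 (by norm_num)
  have hsq : ((N : ℝ) ^ (1 / 8 : ℝ)) ^ 2 = q := by
    rw [hq, ← Real.rpow_natCast, ← Real.rpow_mul hN0.le]; norm_num
  have hle8 : (N : ℝ) ^ (1 / 8 : ℝ) ≤ q := Real.rpow_le_rpow_of_exponent_le hN1 (by norm_num)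
  have hsqrt : √(N : ℝ) = q * q := by
    rw [Real.sqrt_eq_rpow, hq, ← Real.rpow_add hN0]; norm_num
  have hNq : (N : ℝ) = (q * q) * (q * q) := by rw [← hsqrt, Real.mul_self_sqrt hN0.le]
  rw [Real.rpow_neg hN0.le, ← hq] at hN
  rw [hsq, hsqrt]
  calc (b * q + (N : ℝ) ^ (1 / 8 : ℝ) + c) / N ≤ (b * q + q + c * q) / N := by
        gcongr
        exact le_mul_of_one_le_right hc hq1
    _ = (b + 1 + c) * q⁻¹ * (1 / (q * q)) := by
        rw [hNq]
        field_simp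
    _ ≤ η * (1 / (q * q)) := by gcongr

/-- A quantity that is at most linear in a slowly growing maximum, divided by `√N`. -/
lemma isBigOP_of_le_maximum (hK : 0 ≤ K) (hκ : 0 < κ) (hM : ∀ N : ℕ, 2 ≤ N → ∀ a : ℝ, 0 < a →
      P {ω | ENNReal.ofReal a < M N ω} ≤ ENNReal.ofReal (K * Real.log N ^ (1 / κ) / a))
    {c : ℝ} (hc : 0 ≤ c)
    (hY : ∀ N : ℕ, 1 ≤ N → ∀ a : ℝ, 0 ≤ a → ∀ᵐ ω ∂P, M N ω ≤ ENNReal.ofReal a →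
      Y N ω ≤ ENNReal.ofReal ((2 * a + c) / √(N : ℝ))) :
    IsBigOP P Y fun N => Real.log N ^ (1 / κ) / √(N : ℝ) := by
  intro η hη
  set A := K / η + 1 with hA
  have hA0 : 0 < A := by positivity
  refine ⟨2 * A + c, by positivity, ?_⟩
  filter_upwards [eventually_ge_atTop 3] with N hN
  have hlog : 1 ≤ Real.log N := by
    rw [Real.le_log_iff_exp_le (by exact_mod_cast (by omega : 0 < N))]
    exact Real.exp_one_lt_d9.le.trans (le_trans (by norm_num) (by exact_mod_cast hN : (3 : ℝ) ≤ N))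
  set l := Real.log N ^ (1 / κ) with hl
  have hl1 : 1 ≤ l := Real.one_le_rpow hlog (by positivity)
  have hl0 : 0 < l := by linarith
  calc P {ω | ENNReal.ofReal ((2 * A + c) * (l / √(N : ℝ))) < Y N ω}
      ≤ P {ω | ENNReal.ofReal (A * l) < M N ω} := by
        refine measure_mono_ae ?_
        filter_upwards [hY N (by omega) (A * l) (by positivity)] with ω hω
          (hgt : ENNReal.ofReal ((2 * A + c) * (l / √(N : ℝ))) < Y N ω)
        show ENNReal.ofReal _ < M N ω
        by_contra hle
        refine (hgt.trans_le (hω (not_lt.1 hle))).not_ge (ENNReal.ofReal_le_ofReal ?_)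
        rw [← mul_div_assoc]
        gcongr
        nlinarith
    _ ≤ ENNReal.ofReal (K * l / (A * l)) := hM N (by omega) _ (by positivity)
    _ ≤ ENNReal.ofReal η := by
        refine ENNReal.ofReal_le_ofReal ?_
        rw [mul_div_mul_right _ _ hl0.ne', div_le_iff₀ hA0, hA, mul_add, mul_div_cancel₀ _ hη.ne']
        linarith

end Sizes

theorem propositionB2 {Ω S : Type*} [MeasurableSpace Ω] [MeasurableSpace S]
    (P : Measure Ω) [IsProbabilityMeasure P]
    (ε : ℤ → Ω → S) (g : (ℕ → S) → L2I) (X : ℤ → Ω → unitInterval → ℝ) (κ : ℝ)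
    (hX : IsApproximableSeries P ε g X κ)
    (p : ℕ)
    (hτ : ∀ i ∈ Finset.Icc 1 p,
      kernelEigenvalue (covKernel P X) (i + 1) < kernelEigenvalue (covKernel P X) i)
    (hτ_pos : 0 < kernelEigenvalue (covKernel P X) (p + 1))
    (j : ℕ) (hj : j ∈ Finset.Icc 1 p)
    (v : L2I) (hv : ‖v‖ = 1)
    (hv_eig : IsEigenfunction (covKernel P X) (kernelEigenvalue (covKernel P X) j) v) :
    IsLittleOP P
      (fun N ω => ⨆ r ∈ Set.Icc (0 : ℝ) 1,
        ‖r * (kernelEigenvalue (empKernel X N r ω) j - kernelEigenvalue (covKernel P X) j)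
          - (1 / √(N : ℝ)) * ∫ s, ∫ t, seqProcess P X N r ω s t * v s * v t‖ₑ)
      (fun N => 1 / √(N : ℝ)) ∧
    IsBigOP P
      (fun N ω => ⨆ r ∈ Set.Icc (0 : ℝ) 1,
        ‖√r * (kernelEigenvalue (empKernel X N r ω) j - kernelEigenvalue (covKernel P X) j)‖ₑ)
      (fun N => Real.log N ^ (1 / κ) / √(N : ℝ)) := by
  have := hX.isProbabilityMeasure
  obtain ⟨hj1, hjp⟩ := Finset.mem_Icc.1 hj
  obtain ⟨i, rfl⟩ : ∃ i, j = i + 1 := ⟨j - 1, by omega⟩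
  obtain ⟨f, ν, gap, hlead, hfv, hgap, hgap1, hgap2⟩ :=
    exists_isLeading_through_eigenfunction hX.covKernel_ae_eq
      (meanTensor_mem_positiveKernels hX.memLp_four) hτ hτ_pos hjp hv hv_eig
  rw [hlead.kernelEigenvalue_eq hX.covKernel_ae_eq (by omega : i < p + 1), ← hfv]
  obtain ⟨K, hK, hmax⟩ := hX.exists_measure_maxRatio_gt_le
  have hgood : ∀ᵐ ω ∂P, ∀ n, X n ω =ᵐ[volume] g (past ε n ω) := ae_all_iff.2 hX.eq_shift
  constructor
  · refine isLittleOP_of_le_maximum hmax (b := 2 * (8 / gap)) (c := |ν i|) (by positivity)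
      (abs_nonneg _) fun N hN a ha => ?_
    filter_upwards [hgood] with ω hω hle
    refine iSup₂_le fun r hr => ?_
    rw [Real.enorm_eq_ofReal_abs]
    exact ENNReal.ofReal_le_ofReal (hX.abs_remainder_le hω hlead (by omega) hgap hgap1 hgap2 hN ha
      hle hr).1
  · refine isBigOP_of_le_maximum hK (by linarith [hX.kappa_gt]) hmax (c := |ν i|)
      (abs_nonneg _) fun N hN a ha => ?_
    filter_upwards [hgood] with ω hω hle
    refine iSup₂_le fun r hr => ?_
    rw [Real.enorm_eq_ofReal_abs]
    exact ENNReal.ofReal_le_ofReal (hX.abs_remainder_le hω hlead (by omega) hgap hgap1 hgap2 hN ha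
      hle hr).2
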